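/- **Setting.** Let $G$ be a locally compact, second countable, Hausdorff group; all Hilbert spaces are complex and separable, $\otimes$ is the Hilbert space tensor product, and all representations are strongly continuous and unitary. Write $\mathcal S(H)$ for the density operators on $H$, and $g.A=U(g)AU(g)^*$. An *effect* is an operator $F$ with $0\le F\le 1$. A *principal frame* $R_i=(H_i,U_i,E_i)$ consists of a representation $U_i$ of $G$ on $H_i$ and a normalized positive operator-valued measure $E_i$ on the Borel sets of $G$ with $E_i(gX)=g.E_i(X)$. It is *localizable* if for every Borel set $X$ with $E_i(X)\neq0$ and every $\varepsilon>0$ there is a unit vector $\xi\in H_i$ with $\langle\xi,E_i(X)\xi\rangle>1-\varepsilon$. A *localizing sequence* for $R_i$ is a sequence of pure states $\omega_n=|\xi_n\rangle\langle\xi_n|$ on $H_i$ such that the probability measures $X\mapsto\langle\xi_n,E_i(X)\xi_n\rangle$ converge weakly to the Dirac measure at $e\in G$. Suppose that the total space is $\mathcal H_T\cong H_i\otimes K_i$, where $K_i$ is the tensor product of the remaining factors with its product representation. The *relativization* $\yen^{R_i}:B(K_i)\to B(\mathcal H_T)$ is $\yen^{R_i}(A)=\int_G dE_i(g)\otimes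 g.A$ (weak integral). For a state $\omega$ on $H_i$, $\Gamma_\omega:B(\mathcal H_T)\to B(K_i)$ is the normal map with $\Gamma_\omega(A\otimes B)=\operatorname{tr}(\omega A)B$, and $\mathcal L^{R_i}_\omega=(\yen^{R_i}\circ\Gamma_\omega)_*$ is the predual (lifting) map, $\mathcal L^{R_i}_\omega(\Omega)=\omega\otimes\yen^{R_i}_*(\Omega)$. For a set $O\subset B(\mathcal H_T)$ of effects put $\Omega\sim_O\Omega'$ iff $\operatorname{tr}(\Omega F)=\operatorname{tr}(\Omega'F)$ for all $F\in O$, and let $\mathcal S(\mathcal H_T)/{\sim_O}$ be the set of classes $[\Omega]_O$ of density operators, a convex subset of the self-adjoint trace-class operators modulo $\sim_O$. There, $x_n\to x$ in the *operational topology* means convergence of the expectation values of all operators in the ultraweakly closed linear span of $O$. A *state space* is a convex subset of a real vector space whose points are separated by its affine $[0,1]$-valued functionals; a *state space map* is an affine map between state spaces. The following state spaces are used. * Global states $\mathcal S(\mathcal H_T)_G$: $O$ is the set of $G$-invariant effects. * $R_i$-relative states $\mathcal S^{R_i}$: $O=\{\yen^{R_i}(F): F \text{ an effect on } K_i\}$.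 Relative states are identified with these classes, so that $\yen^{R_i}_*:\mathcal S(\mathcal H_T)_G\to\mathcal S^{R_i}$ is $[\Omega]_G\mapsto[\Omega]_{O}$. * $R_j$-framed $R_i$-relative states $\mathcal S^{R_i}_{E_j}$: $O$ is the set of effects in the ultraweakly closed linear span of the operators $\yen^{R_i}(E_j(X)\otimes F)$, with $X$ Borel and $F$ an effect on the tensor product of the remaining factors. * Doubly framed states $\mathcal S^{R_i}_{E_j,E_k}$: the same, with $\yen^{R_i}(E_j(X)\otimes E_k(Y)\otimes F)$. $\pi_{E_j}$ denotes the canonical projections $\mathcal S^{R_i}\to\mathcal S^{R_i}_{E_j}$ and $\mathcal S^{R_i}_{E_k}\to\mathcal S^{R_i}_{E_j,E_k}$, $[\Omega]\mapsto[\Omega]$. For $R_i$ localizable, the *frame-change map* is $$\Phi_{i\to j}:\ [\Omega]\longmapsto\lim_{n\to\infty}[\mathcal L^{R_i}_{\omega_n}(\Omega)],\qquad \text{that is}\quad \Phi_{i\to j}=\lim_n \pi_{E_i}\circ\yen^{R_j}_*\circ\mathcal L^{R_i}_{\omega_n},$$ with $(\omega_n)$ any localizing sequence for $R_i$ and the limit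 taken in the operational topology. It is a map $\mathcal S^{R_i}_{E_j}\to\mathcal S^{R_j}_{E_i}$ and, with a further frame $R_k$ taken into account, $\mathcal S^{R_i}_{E_j,E_k}\to\mathcal S^{R_j}_{E_i,E_k}$, given by the same formula. It is called a *well-defined state space map* if $\mathcal L^{R_i}_{\omega}$ maps density operators to density operators for every pure state $\omega$, the limit exists for every class and every localizing sequence, is independent of the representative $\Omega$ and of the localizing sequence, lies in the target state space, is determined uniquely by this, and $\Phi_{i\to j}$ is affine between state spaces. **Theorem.** Let $R_1,R_2$ be principal frames, let $H_S$ carry a representation of $G$, let $\mathcal H_T=H_1\otimes H_2\otimes H_S$, and let $R_1$ be localizable. 1. $\Phi_{1\to2}:\mathcal S^{R_1}_{E_2}\to\mathcal S^{R_2}_{E_1}$ is a well-defined state space map, and on $\mathcal S(\mathcal H_T)_G$ $$\Phi_{1\to2}\circ\pi_{E_2}\circ\yen^{R_1}_*=\pi_{E_1}\circ\yen^{R_2}_*.$$ 2. If $R_2$ is localizable as well, then $\Phi_{2\to1}:\mathcal S^{R_2}_{E_1}\to\mathcal S^{R_1}_{E_2}$ is also a well-defined state space map and is the inverse of $\Phi_{1\to2}$;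 in particular $\Phi_{2\to1}\circ\Phi_{1\to2}=\mathrm{Id}$. 3. Let $R_1$ and $R_2$ be localizable, let $R_3$ be an arbitrary principal frame, and let $\mathcal H_T=H_1\otimes H_2\otimes H_3\otimes H_S$. Then the frame-change maps $\Phi_{1\to2}$ (on $\mathcal S^{R_1}_{E_2}$ and on $\mathcal S^{R_1}_{E_2,E_3}$), $\Phi_{1\to3}$ (on $\mathcal S^{R_1}_{E_3}$) and $\Phi_{2\to3}:\mathcal S^{R_2}_{E_1,E_3}\to\mathcal S^{R_3}_{E_1,E_2}$ are well-defined state space maps, and $$\pi_{E_2}\circ\Phi_{1\to3}=\Phi_{2\to3}\circ\Phi_{1\to2}$$ in both of the following senses: for every density operator $\Omega$ on $\mathcal H_T$, $\pi_{E_2}(\Phi_{1\to3}([\Omega]_{\mathcal S^{R_1}_{E_3}}))=\Phi_{2\to3}(\pi_{E_3}(\Phi_{1\to2}([\Omega]_{\mathcal S^{R_1}_{E_2}})))$; and $\pi_{E_2}\circ\Phi_{1\to3}=\Phi_{2\to3}\circ\Phi_{1\to2}\circ\pi_{E_2}$ as maps $\mathcal S^{R_1}_{E_3}\to\mathcal S^{R_3}_{E_1,E_2}$,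 with $\Phi_{1\to2}$ on the doubly framed space. -/

import Mathlib

open scoped TensorProduct InnerProductSpace Topology
open UniformSpace MeasureTheory Filter TopologicalSpace

namespace QRF

noncomputable section

/-- The Hilbert space tensor product: the completion of the algebraic tensor product of two
inner product spaces. -/
def HTensor (E F : Type*) [NormedAddCommGroup E] [InnerProductSpace ℂ E]
    [NormedAddCommGroup F] [InnerProductSpace ℂ F] := Completion (E ⊗[ℂ] F)

infixr:70 " ⊗ₕ " => HTensor

section Tensor
variable {E F E' F' : Type*} [NormedAddCommGroup E] [InnerProductSpace ℂ E]
  [NormedAddCommGroup F] [InnerProductSpace ℂ F]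
  [NormedAddCommGroup E'] [InnerProductSpace ℂ E']
  [NormedAddCommGroup F'] [InnerProductSpace ℂ F']

instance : NormedAddCommGroup (E ⊗ₕ F) :=
  inferInstanceAs (NormedAddCommGroup (Completion (E ⊗[ℂ] F)))

instance : InnerProductSpace ℂ (E ⊗ₕ F) :=
  inferInstanceAs (InnerProductSpace ℂ (Completion (E ⊗[ℂ] F)))

instance : CompleteSpace (E ⊗ₕ F) :=
  inferInstanceAs (CompleteSpace (Completion (E ⊗[ℂ] F)))

/-- The inclusion of the algebraic tensor product. -/
def toH : E ⊗[ℂ] F →ₗᵢ[ℂ] E ⊗ₕ F := Completion.toComplₗᵢ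

theorem denseRange_toH : DenseRange (toH : E ⊗[ℂ] F → E ⊗ₕ F) := Completion.denseRange_coe

/-- The operator `A ⊗ B` on Hilbert space tensor products. -/
def hmap (A : E →L[ℂ] E') (B : F →L[ℂ] F') : E ⊗ₕ F →L[ℂ] E' ⊗ₕ F' :=
  (TensorProduct.mapL A B).completion

theorem hmap_toH (A : E →L[ℂ] E') (B : F →L[ℂ] F') (t : E ⊗[ℂ] F) :
    hmap A B (toH t) = toH (TensorProduct.mapL A B t) :=
  ContinuousLinearMap.completion_apply_coe _ t

/-- The continuous extension of a continuous linear map on the algebraic tensor product. -/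
def fromH {W : Type*} [NormedAddCommGroup W] [NormedSpace ℂ W] [CompleteSpace W]
    (f : E ⊗[ℂ] F →L[ℂ] W) : E ⊗ₕ F →L[ℂ] W :=
  ContinuousLinearMap.fromCompletion f

theorem fromH_toH {W : Type*} [NormedAddCommGroup W] [NormedSpace ℂ W] [CompleteSpace W]
    (f : E ⊗[ℂ] F →L[ℂ] W) (t : E ⊗[ℂ] F) : fromH f (toH t) = f t :=
  ContinuousLinearMap.fromCompletion_apply_coe f t

theorem hmap_tmul (A : E →L[ℂ] E') (B : F →L[ℂ] F') (x : E) (y : F) :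
    hmap A B (toH (x ⊗ₜ[ℂ] y)) = (toH (A x ⊗ₜ[ℂ] B y)) := by
  simp [hmap_toH]

theorem hTensor_dense : Dense (Submodule.span ℂ
    {z : E ⊗ₕ F | ∃ x y, z = (toH (x ⊗ₜ[ℂ] y))} : Set (E ⊗ₕ F)) := by
  refine denseRange_toH.mono ?_
  rintro _ ⟨t, rfl⟩
  induction t with
  | zero => rw [map_zero]; exact zero_mem _
  | tmul x y => exact Submodule.subset_span ⟨x, y, rfl⟩
  | add a b ha hb => rw [map_add]; exact add_mem ha hb

theorem hmap_ext {W : Type*} [NormedAddCommGroup W] [NormedSpace ℂ W] {f g : E ⊗ₕ F →L[ℂ] W}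
    (h : ∀ x y, f (toH (x ⊗ₜ[ℂ] y)) = g (toH (x ⊗ₜ[ℂ] y))) :
    f = g := by
  refine ContinuousLinearMap.ext_on hTensor_dense ?_
  rintro _ ⟨x, y, rfl⟩
  exact h x y

theorem hmap_comp {E'' F'' : Type*} [NormedAddCommGroup E''] [InnerProductSpace ℂ E'']
    [NormedAddCommGroup F''] [InnerProductSpace ℂ F'']
    (A' : E' →L[ℂ] E'') (B' : F' →L[ℂ] F'') (A : E →L[ℂ] E') (B : F →L[ℂ] F') :
    hmap A' B' ∘L hmap A B = hmap (A' ∘L A) (B' ∘L B) :=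
  hmap_ext fun x y => by simp [hmap_tmul]

theorem hmap_one : hmap (1 : E →L[ℂ] E) (1 : F →L[ℂ] F) = 1 :=
  hmap_ext fun x y => by simp [hmap_tmul]

theorem inner_ext_tensor {f g : E ⊗ₕ F →L[ℂ] E' ⊗ₕ F'}
    (h : ∀ x y x' y', ⟪(toH (x' ⊗ₜ[ℂ] y')), f (toH (x ⊗ₜ[ℂ] y))⟫_ℂ
      = ⟪(toH (x' ⊗ₜ[ℂ] y')), g (toH (x ⊗ₜ[ℂ] y))⟫_ℂ) :
    f = g := by
  refine hmap_ext fun x y => ?_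
  refine ext_inner_left ℂ fun v => ?_
  have : (innerSL ℂ).flip (f (toH (x ⊗ₜ[ℂ] y))) = (innerSL ℂ).flip (g (toH (x ⊗ₜ[ℂ] y))) := by
    refine ContinuousLinearMap.ext_on hTensor_dense ?_
    rintro _ ⟨x', y', rfl⟩
    simpa using h x y x' y'
  simpa using congrArg (fun k => k v) this

theorem adjoint_hmap [CompleteSpace E] [CompleteSpace F] [CompleteSpace E'] [CompleteSpace F']
    (A : E →L[ℂ] E') (B : F →L[ℂ] F') :
    ContinuousLinearMap.adjoint (hmap A B)
      = hmap (ContinuousLinearMap.adjoint A) (ContinuousLinearMap.adjoint B) := by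
  refine inner_ext_tensor fun x y x' y' => ?_
  rw [ContinuousLinearMap.adjoint_inner_right, hmap_tmul, hmap_tmul, toH.inner_map_map,
    toH.inner_map_map, TensorProduct.inner_tmul, TensorProduct.inner_tmul,
    ContinuousLinearMap.adjoint_inner_right, ContinuousLinearMap.adjoint_inner_right]

end Tensor

theorem hmap_mem_unitary {H K : Type*} [NormedAddCommGroup H] [InnerProductSpace ℂ H]
    [CompleteSpace H] [NormedAddCommGroup K] [InnerProductSpace ℂ K]
    [CompleteSpace K] {A : H →L[ℂ] H} {B : K →L[ℂ] K} (hA : A ∈ unitary (H →L[ℂ] H))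
    (hB : B ∈ unitary (K →L[ℂ] K)) : hmap A B ∈ unitary (H ⊗ₕ K →L[ℂ] H ⊗ₕ K) := by
  rw [Unitary.mem_iff] at *
  simp only [ContinuousLinearMap.star_eq_adjoint, ContinuousLinearMap.mul_def] at *
  rw [adjoint_hmap, hmap_comp, hmap_comp, hA.1, hA.2, hB.1, hB.2]
  exact ⟨hmap_one, hmap_one⟩

/-- A decomposition `T ≅ R ⊗ K` of a Hilbert space into a distinguished factor `R` and the remaining
factor `K`. It is recorded by the map `(r, k) ↦ slot r k`, which plays the role of `r ⊗ k`: it is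
bilinear, multiplies inner products, and has total range, i.e. it extends to a unitary from the
Hilbert tensor product `R ⊗ K` onto `T`. Only the decompositions `first` and `skip` of concrete
tensor products are used. -/
structure TensorSplit (R K T : Type*) [NormedAddCommGroup R] [InnerProductSpace ℂ R]
    [NormedAddCommGroup K] [InnerProductSpace ℂ K] [NormedAddCommGroup T]
    [InnerProductSpace ℂ T] where
  slot : R →ₗ[ℂ] (K →L[ℂ] T)
  inner_slot : ∀ r r' k k', ⟪slot r k, slot r' k'⟫_ℂ = ⟪r, r'⟫_ℂ * ⟪k, k'⟫_ℂ
  dense_slot : Dense (Submodule.span ℂ {t : T | ∃ r k, t = slot r k} : Set T)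

namespace TensorSplit
variable {R K T A : Type*} [NormedAddCommGroup R] [InnerProductSpace ℂ R]
  [NormedAddCommGroup K] [InnerProductSpace ℂ K] [NormedAddCommGroup T] [InnerProductSpace ℂ T]
  [NormedAddCommGroup A] [InnerProductSpace ℂ A]

/-- `R ⊗ K`, with the first factor distinguished. -/
def first (R K : Type*) [NormedAddCommGroup R] [InnerProductSpace ℂ R]
    [NormedAddCommGroup K] [InnerProductSpace ℂ K] : TensorSplit R K (R ⊗ₕ K) where
  slot :=
    { toFun := fun r => toH.toContinuousLinearMap ∘L TensorProduct.mkL ℂ R K r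
      map_add' := fun r r' => by ext k; simp
      map_smul' := fun c r => by ext k; simp }
  inner_slot := fun r r' k k' => by simp [toH.inner_map_map]
  dense_slot := by
    have := hTensor_dense (E := R) (F := K)
    simpa using this

/-- If `T ≅ R ⊗ K`, then `A ⊗ T ≅ R ⊗ (A ⊗ K)`, with `r ⊗ (a ⊗ k)` placed at `a ⊗ (r ⊗ k)`. -/
def skip (A : Type*) [NormedAddCommGroup A] [InnerProductSpace ℂ A] (D : TensorSplit R K T) :
    TensorSplit R (A ⊗ₕ K) (A ⊗ₕ T) where
  slot :=
    { toFun := fun r => hmap (ContinuousLinearMap.id ℂ A) (D.slot r)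
      map_add' := fun r r' => hmap_ext fun x y => by
        simp [hmap_tmul, TensorProduct.tmul_add, map_add]
      map_smul' := fun c r => hmap_ext fun x y => by
        simp [hmap_tmul, TensorProduct.tmul_smul, map_smul] }
  inner_slot := fun r r' k k' => by
    dsimp only [LinearMap.coe_mk, AddHom.coe_mk]
    refine denseRange_toH.induction_on₂ (isClosed_eq (by fun_prop) (by fun_prop)) ?_ k k'
    intro x y
    induction x with
    | zero => rw [map_zero, map_zero, inner_zero_left, inner_zero_left, mul_zero]
    | add x x' hx hx' =>
      simp only [map_add, map_add, inner_add_left, hx, hx', mul_add]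
    | tmul a k =>
      induction y with
      | zero => rw [map_zero, map_zero, inner_zero_right, inner_zero_right, mul_zero]
      | add x x' hx hx' =>
        simp only [map_add, map_add, inner_add_right, hx, hx', mul_add]
      | tmul a' k' =>
        simp only [hmap_tmul, toH.inner_map_map, TensorProduct.inner_tmul, D.inner_slot,
          ContinuousLinearMap.id_apply]
        ring
  dense_slot := by
    set M : Submodule ℂ (A ⊗ₕ T) := Submodule.span ℂ
      {t : A ⊗ₕ T | ∃ r k, t = hmap (ContinuousLinearMap.id ℂ A) (D.slot r) k}
    have key : ∀ (a : A) (t : T), (toH (a ⊗ₜ[ℂ] t)) ∈ M.topologicalClosure := by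
      intro a t
      let f : T →L[ℂ] A ⊗ₕ T := (first A T).slot a
      have hsub : Submodule.span ℂ {t : T | ∃ r k, t = D.slot r k} ≤
          M.topologicalClosure.comap (f : T →ₗ[ℂ] A ⊗ₕ T) := by
        refine Submodule.span_le.mpr ?_
        rintro _ ⟨r, k, rfl⟩
        refine M.le_topologicalClosure (Submodule.subset_span
          ⟨r, (toH (a ⊗ₜ[ℂ] k)), ?_⟩)
        rw [hmap_tmul]
        rfl
      have hcl : IsClosed ((M.topologicalClosure.comap (f : T →ₗ[ℂ] A ⊗ₕ T) : Submodule ℂ T) :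
          Set T) := M.isClosed_topologicalClosure.preimage f.continuous
      exact (hcl.closure_subset_iff.mpr hsub) (D.dense_slot t)
    have hle : Submodule.span ℂ {z : A ⊗ₕ T | ∃ x y, z = (toH (x ⊗ₜ[ℂ] y))} ≤
        M.topologicalClosure := by
      refine Submodule.span_le.mpr ?_
      rintro _ ⟨a, t, rfl⟩
      exact key a t
    intro z
    exact (M.isClosed_topologicalClosure.closure_subset_iff.mpr hle) (hTensor_dense z)

/-- The unitary `R ⊗ K → T` of a decomposition, `r ⊗ k ↦ slot r k`. -/
def toUnitary [CompleteSpace T] (D : TensorSplit R K T) : R ⊗ₕ K →L[ℂ] T :=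
  fromH (LinearMap.isometryOfInner
    (TensorProduct.lift ((ContinuousLinearMap.coeLM ℂ).comp D.slot)) (fun x y => by
      induction x with
      | zero => simp
      | add x x' hx hx' => simp only [map_add, inner_add_left, hx, hx']
      | tmul a k =>
        induction y with
        | zero => simp
        | add x x' hx hx' => simp only [map_add, inner_add_right, hx, hx']
        | tmul a' k' => simp [D.inner_slot])).toContinuousLinearMap

/-- The operator on `T ≅ R ⊗ K` that is `A ⊗ B` under the decomposition. -/
def op [CompleteSpace R] [CompleteSpace K] [CompleteSpace T] (D : TensorSplit R K T)
    (A : R →L[ℂ] R) (B : K →L[ℂ] K) : T →L[ℂ] T :=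
  D.toUnitary ∘L hmap A B ∘L ContinuousLinearMap.adjoint D.toUnitary

theorem toUnitary_tmul [CompleteSpace T] (D : TensorSplit R K T) (r : R) (k : K) :
    D.toUnitary (toH (r ⊗ₜ[ℂ] k)) = D.slot r k := by
  simp [toUnitary, fromH_toH]

theorem op_slot [CompleteSpace R] [CompleteSpace K] [CompleteSpace T] (D : TensorSplit R K T)
    (A : R →L[ℂ] R) (B : K →L[ℂ] K) (r : R) (k : K) :
    D.op A B (D.slot r k) = D.slot (A r) (B k) := by
  have h : ContinuousLinearMap.adjoint D.toUnitary (D.slot r k)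
      = (toH (r ⊗ₜ[ℂ] k)) := by
    refine ext_inner_left ℂ fun v => ?_
    rw [ContinuousLinearMap.adjoint_inner_right]
    have : (innerSL ℂ).flip (D.slot r k) ∘SL D.toUnitary
        = (innerSL ℂ).flip (toH (r ⊗ₜ[ℂ] k)) := by
      refine ContinuousLinearMap.ext_on hTensor_dense ?_
      rintro _ ⟨x', y', rfl⟩
      simp [toUnitary_tmul, D.inner_slot, toH.inner_map_map]
    simpa using congrArg (fun f => f v) this
  simp [op, h, hmap_tmul, toUnitary_tmul]

end TensorSplit

section TraceClass
variable {H : Type*} [NormedAddCommGroup H] [InnerProductSpace ℂ H]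

/-- Trace-class operators on a Hilbert space, in nuclear form: `A = ∑ n, |x n⟩⟨y n|` with
`∑ n, ‖x n‖ * ‖y n‖ < ∞`. -/
def IsTraceClass (A : H →L[ℂ] H) : Prop :=
  ∃ x y : ℕ → H, Summable (fun n => ‖x n‖ * ‖y n‖) ∧
    ∀ z, HasSum (fun n => ⟪y n, z⟫_ℂ • x n) (A z)

theorem summable_diag_aux {ι : Type*} {b : ι → H} (hb : Orthonormal ℂ b) (x y : H) :
    Summable (fun i => ‖⟪y, b i⟫_ℂ‖ * ‖⟪b i, x⟫_ℂ‖) ∧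
      ∑' i, ‖⟪y, b i⟫_ℂ‖ * ‖⟪b i, x⟫_ℂ‖ ≤ ‖x‖ * ‖y‖ := by
  have hx := hb.inner_products_summable x
  have hy := hb.inner_products_summable y
  have hx' : ∑' i, ‖⟪b i, x⟫_ℂ‖ ^ 2 ≤ ‖x‖ ^ 2 := hb.tsum_inner_products_le x
  have hy' : ∑' i, ‖⟪b i, y⟫_ℂ‖ ^ 2 ≤ ‖y‖ ^ 2 := hb.tsum_inner_products_le y
  have key := Real.summable_and_inner_le_Lp_mul_Lq_tsum_of_nonneg (p := 2) (q := 2)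
    (f := fun i => ‖⟪b i, x⟫_ℂ‖) (g := fun i => ‖⟪b i, y⟫_ℂ‖)
    Real.HolderConjugate.two_two (fun _ => norm_nonneg _) (fun _ => norm_nonneg _)
    (by simpa using hx) (by simpa using hy)
  have e : (fun i => ‖⟪y, b i⟫_ℂ‖ * ‖⟪b i, x⟫_ℂ‖) =
      fun i => ‖⟪b i, x⟫_ℂ‖ * ‖⟪b i, y⟫_ℂ‖ := by
    ext i; rw [mul_comm, norm_inner_symm y]
  rw [e]
  refine ⟨key.1, key.2.trans ?_⟩
  simp only [Real.rpow_two, ← Real.sqrt_eq_rpow]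
  gcongr
  · exact (Real.sqrt_le_left (norm_nonneg _)).mpr hx'
  · exact (Real.sqrt_le_left (norm_nonneg _)).mpr hy'

theorem IsTraceClass.summable_diag {A : H →L[ℂ] H} (hA : IsTraceClass A) {ι : Type*} {b : ι → H}
    (hb : Orthonormal ℂ b) : Summable (fun i => ⟪b i, A (b i)⟫_ℂ) := by
  obtain ⟨x, y, hs, hz⟩ := hA
  have h2 : Summable (fun p : ℕ × ι => ‖⟪y p.1, b p.2⟫_ℂ‖ * ‖⟪b p.2, x p.1⟫_ℂ‖) := by
    rw [summable_prod_of_nonneg (fun _ => by positivity)]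
    refine ⟨fun n => (summable_diag_aux hb (x n) (y n)).1, ?_⟩
    exact Summable.of_nonneg_of_le (fun _ => tsum_nonneg fun _ => by positivity)
      (fun n => (summable_diag_aux hb (x n) (y n)).2) hs
  have h3 : Summable (fun p : ι × ℕ => ⟪y p.2, b p.1⟫_ℂ * ⟪b p.1, x p.2⟫_ℂ) := by
    refine Summable.of_norm ?_
    simp only [norm_mul]
    exact h2.prod_symm
  refine h3.prod.congr fun i => ?_
  have := ((hz (b i)).mapL (innerSL ℂ (b i))).tsum_eq
  rw [innerSL_apply_apply] at this
  rw [← this]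
  exact tsum_congr fun n => by simp

theorem IsTraceClass.add {A B : H →L[ℂ] H} (hA : IsTraceClass A) (hB : IsTraceClass B) :
    IsTraceClass (A + B) := by
  obtain ⟨x, y, hs, hz⟩ := hA
  obtain ⟨x', y', hs', hz'⟩ := hB
  let e : ℕ ≃ ℕ ⊕ ℕ := Equiv.natSumNatEquivNat.symm
  refine ⟨fun n => Sum.elim x x' (e n), fun n => Sum.elim y y' (e n), ?_, fun z => ?_⟩
  · change Summable ((fun s => ‖Sum.elim x x' s‖ * ‖Sum.elim y y' s‖) ∘ e)
    rw [e.summable_iff (f := fun s => ‖Sum.elim x x' s‖ * ‖Sum.elim y y' s‖)]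
    exact (HasSum.sum (by simpa [Function.comp_def] using hs.hasSum)
      (by simpa [Function.comp_def] using hs'.hasSum)).summable
  · change HasSum ((fun s => ⟪Sum.elim y y' s, z⟫_ℂ • Sum.elim x x' s) ∘ e) _
    rw [e.hasSum_iff (f := fun s => ⟪Sum.elim y y' s, z⟫_ℂ • Sum.elim x x' s)]
    exact HasSum.sum (by simpa [Function.comp_def] using hz z)
      (by simpa [Function.comp_def] using hz' z)

theorem IsTraceClass.smul {A : H →L[ℂ] H} (hA : IsTraceClass A) (c : ℝ) :
    IsTraceClass (c • A) := by
  obtain ⟨x, y, hs, hz⟩ := hA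
  refine ⟨fun n => c • x n, y, ?_, fun z => ?_⟩
  · simp only [norm_smul, mul_assoc]
    exact hs.mul_left _
  · simpa [smul_comm c] using (hz z).const_smul c

variable [CompleteSpace H]

/-- The trace `∑ i, ⟪e i, A (e i)⟫` over a Hilbert basis `e` (for trace-class `A` it does not depend
on the basis). -/
def trace (A : H →L[ℂ] H) : ℂ :=
  ∑' i, ⟪(exists_hilbertBasis ℂ H).choose_spec.choose i,
    A ((exists_hilbertBasis ℂ H).choose_spec.choose i)⟫_ℂ

theorem IsTraceClass.mul_right {A : H →L[ℂ] H} (hA : IsTraceClass A) (B : H →L[ℂ] H) :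
    IsTraceClass (A * B) := by
  obtain ⟨x, y, hs, hz⟩ := hA
  refine ⟨x, fun n => ContinuousLinearMap.adjoint B (y n), ?_, fun z => ?_⟩
  · refine Summable.of_nonneg_of_le (fun _ => by positivity) (fun n => ?_)
      (hs.mul_right ‖ContinuousLinearMap.adjoint B‖)
    have := (ContinuousLinearMap.adjoint B).le_opNorm (y n)
    nlinarith [norm_nonneg (x n), norm_nonneg (y n)]
  · simpa [ContinuousLinearMap.adjoint_inner_left] using hz (B z)

theorem trace_add {A B : H →L[ℂ] H} (hA : IsTraceClass A) (hB : IsTraceClass B) :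
    trace (A + B) = trace A + trace B := by
  have hb := (exists_hilbertBasis ℂ H).choose_spec.choose.orthonormal
  unfold trace
  rw [← (hA.summable_diag hb).tsum_add (hB.summable_diag hb)]
  exact tsum_congr fun i => by simp

theorem trace_smul (A : H →L[ℂ] H) (c : ℂ) : trace (c • A) = c * trace A := by
  unfold trace
  rw [← tsum_mul_left]
  exact tsum_congr fun i => by simp

variable (H) in
/-- The real vector space of self-adjoint trace-class operators. -/
def TraceClassSA : Submodule ℝ (H →L[ℂ] H) where
  carrier := {A | IsTraceClass A ∧ IsSelfAdjoint A}
  add_mem' := fun ha hb => ⟨ha.1.add hb.1, ha.2.add hb.2⟩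
  zero_mem' := ⟨⟨fun _ => 0, fun _ => 0, by simp, fun z => by
    simp⟩, IsSelfAdjoint.zero _⟩
  smul_mem' := fun c _ ha => ⟨ha.1.smul c, IsSelfAdjoint.smul (by simp [isSelfAdjoint_iff]) ha.2⟩

/-- Density operators: positive trace-class operators of trace one. -/
structure IsDensity (ρ : H →L[ℂ] H) : Prop where
  traceClass : IsTraceClass ρ
  positive : ρ.IsPositive
  trace_eq_one : trace ρ = 1

variable (H) in
/-- The state space of all density operators on `H`. -/
def Density : Set (TraceClassSA H) := {ρ | IsDensity (ρ : H →L[ℂ] H)}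

/-- Effects: operators with `0 ≤ F ≤ 1`. -/
def IsEffect (F : H →L[ℂ] H) : Prop := F.IsPositive ∧ (1 - F).IsPositive

variable (H) in
/-- The ultraweak topology on bounded operators: `A i → A` iff `tr (Ω A i) → tr (Ω A)` for every
trace-class `Ω`. -/
abbrev ultraweak : TopologicalSpace (H →L[ℂ] H) :=
  TopologicalSpace.induced
    (fun (A : H →L[ℂ] H) (Ω : {Ω : H →L[ℂ] H // IsTraceClass Ω}) => trace (Ω.1 * A)) inferInstance

/-- The ultraweak closure of the complex linear span of a set of operators. -/
def uwSpan (O : Set (H →L[ℂ] H)) : Set (H →L[ℂ] H) :=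
  closure[ultraweak H] (Submodule.span ℂ O : Set (H →L[ℂ] H))

theorem trace_mul_add {Ω Ω' : H →L[ℂ] H} (h : IsTraceClass Ω) (h' : IsTraceClass Ω')
    (F : H →L[ℂ] H) : trace ((Ω + Ω') * F) = trace (Ω * F) + trace (Ω' * F) := by
  rw [add_mul, trace_add (h.mul_right F) (h'.mul_right F)]

theorem trace_real_smul_mul (c : ℝ) (Ω F : H →L[ℂ] H) :
    trace ((c • Ω) * F) = c • trace (Ω * F) := by
  have : (c • Ω) * F = (c : ℂ) • (Ω * F) := by ext; simp
  rw [this, trace_smul]; simp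

/-- The self-adjoint trace-class operators that are operationally `O`-equivalent to zero. -/
def opKernel (O : Set (H →L[ℂ] H)) : Submodule ℝ (TraceClassSA H) where
  carrier := {Ω | ∀ F ∈ O, trace ((Ω : H →L[ℂ] H) * F) = 0}
  add_mem' := fun {a b} ha hb F hF => by
    simp [trace_mul_add a.2.1 b.2.1, ha F hF, hb F hF]
  zero_mem' := fun F _ => by simp [trace]
  smul_mem' := fun c a ha F hF => by
    have := trace_real_smul_mul c (a : H →L[ℂ] H) F
    rw [ha F hF, smul_zero] at this
    simpa using this

/-- Self-adjoint trace-class operators modulo operational `O`-equivalence, where `Ω ~ Ω'` iff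
`tr (Ω F) = tr (Ω' F)` for all `F ∈ O`. -/
abbrev OpQuotient (O : Set (H →L[ℂ] H)) := TraceClassSA H ⧸ opKernel O

theorem trace_eq_zero_of_mem_uwSpan {O : Set (H →L[ℂ] H)} {Ω : TraceClassSA H}
    (hΩ : Ω ∈ opKernel O) {B : H →L[ℂ] H} (hB : B ∈ uwSpan O) :
    trace ((Ω : H →L[ℂ] H) * B) = 0 := by
  have hc : @Continuous _ _ (ultraweak H) _
      (fun A : H →L[ℂ] H => trace ((Ω : H →L[ℂ] H) * A)) :=
    @Continuous.comp _ _ _ (ultraweak H) _ _ (fun A (Ω : {Ω : H →L[ℂ] H // IsTraceClass Ω}) =>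
      trace (Ω.1 * A)) _ (continuous_apply (⟨Ω, Ω.2.1⟩ : {Ω : H →L[ℂ] H // IsTraceClass Ω}))
      continuous_induced_dom
  have hcl : @IsClosed _ (ultraweak H) {A : H →L[ℂ] H | trace ((Ω : H →L[ℂ] H) * A) = 0} :=
    @IsClosed.preimage _ _ (ultraweak H) _ _ hc _ isClosed_singleton
  have hsub : (Submodule.span ℂ O : Set (H →L[ℂ] H)) ⊆
      {A : H →L[ℂ] H | trace ((Ω : H →L[ℂ] H) * A) = 0} := by
    intro A hA
    refine Submodule.span_induction (p := fun A _ => trace ((Ω : H →L[ℂ] H) * A) = 0)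
      (fun F hF => hΩ F hF) (by simp [trace]) (fun A B _ _ hA hB => ?_) (fun c A _ hA => ?_) hA
    · rw [mul_add, trace_add (Ω.2.1.mul_right A) (Ω.2.1.mul_right B), hA, hB, add_zero]
    · rw [mul_smul_comm, trace_smul, hA, mul_zero]
  exact (@IsClosed.closure_subset_iff _ (ultraweak H) _ _ hcl).mpr hsub hB

/-- The value `tr (Ω B)` of an operator `B` of the ultraweakly closed span of `O` on the class
of `Ω`. -/
def expect (O : Set (H →L[ℂ] H)) (B : uwSpan O) : OpQuotient O →ₗ[ℝ] ℂ :=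
  (opKernel O).liftQ
    { toFun := fun Ω => trace ((Ω : H →L[ℂ] H) * (B : H →L[ℂ] H))
      map_add' := fun a b => trace_mul_add a.2.1 b.2.1 _
      map_smul' := fun c _ => trace_real_smul_mul c _ _ }
    (fun _ hΩ => trace_eq_zero_of_mem_uwSpan hΩ B.2)

/-- Convergence in the operational topology on the quotient: pointwise convergence of the
expectation values of all operators in the ultraweakly closed span of `O`. -/
def OpTendsto (O : Set (H →L[ℂ] H)) (x : ℕ → OpQuotient O) (y : OpQuotient O) : Prop :=
  ∀ B : uwSpan O, Tendsto (fun n => expect O B (x n)) atTop (𝓝 (expect O B y))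

end TraceClass

section GPT
variable {V V' : Type*} [AddCommGroup V] [Module ℝ V] [AddCommGroup V'] [Module ℝ V']

/-- `φ (∑ cᵢ xᵢ) = ∑ cᵢ φ (xᵢ)` for all finite convex combinations of points of `S` that lie
in `S`. -/
def IsAffineMap {S : Set V} (φ : S → V') : Prop :=
  ∀ (n : ℕ) (c : Fin n → ℝ) (x : Fin n → S) (y : S), (∀ i, 0 < c i) → ∑ i, c i = 1 →
    (y : V) = ∑ i, c i • (x i : V) → φ y = ∑ i, c i • φ (x i)

/-- A state space: a total convex set, i.e. a convex set whose points are separated by its effects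
(the affine functionals with values in `[0, 1]`). -/
structure IsStateSpace (S : Set V) : Prop where
  convex : Convex ℝ S
  total : ∀ x y : S, (∀ f : S → ℝ, IsAffineMap f → (∀ z, 0 ≤ f z ∧ f z ≤ 1) → f x = f y) → x = y

/-- A state space map: an affine map between state spaces. -/
structure IsStateSpaceMap {S : Set V} {S' : Set V'} (φ : S → S') : Prop where
  source : IsStateSpace S
  target : IsStateSpace S'
  affine : IsAffineMap (fun x => (φ x : V'))
end GPT

section Frames
variable (G : Type*) [Group G] [TopologicalSpace G]
variable (H : Type*) [NormedAddCommGroup H] [InnerProductSpace ℂ H] [CompleteSpace H]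

/-- A strongly continuous unitary representation of `G` on `H`. -/
structure UnitaryRep where
  toHom : G →* unitary (H →L[ℂ] H)
  continuous' : ∀ ψ : H, Continuous fun g => (toHom g : H →L[ℂ] H) ψ

/-- A normalized positive operator-valued measure on `G` (only its values on measurable sets matter);
sigma-additivity is in the sense of expectation values. -/
structure POVM (G : Type*) [MeasurableSpace G] (H : Type*) [NormedAddCommGroup H]
    [InnerProductSpace ℂ H] [CompleteSpace H] where
  toFun : Set G → (H →L[ℂ] H)
  positive : ∀ X, MeasurableSet X → (toFun X).IsPositive
  univ : toFun Set.univ = 1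
  iUnion : ∀ X : ℕ → Set G, (∀ n, MeasurableSet (X n)) → Pairwise (Function.onFun Disjoint X) →
    ∀ ψ : H, HasSum (fun n => ⟪ψ, toFun (X n) ψ⟫_ℂ) ⟪ψ, toFun (⋃ n, X n) ψ⟫_ℂ

variable {G H}

/-- The action `g.A = U(g) A U(g)*`. -/
def UnitaryRep.conj (U : UnitaryRep G H) (g : G) (A : H →L[ℂ] H) : H →L[ℂ] H :=
  (U.toHom g : H →L[ℂ] H) * A * ContinuousLinearMap.adjoint (U.toHom g : H →L[ℂ] H)

/-- The tensor product representation `g ↦ U(g) ⊗ V(g)`. -/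
def UnitaryRep.tensor {K : Type*} [NormedAddCommGroup K] [InnerProductSpace ℂ K] [CompleteSpace K]
    (U : UnitaryRep G H) (V : UnitaryRep G K) : UnitaryRep G (H ⊗ₕ K) where
  toHom :=
    { toFun := fun g => ⟨hmap (U.toHom g : H →L[ℂ] H) (V.toHom g : K →L[ℂ] K),
        hmap_mem_unitary (U.toHom g).2 (V.toHom g).2⟩
      map_one' := by
        ext1
        simpa using hmap_one
      map_mul' := fun g h => by
        ext1
        simp [ContinuousLinearMap.mul_def, hmap_comp] }
  continuous' := by
    intro ψ
    refine continuous_of_uniform_approx_of_continuous fun u hu => ?_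
    obtain ⟨ε, hε, hu⟩ := Metric.mem_uniformity_dist.mp hu
    obtain ⟨t, ht⟩ := Metric.denseRange_iff.mp
      (denseRange_toH (E := H) (F := K)) ψ ε hε
    refine ⟨fun g => hmap (U.toHom g : H →L[ℂ] H) (V.toHom g : K →L[ℂ] K) (toH t), ?_, fun g => hu ?_⟩
    · clear ht
      induction t with
      | zero => simpa only [map_zero, map_zero] using continuous_const
      | tmul x y =>
        simp only [hmap_tmul]
        exact (toH.continuous).comp (TensorProduct.continuous_tmul.comp
          ((U.continuous' x).prodMk (V.continuous' y)))
      | add a b ha hb =>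
        simp only [map_add, map_add]
        exact ha.add hb
    · change dist (hmap (U.toHom g : H →L[ℂ] H) (V.toHom g : K →L[ℂ] K) ψ) _ < ε
      rw [dist_eq_norm, ← map_sub, ContinuousLinearMap.norm_map_of_mem_unitary
        (hmap_mem_unitary (U.toHom g).2 (V.toHom g).2), ← dist_eq_norm]
      exact ht

namespace POVM
variable {G : Type*} [MeasurableSpace G]

theorem empty (E : POVM G H) (ψ : H) : ⟪ψ, E.toFun ∅ ψ⟫_ℂ = 0 := by
  have h := (E.iUnion (fun _ => ∅) (fun _ => MeasurableSet.empty)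
    (fun _ _ _ => disjoint_bot_left) ψ).summable
  exact tendsto_nhds_unique tendsto_const_nhds h.tendsto_atTop_zero

/-- The measure `X ↦ ⟪ψ, E(X) ψ⟫`. For a unit vector `ψ` this is the probability distribution of `E`
in the pure state `|ψ⟩⟨ψ|`. -/
def measure (E : POVM G H) (ψ : H) : Measure G :=
  Measure.ofMeasurable (fun X _ => ENNReal.ofReal (⟪ψ, E.toFun X ψ⟫_ℂ).re)
    (by simp [E.empty])
    (fun X hX hd => by
      have h := Complex.hasSum_re (E.iUnion X hX hd ψ)
      rw [← h.tsum_eq, ENNReal.ofReal_tsum_of_nonneg _ h.summable]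
      intro n
      exact (E.positive _ (hX n)).re_inner_nonneg_right ψ)

end POVM

variable [MeasurableSpace G]

variable (G H) in
/-- A principal quantum reference frame: a system with a unitary representation of `G` and a POVM on
`G` that is covariant for left translation, `E(gX) = U(g) E(X) U(g)*`. -/
structure QFrame where
  rep : UnitaryRep G H
  povm : POVM G H
  covariant : ∀ (g : G) (X : Set G), MeasurableSet X →
    povm.toFun ((fun x => g * x) '' X) = rep.conj g (povm.toFun X)

/-- Localizability: whenever `E(X) ≠ 0`, there are pure states that give `X` probability arbitrarily
close to one. -/
def QFrame.Localizable (R : QFrame G H) : Prop :=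
  ∀ X, MeasurableSet X → R.povm.toFun X ≠ 0 →
    ∀ ε > (0 : ℝ), ∃ ξ : H, ‖ξ‖ = 1 ∧ 1 - ε < (⟪ξ, R.povm.toFun X ξ⟫_ℂ).re

/-- Unit vectors `ξ n` such that the pure states `|ξ n⟩⟨ξ n|` form a localizing sequence centred at the
identity: the distributions of the frame observable converge weakly to the Dirac measure at `1`. -/
def QFrame.IsLocalizingSequence (R : QFrame G H) (ξ : ℕ → H) : Prop :=
  (∀ n, ‖ξ n‖ = 1) ∧ ∀ f : BoundedContinuousFunction G ℝ,
    Tendsto (fun n => ∫ g, f g ∂(R.povm.measure (ξ n))) atTop (𝓝 (f 1))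

end Frames

section Internal
variable (G : Type*) [Group G] [TopologicalSpace G] [MeasurableSpace G]
variable (R K T : Type*) [NormedAddCommGroup R] [InnerProductSpace ℂ R] [CompleteSpace R]
  [NormedAddCommGroup K] [InnerProductSpace ℂ K] [CompleteSpace K]
  [NormedAddCommGroup T] [InnerProductSpace ℂ T] [CompleteSpace T]

/-- A frame inside a total system `T ≅ R ⊗ K`, where `K` is the rest of the system, carrying its own
representation of `G`. -/
structure InternalFrame where
  frame : QFrame G R
  restRep : UnitaryRep G K
  split : TensorSplit R K T

variable {G R K T}
namespace InternalFrame

/-- `Y` is the relativization `∫ dE(g) ⊗ g.A` of `A`. The integral is the weak one,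
`⟪r ⊗ k, Y (r ⊗ k)⟫ = ∫ ⟪k, (g.A) k⟫ d⟪r, E(g) r⟫`; by polarization this determines `Y`. -/
def IsRelativization (F : InternalFrame G R K T) (A : K →L[ℂ] K) (Y : T →L[ℂ] T) : Prop :=
  ∀ r k, ⟪F.split.slot r k, Y (F.split.slot r k)⟫_ℂ =
    ∫ g, ⟪k, F.restRep.conj g A k⟫_ℂ ∂(F.frame.povm.measure r)

open Classical in
/-- The relativization map `¥ : B(K) → B(T)`, `A ↦ ∫ dE(g) ⊗ g.A`. -/
def yen (F : InternalFrame G R K T) (A : K →L[ℂ] K) : T →L[ℂ] T :=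
  if h : ∃ Y, F.IsRelativization A Y then h.choose else 0

/-- The restriction map `Γ_ω : B(T) → B(K)` of the pure state `ω = |ξ⟩⟨ξ|` of the frame, the normal map
with `A ⊗ B ↦ tr (ω A) B`. -/
def restrict (F : InternalFrame G R K T) (ξ : R) (B : T →L[ℂ] T) : K →L[ℂ] K :=
  ContinuousLinearMap.adjoint (F.split.slot ξ) ∘L B ∘L F.split.slot ξ

end InternalFrame

open Classical in
/-- The predual map `Γ_*` of a (normal) map `Γ` of operators: `tr (Γ_*(Ω) A) = tr (Ω Γ(A))` for all
`A`. -/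
def predual (Γ : (K →L[ℂ] K) → (T →L[ℂ] T)) (Ω : TraceClassSA T) : TraceClassSA K :=
  if h : ∃ ρ : TraceClassSA K, ∀ A : K →L[ℂ] K,
    trace ((ρ : K →L[ℂ] K) * A) = trace ((Ω : T →L[ℂ] T) * Γ A) then h.choose else 0

namespace InternalFrame

/-- The lifting map `L_ω = (¥ ∘ Γ_ω)_*`, `ω = |ξ⟩⟨ξ|`, on representatives: it sends `Ω` to
`ω ⊗ ¥_*(Ω)`. It depends only on the relative class of `Ω`. -/
def lift (F : InternalFrame G R K T) (ξ : R) : TraceClassSA T → TraceClassSA T :=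
  predual fun B => F.yen (F.restrict ξ B)

/-- The relativized framed effects: the effects in the ultraweakly closed span of
`{¥(A) | A ∈ 𝒜}`, for a set `𝒜` of operators on the rest `K`. -/
def relEffects (F : InternalFrame G R K T) (𝒜 : Set (K →L[ℂ] K)) : Set (T →L[ℂ] T) :=
  {B | B ∈ uwSpan (F.yen '' 𝒜) ∧ IsEffect B}
end InternalFrame

section OpStates

/-- The class `[Ω]_O`. -/
def opClass (O : Set (T →L[ℂ] T)) (Ω : TraceClassSA T) : OpQuotient O := (opKernel O).mkQ Ω

/-- The operational state space `S(T)/~_O`: the classes of density operators. -/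
def OpStates (O : Set (T →L[ℂ] T)) : Set (OpQuotient O) := opClass O '' Density T

/-- The class of a density operator, as a point of the operational state space. -/
def opState (O : Set (T →L[ℂ] T)) (Ω : Density T) : OpStates O :=
  ⟨opClass O Ω, Set.mem_image_of_mem _ Ω.2⟩

/-- The canonical map `[Ω]_O ↦ [Ω]_O'` between operational state spaces of the same system. With
`O` the invariant effects and `O'` the image of the effects under `¥` this is `¥_*`, relative states
being identified with classes `[Ω]_R ≃ ¥_*[Ω]_G`; for smaller sets `O'` it is a projection `π` onto
framed states. -/
def IsProjection {O O' : Set (T →L[ℂ] T)} (p : OpStates O → OpStates O') : Prop :=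
  ∀ Ω : Density T, p (opState O Ω) = opState O' Ω

end OpStates

/-- The invariant effects; the classes of states modulo them are the global states. -/
def UnitaryRep.invariantEffects (U : UnitaryRep G T) : Set (T →L[ℂ] T) :=
  {B | IsEffect B ∧ ∀ g, U.conj g B = B}

namespace InternalFrame

/-- `Φ [Ω]_O = lim_n [L_{ω_n}(Ω)]_O'` in the operational topology, for every density operator `Ω` and
every localizing sequence `ω_n = |ξ n⟩⟨ξ n|` of the frame. When `O` and `O'` are the relativized
framed effects of this frame and of a second one, `[·]_O'` is `π ∘ ¥_*` for the second frame, and this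
says `Φ = lim_n π ∘ ¥_* ∘ L_{ω_n}` on the framed relative states. -/
def IsLocalizedLimit (F : InternalFrame G R K T) {O O' : Set (T →L[ℂ] T)}
    (Φ : OpStates O → OpStates O') : Prop :=
  ∀ ξ : ℕ → R, F.frame.IsLocalizingSequence ξ → ∀ Ω : Density T,
    OpTendsto O' (fun n => opClass O' (F.lift (ξ n) Ω)) (Φ (opState O Ω))

/-- `Φ` is the frame-change map out of the frame `F`, and it is well defined as a state space map: the
lifting maps take states to states, the limit defining `Φ` exists on every class, does not depend on
the representative or on the localizing sequence, lies in the target state space, determines `Φ`, and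
`Φ` is affine. -/
structure IsFrameChange (F : InternalFrame G R K T) {O O' : Set (T →L[ℂ] T)}
    (Φ : OpStates O → OpStates O') : Prop where
  approx : ∀ ξ : R, ‖ξ‖ = 1 → ∀ Ω : Density T, F.lift ξ Ω ∈ Density T
  limit : F.IsLocalizedLimit Φ
  unique : ∀ Ψ : OpStates O → OpStates O', F.IsLocalizedLimit Ψ → Ψ = Φ
  stateSpaceMap : IsStateSpaceMap Φ

end InternalFrame
end Internal

section Setup
variable {G : Type*} [Group G] [TopologicalSpace G] [MeasurableSpace G]
  {R K S A B : Type*} [NormedAddCommGroup R] [InnerProductSpace ℂ R] [CompleteSpace R]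
  [NormedAddCommGroup K] [InnerProductSpace ℂ K] [CompleteSpace K]
  [NormedAddCommGroup S] [InnerProductSpace ℂ S] [CompleteSpace S]
  [NormedAddCommGroup A] [InnerProductSpace ℂ A] [CompleteSpace A]
  [NormedAddCommGroup B] [InnerProductSpace ℂ B] [CompleteSpace B]

/-- The frame in the first factor of `R ⊗ K`. -/
def frameOne (𝓡 : QFrame G R) (V : UnitaryRep G K) : InternalFrame G R K (R ⊗ₕ K) where
  frame := 𝓡
  restRep := V
  split := TensorSplit.first R K

/-- The frame in the second factor of `A ⊗ R ⊗ S`; the rest is `A ⊗ S`. -/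
def frameTwo (UA : UnitaryRep G A) (𝓡 : QFrame G R) (V : UnitaryRep G S) :
    InternalFrame G R (A ⊗ₕ S) (A ⊗ₕ (R ⊗ₕ S)) where
  frame := 𝓡
  restRep := UA.tensor V
  split := (TensorSplit.first R S).skip A

/-- The frame in the third factor of `A ⊗ B ⊗ R ⊗ S`; the rest is `A ⊗ B ⊗ S`. -/
def frameThree (UA : UnitaryRep G A) (UB : UnitaryRep G B) (𝓡 : QFrame G R)
    (V : UnitaryRep G S) :
    InternalFrame G R (A ⊗ₕ (B ⊗ₕ S)) (A ⊗ₕ (B ⊗ₕ (R ⊗ₕ S))) where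
  frame := 𝓡
  restRep := UA.tensor (UB.tensor V)
  split := ((TensorSplit.first R S).skip B).skip A

/-- The operators `E(X) ⊗ F` on `K ≅ R ⊗ S`, with `X` a Borel set and `F` an effect on `S`. -/
def framing (D : TensorSplit R S K) (E : POVM G R) : Set (K →L[ℂ] K) :=
  {C | ∃ (X : Set G) (F : S →L[ℂ] S), MeasurableSet X ∧ IsEffect F ∧ C = D.op (E.toFun X) F}

/-- The operators `E(X) ⊗ E'(Y) ⊗ F` on `A ⊗ B ⊗ S`, with `X`, `Y` Borel sets and `F` an effect
on `S`. -/
def doubleFraming (E : POVM G A) (E' : POVM G B) (S : Type*) [NormedAddCommGroup S]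
    [InnerProductSpace ℂ S] [CompleteSpace S] : Set (A ⊗ₕ (B ⊗ₕ S) →L[ℂ] A ⊗ₕ (B ⊗ₕ S)) :=
  {C | ∃ (X Y : Set G) (F : S →L[ℂ] S), MeasurableSet X ∧ MeasurableSet Y ∧ IsEffect F ∧
    C = hmap (E.toFun X) (hmap (E'.toFun Y) F)}

end Setup

end

end QRF

open QRF

open scoped ComplexOrder

namespace QRF

/-! The frame-change map turns out to be the canonical map `[Ω] ↦ [Ω]` between two quotients of the
same space of density operators. Two facts give this.

Algebra (`yen_op_mem_uwSpan`). By covariance, relativizing `E_i(X) ⊗ C` with respect to `R_j` gives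
the integral of `g.C` against `dE_i(h) ⊗ dE_j(g)` over the pairs with `g⁻¹h ∈ X`. Fubini and the
substitution `g = hk` turn it into `∫ dE_i(h) ⊗ h.(∫_{X⁻¹} dE_j(k) ⊗ k.C)`. Riemann sums for the
inner integral are combinations of framed operators, so the target effects lie in the ultraweak span
of the source ones. Source-equivalent states are therefore target-equivalent, and `opProj` is
defined.

Analysis (`tendsto_trace_lift`). Along a localizing sequence `Γ_ω ∘ ¥` tends to the identity, in
trace norm on each fixed predual element. Hence `L_ω(Ω) - Ω` is small on `¥(A)`, uniformly for `‖A‖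
≤ 1`. Operators that are merely ultraweak limits of the range of `¥` need not be bounded limits of
it, so this alone does not suffice. But the same approximation, iterated geometrically, shows that
`¥_*` is open and surjective (`exists_yen_predual_preimage`): a functional small on the range of `¥`
is represented by a trace-class operator small in norm, modulo the annihilator of the range. This
controls all of the ultraweak closure.

Localizing sequences exist by localizability and covariance, which gives uniqueness of the limit.
Once every frame change is `[Ω] ↦ [Ω]`, intertwining, invertibility and both composition laws are
checked on representatives. -/

noncomputable section


/-! ### Weak operator convergence and effects. -/

section WeakConvergence
variable {H : Type*} [NormedAddCommGroup H] [InnerProductSpace ℂ H]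

/-- Convergence in the weak operator topology. -/
def WeakTendsto {ι : Type*} (Y : ι → H →L[ℂ] H) (l : Filter ι) (Z : H →L[ℂ] H) : Prop :=
  ∀ u v, Tendsto (fun n => ⟪u, Y n v⟫_ℂ) l (𝓝 ⟪u, Z v⟫_ℂ)

theorem norm_inner_apply_le {A : H →L[ℂ] H} {C : ℝ} (hA : ‖A‖ ≤ C) (u v : H) :
    ‖⟪u, A v⟫_ℂ‖ ≤ C * ‖u‖ * ‖v‖ := by
  calc ‖⟪u, A v⟫_ℂ‖ ≤ ‖u‖ * ‖A v‖ := norm_inner_le_norm _ _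
    _ ≤ ‖u‖ * (C * ‖v‖) := by gcongr; exact A.le_of_opNorm_le hA v
    _ = C * ‖u‖ * ‖v‖ := by ring

/-- A family of vectors whose expectation values determine an operator. -/
def Determining {ι : Type*} (v : ι → H) : Prop :=
  ∀ Z : H →L[ℂ] H, (∀ i, ⟪v i, Z (v i)⟫_ℂ = 0) → Z = 0

theorem eq_zero_of_inner_self {Z : H →L[ℂ] H} (h : ∀ v, ⟪v, Z v⟫_ℂ = 0) : Z = 0 := by
  have := (inner_map_self_eq_zero (Z : H →ₗ[ℂ] H)).1 fun x => by
    rw [← inner_conj_symm]; simp [h x]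
  exact ContinuousLinearMap.coe_injective this

theorem Determining.eq {ι : Type*} {v : ι → H} (hv : Determining v) {Y Z : H →L[ℂ] H}
    (h : ∀ i, ⟪v i, Y (v i)⟫_ℂ = ⟪v i, Z (v i)⟫_ℂ) : Y = Z :=
  sub_eq_zero.1 (hv _ fun i => by simp [h i])

variable [CompleteSpace H]

/-- Weak compactness of balls: each matrix element has an ultrafilter limit in a closed disc, and
these limits form a bounded sesquilinear form, hence come from an operator. -/
theorem exists_weakTendsto_ultrafilter {ι : Type*} {Y : ι → H →L[ℂ] H} {C : ℝ}
    (hC : ∀ n, ‖Y n‖ ≤ C) (𝒰 : Ultrafilter ι) : ∃ Z, WeakTendsto Y 𝒰 Z := by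
  have hex : ∀ v w : H, ∃ z : ℂ, ‖z‖ ≤ C * ‖v‖ * ‖w‖ ∧
      Tendsto (fun n => ⟪Y n v, w⟫_ℂ) 𝒰 (𝓝 z) := by
    intro v w
    obtain ⟨z, hz, hzl⟩ := (isCompact_closedBall (0 : ℂ) (C * ‖v‖ * ‖w‖)).ultrafilter_le_nhds
      (𝒰.map fun n => ⟪Y n v, w⟫_ℂ) (by
        refine le_principal_iff.2 (Filter.mem_map.2 (univ_mem' fun n => ?_))
        rw [Set.mem_preimage, mem_closedBall_zero_iff, norm_inner_symm]
        exact (norm_inner_apply_le (hC n) w v).trans_eq (by ring))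
    exact ⟨z, by simpa using hz, hzl⟩
  choose B hB hlim using hex
  let Bl : H →ₗ⋆[ℂ] H →ₗ[ℂ] ℂ := LinearMap.mk₂'ₛₗ _ _ B
    (fun v v' w => tendsto_nhds_unique (hlim (v + v') w) (by
      simpa [inner_add_left] using (hlim v w).add (hlim v' w)))
    (fun c v w => tendsto_nhds_unique (hlim (c • v) w) (by
      simpa [inner_smul_left, mul_comm] using (hlim v w).const_mul ((starRingEnd ℂ) c)))
    (fun v w w' => tendsto_nhds_unique (hlim v (w + w')) (by
      simpa [inner_add_right] using (hlim v w).add (hlim v w')))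
    (fun c v w => tendsto_nhds_unique (hlim v (c • w)) (by
      simpa [inner_smul_right] using (hlim v w).const_mul _))
  refine ⟨InnerProductSpace.continuousLinearMapOfBilin
    (Bl.mkContinuous₂ C fun v w => hB v w), fun u v => ?_⟩
  have h := (Complex.continuous_conj.tendsto _).comp (hlim v u)
  have e : ⟪u, InnerProductSpace.continuousLinearMapOfBilin
      (Bl.mkContinuous₂ C fun v w => hB v w) v⟫_ℂ = (starRingEnd ℂ) (B v u) := by
    rw [← inner_conj_symm, InnerProductSpace.continuousLinearMapOfBilin_apply]
    rfl
  rw [e]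
  refine h.congr fun n => ?_
  simp

/-- Along every finer ultrafilter a weak limit exists by compactness, and the determining vectors
identify it as `Z`. Hence weak convergence of bounded families need only be tested on expectation
values in product vectors. -/
theorem Determining.weakTendsto {ι κ : Type*} {v : κ → H} (hv : Determining v)
    {Y : ι → H →L[ℂ] H} {C : ℝ} (hC : ∀ n, ‖Y n‖ ≤ C) {l : Filter ι} {Z : H →L[ℂ] H}
    (h : ∀ i, Tendsto (fun n => ⟪v i, Y n (v i)⟫_ℂ) l (𝓝 ⟪v i, Z (v i)⟫_ℂ)) :
    WeakTendsto Y l Z := by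
  intro u w
  rw [tendsto_iff_ultrafilter]
  intro 𝒰 h𝒰
  obtain ⟨Z', hZ'⟩ := exists_weakTendsto_ultrafilter hC 𝒰
  have : Z' = Z := hv.eq fun i => tendsto_nhds_unique (hZ' _ _) ((h i).mono_left h𝒰)
  exact this ▸ hZ' u w

omit [CompleteSpace H] in
theorem isPositive_of_inner_nonneg {A : H →L[ℂ] H} (h : ∀ v, 0 ≤ ⟪v, A v⟫_ℂ) :
    A.IsPositive := by
  rw [ContinuousLinearMap.isPositive_iff_complex]
  intro v
  have h1 := h v
  rw [← inner_conj_symm] at h1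
  rw [Complex.nonneg_iff] at h1
  simp only [Complex.conj_re, Complex.conj_im, zero_eq_neg] at h1
  have h1' : 0 = (⟪A v, v⟫_ℂ).im := by linarith [h1.2]
  exact ⟨Complex.ext (by simp) (by simpa using h1'), h1.1⟩

omit [CompleteSpace H] in
theorem WeakTendsto.isPositive {ι : Type*} {Y : ι → H →L[ℂ] H} {l : Filter ι} [l.NeBot]
    {Z : H →L[ℂ] H} (h : WeakTendsto Y l Z) (hY : ∀ n, (Y n).IsPositive) : Z.IsPositive :=
  isPositive_of_inner_nonneg fun v => ge_of_tendsto (h v v)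
    (Eventually.of_forall fun n => (hY n).inner_nonneg_right v)

theorem IsEffect.norm_le_one {F : H →L[ℂ] H} (hF : IsEffect F) : ‖F‖ ≤ 1 :=
  (CStarAlgebra.norm_le_one_iff_of_nonneg F
    ((ContinuousLinearMap.nonneg_iff_isPositive F).2 hF.1)).2 hF.2

omit [CompleteSpace H] in
theorem isEffect_one : IsEffect (1 : H →L[ℂ] H) :=
  ⟨ContinuousLinearMap.isPositive_one, by simp⟩

omit [CompleteSpace H] in
theorem IsEffect.compl {F : H →L[ℂ] H} (hF : IsEffect F) : IsEffect (1 - F) :=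
  ⟨hF.2, by simpa using hF.1⟩

theorem isEffect_inv_smul {A : H →L[ℂ] H} (hA : A.IsPositive) {c : ℝ} (hc : 0 < c)
    (h : ‖A‖ ≤ c) : IsEffect (((c⁻¹ : ℝ) : ℂ) • A) := by
  have h0 : 0 ≤ ((c⁻¹ : ℝ) : ℂ) • A := (ContinuousLinearMap.nonneg_iff_isPositive _).2
    (hA.smul_of_nonneg (Complex.zero_le_real.2 (by positivity)))
  refine ⟨(ContinuousLinearMap.nonneg_iff_isPositive _).1 h0, (ContinuousLinearMap.le_def _ _).1
    ((CStarAlgebra.norm_le_one_iff_of_nonneg _ h0).1 ?_)⟩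
  rwa [norm_smul, Complex.norm_real, Real.norm_of_nonneg (by positivity), inv_mul_le_one₀ hc]

theorem exists_effect_of_isPositive {A : H →L[ℂ] H} (hA : A.IsPositive) :
    ∃ (c : ℝ) (F : H →L[ℂ] H), 0 ≤ c ∧ IsEffect F ∧ A = (c : ℂ) • F := by
  have hc : (0 : ℝ) < ‖A‖ + 1 := by positivity
  refine ⟨‖A‖ + 1, _, hc.le, isEffect_inv_smul hA hc (by linarith), ?_⟩
  rw [smul_smul, ← Complex.ofReal_mul, mul_inv_cancel₀ hc.ne', Complex.ofReal_one, one_smul]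

/-- Every operator is a combination of four effects. -/
theorem exists_effect_decomposition (A : H →L[ℂ] H) :
    ∃ (c : Fin 4 → ℂ) (F : Fin 4 → H →L[ℂ] H), (∀ i, IsEffect (F i)) ∧ A = ∑ i, c i • F i := by
  obtain ⟨x, hx, -, hA⟩ := CStarAlgebra.exists_sum_four_nonneg A
  choose c F hc hF hx' using fun i => exists_effect_of_isPositive
    ((ContinuousLinearMap.nonneg_iff_isPositive _).1 (hx i))
  refine ⟨fun i => Complex.I ^ (i : ℕ) * c i, F, hF, hA.trans ?_⟩
  exact Finset.sum_congr rfl fun i _ => by rw [mul_smul, ← hx']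

end WeakConvergence

/-! ### Traces computed from nuclear forms. -/

section Nuclear
variable {H : Type*} [NormedAddCommGroup H] [InnerProductSpace ℂ H] [CompleteSpace H]

variable (H) in
/-- The Hilbert basis used in the definition of the trace. -/
def traceBasis : HilbertBasis (exists_hilbertBasis ℂ H).choose ℂ H :=
  (exists_hilbertBasis ℂ H).choose_spec.choose

-- Fubini for an absolutely summable double series, then Parseval. The right-hand side does not
-- mention the basis, so the trace is basis independent.
omit [CompleteSpace H] in
theorem tsum_diag_eq_tsum_nuclear {ι : Type*} (b : HilbertBasis ι ℂ H) {A : H →L[ℂ] H}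
    {x y : ℕ → H} (hs : Summable (fun n => ‖x n‖ * ‖y n‖))
    (hz : ∀ z, HasSum (fun n => ⟪y n, z⟫_ℂ • x n) (A z)) :
    ∑' i, ⟪b i, A (b i)⟫_ℂ = ∑' n, ⟪y n, x n⟫_ℂ := by
  have hb := b.orthonormal
  have h2 : Summable (fun p : ℕ × ι => ‖⟪y p.1, b p.2⟫_ℂ‖ * ‖⟪b p.2, x p.1⟫_ℂ‖) := by
    rw [summable_prod_of_nonneg (fun _ => by positivity)]
    refine ⟨fun n => (summable_diag_aux hb (x n) (y n)).1, ?_⟩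
    exact Summable.of_nonneg_of_le (fun _ => tsum_nonneg fun _ => by positivity)
      (fun n => (summable_diag_aux hb (x n) (y n)).2) hs
  have h3 : Summable (fun p : ℕ × ι => ⟪y p.1, b p.2⟫_ℂ * ⟪b p.2, x p.1⟫_ℂ) := by
    refine Summable.of_norm ?_
    simpa only [norm_mul] using h2
  calc ∑' i, ⟪b i, A (b i)⟫_ℂ = ∑' i, ∑' n, ⟪y n, b i⟫_ℂ * ⟪b i, x n⟫_ℂ := by
        refine tsum_congr fun i => ?_
        have := ((hz (b i)).mapL (innerSL ℂ (b i))).tsum_eq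
        rw [innerSL_apply_apply] at this
        rw [← this]
        exact tsum_congr fun n => by simp
    _ = ∑' n, ∑' i, ⟪y n, b i⟫_ℂ * ⟪b i, x n⟫_ℂ := h3.tsum_comm
    _ = ∑' n, ⟪y n, x n⟫_ℂ := tsum_congr fun n => (b.hasSum_inner_mul_inner _ _).tsum_eq

theorem trace_eq_tsum_nuclear {A : H →L[ℂ] H} {x y : ℕ → H}
    (hs : Summable (fun n => ‖x n‖ * ‖y n‖))
    (hz : ∀ z, HasSum (fun n => ⟪y n, z⟫_ℂ • x n) (A z)) :
    trace A = ∑' n, ⟪y n, x n⟫_ℂ :=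
  tsum_diag_eq_tsum_nuclear (traceBasis H) hs hz

theorem trace_mul_eq_tsum {A : H →L[ℂ] H} {x y : ℕ → H}
    (hs : Summable (fun n => ‖x n‖ * ‖y n‖))
    (hz : ∀ z, HasSum (fun n => ⟪y n, z⟫_ℂ • x n) (A z)) (B : H →L[ℂ] H) :
    trace (A * B) = ∑' n, ⟪y n, B (x n)⟫_ℂ := by
  rw [trace_eq_tsum_nuclear (x := x) (y := fun n => ContinuousLinearMap.adjoint B (y n))]
  · simp [ContinuousLinearMap.adjoint_inner_left]
  · refine Summable.of_nonneg_of_le (fun _ => by positivity) (fun n => ?_)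
      (hs.mul_right ‖ContinuousLinearMap.adjoint B‖)
    have := (ContinuousLinearMap.adjoint B).le_opNorm (y n)
    nlinarith [norm_nonneg (x n), norm_nonneg (y n)]
  · intro z
    simpa [ContinuousLinearMap.adjoint_inner_left] using hz (B z)

theorem IsTraceClass.exists_bound {Ω : H →L[ℂ] H} (hΩ : IsTraceClass Ω) :
    ∃ M : ℝ, 0 ≤ M ∧ ∀ A : H →L[ℂ] H, ‖trace (Ω * A)‖ ≤ M * ‖A‖ := by
  obtain ⟨x, y, hs, hz⟩ := hΩ
  refine ⟨∑' n, ‖x n‖ * ‖y n‖, tsum_nonneg fun _ => by positivity, fun A => ?_⟩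
  rw [trace_mul_eq_tsum hs hz, ← tsum_mul_right]
  refine tsum_of_norm_bounded (hs.mul_right ‖A‖).hasSum fun n => ?_
  exact (norm_inner_apply_le le_rfl _ _).trans_eq (by ring)

omit [CompleteSpace H] in
theorem tendsto_tsum_inner {ι : Type*} {Y : ι → H →L[ℂ] H} {C : ℝ} (hC : ∀ n, ‖Y n‖ ≤ C)
    {l : Filter ι} {Z : H →L[ℂ] H} (h : WeakTendsto Y l Z) {x y : ℕ → H}
    (hs : Summable (fun n => ‖x n‖ * ‖y n‖)) :
    Tendsto (fun n => ∑' i, ⟪y i, Y n (x i)⟫_ℂ) l (𝓝 (∑' i, ⟪y i, Z (x i)⟫_ℂ)) :=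
  tendsto_tsum_of_dominated_convergence (hs.mul_left C) (fun i => h _ _)
    (Eventually.of_forall fun n i =>
      (norm_inner_apply_le (hC n) (y i) (x i)).trans_eq (by ring))

theorem IsTraceClass.tendsto_trace_mul {Ω : H →L[ℂ] H} (hΩ : IsTraceClass Ω) {ι : Type*}
    {Y : ι → H →L[ℂ] H} {C : ℝ} (hC : ∀ n, ‖Y n‖ ≤ C) {l : Filter ι} {Z : H →L[ℂ] H}
    (h : WeakTendsto Y l Z) : Tendsto (fun n => trace (Ω * Y n)) l (𝓝 (trace (Ω * Z))) := by
  obtain ⟨x, y, hs, hz⟩ := hΩ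
  simp only [trace_mul_eq_tsum hs hz]
  exact tendsto_tsum_inner hC h hs

/-- On bounded sets weak operator convergence implies ultraweak convergence, by dominated
convergence in the nuclear series. -/
theorem WeakTendsto.mem_uwSpan {O : Set (H →L[ℂ] H)} {ι : Type*} {Y : ι → H →L[ℂ] H} {C : ℝ}
    (hC : ∀ n, ‖Y n‖ ≤ C) {l : Filter ι} [l.NeBot] {Z : H →L[ℂ] H} (h : WeakTendsto Y l Z)
    (hY : ∀ n, Y n ∈ Submodule.span ℂ O) : Z ∈ uwSpan O := by
  refine @mem_closure_of_tendsto _ (ultraweak H) _ _ _ Y l _ ?_ (Eventually.of_forall hY)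
  rw [nhds_induced, tendsto_comap_iff, tendsto_pi_nhds]
  exact fun Ω => Ω.2.tendsto_trace_mul hC h

theorem subset_uwSpan (O : Set (H →L[ℂ] H)) : O ⊆ uwSpan O := fun _ hA =>
  @subset_closure _ (ultraweak H) _ _ (Submodule.subset_span hA)

theorem trace_mul_rankOne {Ω : H →L[ℂ] H} (hΩ : IsTraceClass Ω) (u v : H) :
    trace (Ω * InnerProductSpace.rankOne ℂ u v) = ⟪v, Ω u⟫_ℂ := by
  obtain ⟨x, y, hs, hz⟩ := hΩ
  rw [trace_mul_eq_tsum hs hz]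
  have := ((hz u).mapL (innerSL ℂ v)).tsum_eq
  rw [innerSL_apply_apply] at this
  rw [← this]
  exact tsum_congr fun n => by simp [mul_comm]

theorem trace_neg (A : H →L[ℂ] H) : trace (-A) = - trace A := by
  simpa using trace_smul A (-1)

theorem trace_sub_mul {Ω Ω' : H →L[ℂ] H} (h : IsTraceClass Ω) (h' : IsTraceClass Ω')
    (A : H →L[ℂ] H) : trace ((Ω - Ω') * A) = trace (Ω * A) - trace (Ω' * A) := by
  have h2 : IsTraceClass (-Ω') := by simpa using h'.smul (-1)
  rw [sub_eq_add_neg, trace_mul_add h h2, neg_mul, trace_neg, sub_eq_add_neg]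

/-- The self-adjoint trace-class operator `∑ |a i⟩⟨a i| - ∑ |b i⟩⟨b i|`. -/
theorem exists_traceClassSA {a b : ℕ → H} (ha : Summable fun n => ‖a n‖ ^ 2)
    (hb : Summable fun n => ‖b n‖ ^ 2) : ∃ Ω : TraceClassSA H, ∀ A : H →L[ℂ] H,
      trace ((Ω : H →L[ℂ] H) * A) = ∑' i, ⟪a i, A (a i)⟫_ℂ - ∑' i, ⟪b i, A (b i)⟫_ℂ := by
  have key : ∀ {a : ℕ → H}, (Summable fun n => ‖a n‖ ^ 2) → ∃ Ω : TraceClassSA H,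
      ∀ A : H →L[ℂ] H, trace ((Ω : H →L[ℂ] H) * A) = ∑' i, ⟪a i, A (a i)⟫_ℂ := by
    intro a ha
    have hs : Summable fun n => ‖a n‖ * ‖a n‖ := by simpa only [sq] using ha
    have hS : Summable fun n => InnerProductSpace.rankOne ℂ (a n) (a n) :=
      Summable.of_norm (by simpa using hs)
    have hz : ∀ z, HasSum (fun n => ⟪a n, z⟫_ℂ • a n)
        ((∑' n, InnerProductSpace.rankOne ℂ (a n) (a n)) z) := fun z => by
      simpa using hS.hasSum.mapL (ContinuousLinearMap.apply ℂ H z)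
    have hsa : IsSelfAdjoint (∑' n, InnerProductSpace.rankOne ℂ (a n) (a n)) := by
      rw [isSelfAdjoint_iff, tsum_star]
      exact tsum_congr fun n => by simp [ContinuousLinearMap.star_eq_adjoint]
    exact ⟨⟨_, ⟨a, a, hs, hz⟩, hsa⟩, fun A => trace_mul_eq_tsum hs hz A⟩
  obtain ⟨P, hP⟩ := key ha
  obtain ⟨N, hN⟩ := key hb
  refine ⟨P - N, fun A => ?_⟩
  rw [← hP, ← hN]
  exact trace_sub_mul P.2.1 N.2.1 A

end Nuclear

/-! ### Positive and negative parts of trace-class operators. -/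

section Positive
variable {H : Type*} [NormedAddCommGroup H] [InnerProductSpace ℂ H]

theorem countable_of_orthonormal [SeparableSpace H] {ι : Type*} {e : ι → H}
    (he : Orthonormal ℂ e) : Countable ι := by
  have hd : Set.univ.PairwiseDisjoint (fun i => Metric.ball (e i) (1 / 2)) := by
    intro i _ j _ hij
    refine Metric.ball_disjoint_ball ?_
    -- Orthonormal vectors are at distance `√2 > 1`, so balls of radius `1/2` around them are
    -- disjoint; a separable space has only countably many disjoint nonempty open sets.
    have h : ‖e i - e j‖ ^ 2 = 2 := by
      rw [@norm_sub_sq ℂ]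
      simp [he.1 i, he.1 j, he.2 hij]
      norm_num
    rw [dist_eq_norm]
    nlinarith [norm_nonneg (e i - e j)]
  exact Set.countable_univ_iff.1
    (hd.countable_of_isOpen (fun _ _ => Metric.isOpen_ball) fun i _ => ⟨e i, by simp⟩)

/-- Moves series over a countable basis to series over `ℕ`, as nuclear forms require; the padding by
zero contributes nothing. -/
theorem comp_extend_zero {α β γ δ : Type*} [Zero γ] [Zero δ] {f : α → β}
    (hf : Function.Injective f) (u : α → γ) (g : γ → δ) (hg : g 0 = 0) :
    (fun n => g (Function.extend f u 0 n)) = Function.extend f (fun i => g (u i)) 0 := by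
  ext n
  by_cases h : ∃ i, f i = n
  · obtain ⟨i, rfl⟩ := h
    simp [hf.extend_apply]
  · simp [Function.extend_apply' _ _ _ h, hg]

variable [CompleteSpace H] [SeparableSpace H]

instance : Countable ↑(exists_hilbertBasis ℂ H).choose :=
  countable_of_orthonormal (traceBasis H).orthonormal

/-- A positive operator with bounded diagonal sums is trace class, with a positive nuclear form. -/
theorem exists_nuclear_of_isPositive {ρ : H →L[ℂ] H} (hρ : ρ.IsPositive) {M : ℝ}
    (hM : ∀ s : Finset ↑(exists_hilbertBasis ℂ H).choose,
      ∑ i ∈ s, (⟪traceBasis H i, ρ (traceBasis H i)⟫_ℂ).re ≤ M) :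
    ∃ a : ℕ → H, (Summable fun n => ‖a n‖ ^ 2) ∧ ∑' n, ‖a n‖ ^ 2 ≤ M ∧
      ∀ z, HasSum (fun n => ⟪a n, z⟫_ℂ • a n) (ρ z) := by
  set e := traceBasis H
  have h0 : 0 ≤ ρ := (ContinuousLinearMap.nonneg_iff_isPositive _).2 hρ
  set S := CFC.sqrt ρ
  have hSS : S * S = ρ := CFC.sqrt_mul_sqrt_self ρ h0
  have hSa : IsSelfAdjoint S := (CFC.sqrt_nonneg ρ).isSelfAdjoint
  have hSi : ∀ u v, ⟪S u, v⟫_ℂ = ⟪u, S v⟫_ℂ := fun u v => by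
    conv_rhs => rw [← hSa.adjoint_eq, ContinuousLinearMap.adjoint_inner_right]
  have hn : ∀ i, ‖S (e i)‖ ^ 2 = (⟪e i, ρ (e i)⟫_ℂ).re := fun i => by
    rw [← hSS, mul_apply_eq_comp, ← hSi, ← @inner_self_eq_norm_sq ℂ]
    rfl
  have hsum : Summable fun i => ‖S (e i)‖ ^ 2 :=
    summable_of_sum_le (fun _ => by positivity) (c := M) (fun s => by
      simpa only [hn] using hM s)
  obtain ⟨f, hf⟩ := Countable.exists_injective_nat ↑(exists_hilbertBasis ℂ H).choose
  refine ⟨Function.extend f (fun i => S (e i)) 0, ?_, ?_, fun z => ?_⟩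
  · rw [comp_extend_zero hf _ (fun x : H => ‖x‖ ^ 2) (by simp)]
    exact (summable_extend_zero hf).2 hsum
  · rw [comp_extend_zero hf _ (fun x : H => ‖x‖ ^ 2) (by simp), tsum_extend_zero hf]
    exact hsum.tsum_le_of_sum_le fun s => by simpa only [hn] using hM s
  · rw [comp_extend_zero hf _ (fun x : H => ⟪x, z⟫_ℂ • x) (by simp)]
    rw [hasSum_extend_zero hf]
    -- Expanding `S z` in the basis and applying `S` gives `ρ z = ∑ ⟪S eᵢ, z⟫ S eᵢ`, so the nuclear
    -- vectors are the `S eᵢ`.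
    have h := (e.hasSum_repr (S z)).mapL S
    rw [← mul_apply_eq_comp, hSS] at h
    refine h.congr_fun fun i => ?_
    simp [e.repr_apply_apply, hSi]

/-- The function `min 1 (m t⁺)` is a continuous substitute for the indicator of `t > 0`, within
reach of the continuous functional calculus. -/
theorem norm_mul_min_sub_posPart_le {m : ℝ} (hm : 0 < m) (t : ℝ) :
    0 ≤ t * min 1 (m * max t 0) ∧ ‖t * min 1 (m * max t 0) - max t 0‖ ≤ m⁻¹ := by
  have hmi : 0 < m⁻¹ := inv_pos.2 hm
  rcases le_total t 0 with h | h
  · simp [max_eq_right h, hmi.le]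
  · rw [max_eq_left h]
    rcases le_total 1 (m * t) with h' | h'
    · simp [min_eq_left h', h, hmi.le]
    · rw [min_eq_right h']
      have ht : t ≤ m⁻¹ := by rwa [← one_div, le_div_iff₀' hm]
      refine ⟨by positivity, ?_⟩
      rw [Real.norm_eq_abs, abs_le]
      constructor <;> nlinarith [mul_nonneg h (sub_nonneg.2 h'), mul_nonneg hm.le h]

-- Test the trace bound on `f_m(Ω)`, a contraction approximating the spectral projection onto the
-- positive part. As `Ω f_m(Ω)` is positive, its partial diagonal sums are at most its trace, hence
-- at most `M`, and it tends to `Ω⁺` in norm.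
omit [SeparableSpace H] in
theorem sum_diag_posPart_le (Ω : TraceClassSA H) {M : ℝ} (hM0 : 0 ≤ M)
    (hM : ∀ A : H →L[ℂ] H, ‖trace ((Ω : H →L[ℂ] H) * A)‖ ≤ M * ‖A‖)
    (s : Finset ↑(exists_hilbertBasis ℂ H).choose) :
    ∑ i ∈ s, (⟪traceBasis H i, (Ω : H →L[ℂ] H)⁺ (traceBasis H i)⟫_ℂ).re ≤ M := by
  set W : H →L[ℂ] H := (Ω : H →L[ℂ] H)
  have hW : IsSelfAdjoint W := Ω.2.2
  set f : ℕ → ℝ → ℝ := fun m t => min 1 ((m + 1 : ℝ) * max t 0)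
  have hf : ∀ m, Continuous (f m) := fun m => by fun_prop
  have hmul : ∀ m, W * cfc (f m) W = cfc (fun t => t * f m t) W := fun m => by
    rw [cfc_mul (fun t => t) (f m) W (by fun_prop) (hf m).continuousOn, cfc_id' ℝ W]
  have hpos : W⁺ = cfc (fun t : ℝ => max t 0) W := by
    rw [CFC.posPart_def, cfcₙ_eq_cfc]
    rfl
  have hlim : Tendsto (fun m => W * cfc (f m) W) atTop (𝓝 W⁺) := by
    rw [tendsto_iff_norm_sub_tendsto_zero]
    refine squeeze_zero (fun _ => norm_nonneg _) (fun m => ?_)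
      tendsto_one_div_add_atTop_nhds_zero_nat
    rw [hmul, hpos, ← cfc_sub (fun t => t * f m t) _ W (by fun_prop) (by fun_prop)]
    refine norm_cfc_le (by positivity) fun t _ => ?_
    rw [one_div]
    exact (norm_mul_min_sub_posPart_le (by positivity) t).2
  have hb : ∀ m, ∑ i ∈ s, (⟪traceBasis H i, (W * cfc (f m) W) (traceBasis H i)⟫_ℂ).re ≤ M := by
    intro m
    have hP : (W * cfc (f m) W).IsPositive := by
      rw [← ContinuousLinearMap.nonneg_iff_isPositive, hmul]
      exact cfc_nonneg fun t _ => (norm_mul_min_sub_posPart_le (by positivity) t).1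
    have hS := Complex.hasSum_re
      ((Ω.2.1.mul_right (cfc (f m) W)).summable_diag (traceBasis H).orthonormal).hasSum
    refine (sum_le_hasSum s (fun i _ => hP.re_inner_nonneg_right _) hS).trans ?_
    refine (Complex.re_le_norm _).trans ((hM (cfc (f m) W)).trans ?_)
    refine mul_le_of_le_one_right hM0 (norm_cfc_le zero_le_one fun t _ => ?_)
    rw [Real.norm_of_nonneg (by positivity)]
    exact min_le_left _ _
  refine le_of_tendsto (b := M) (x := atTop) ?_ (Eventually.of_forall hb)
  refine tendsto_finsetSum _ fun i _ => ?_
  refine (Complex.continuous_re.tendsto _).comp (tendsto_const_nhds.inner ?_)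
  exact ((ContinuousLinearMap.apply ℂ H (traceBasis H i)).continuous.tendsto _).comp hlim

/-- A bound on the trace norm of a self-adjoint trace-class operator bounds its positive and
negative parts. -/
theorem TraceClassSA.exists_diagonal_form (Ω : TraceClassSA H) {M : ℝ} (hM0 : 0 ≤ M)
    (hM : ∀ A : H →L[ℂ] H, ‖trace ((Ω : H →L[ℂ] H) * A)‖ ≤ M * ‖A‖) :
    ∃ a b : ℕ → H, (Summable fun n => ‖a n‖ ^ 2) ∧ (Summable fun n => ‖b n‖ ^ 2) ∧
      ∑' n, ‖a n‖ ^ 2 ≤ M ∧ ∑' n, ‖b n‖ ^ 2 ≤ M ∧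
      ∀ A : H →L[ℂ] H, trace ((Ω : H →L[ℂ] H) * A)
        = ∑' i, ⟪a i, A (a i)⟫_ℂ - ∑' i, ⟪b i, A (b i)⟫_ℂ := by
  obtain ⟨a, ha, haM, haz⟩ := exists_nuclear_of_isPositive
    ((ContinuousLinearMap.nonneg_iff_isPositive _).1 (CFC.posPart_nonneg (Ω : H →L[ℂ] H)))
    (sum_diag_posPart_le Ω hM0 hM)
  obtain ⟨b, hb, hbM, hbz⟩ := exists_nuclear_of_isPositive
    ((ContinuousLinearMap.nonneg_iff_isPositive _).1 (CFC.negPart_nonneg (Ω : H →L[ℂ] H)))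
    (M := M) (by
      rw [← CFC.posPart_neg]
      exact sum_diag_posPart_le (-Ω) hM0 fun A => by
        simpa [trace_neg] using hM A)
  refine ⟨a, b, ha, hb, haM, hbM, fun A => ?_⟩
  simp only [sq] at ha hb
  rw [← trace_mul_eq_tsum ha haz, ← trace_mul_eq_tsum hb hbz,
    ← trace_sub_mul ⟨a, a, ha, haz⟩ ⟨b, b, hb, hbz⟩, CFC.posPart_sub_negPart _ Ω.2.2]

end Positive

/-! ### Normal maps and their preduals. -/

section Normal

/-- A positive linear map of operators that is continuous along bounded weakly convergent
sequences. -/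
structure IsNormalMap {K T : Type*} [NormedAddCommGroup K] [InnerProductSpace ℂ K]
    [NormedAddCommGroup T] [InnerProductSpace ℂ T]
    (Θ : (K →L[ℂ] K) → (T →L[ℂ] T)) : Prop where
  add : ∀ A B, Θ (A + B) = Θ A + Θ B
  smul : ∀ (c : ℂ) A, Θ (c • A) = c • Θ A
  positive : ∀ A, A.IsPositive → (Θ A).IsPositive
  bounded : ∃ C : ℝ, 0 ≤ C ∧ ∀ A, ‖Θ A‖ ≤ C * ‖A‖
  normal : ∀ (Y : ℕ → K →L[ℂ] K) (C : ℝ) (Z : K →L[ℂ] K), (∀ n, ‖Y n‖ ≤ C) →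
    WeakTendsto Y atTop Z → WeakTendsto (fun n => Θ (Y n)) atTop (Θ Z)

theorem IsNormalMap.comp {K T L : Type*} [NormedAddCommGroup K] [InnerProductSpace ℂ K]
    [NormedAddCommGroup T] [InnerProductSpace ℂ T] [NormedAddCommGroup L] [InnerProductSpace ℂ L]
    {Θ : (K →L[ℂ] K) → (T →L[ℂ] T)} {Ξ : (L →L[ℂ] L) → (K →L[ℂ] K)} (hΘ : IsNormalMap Θ)
    (hΞ : IsNormalMap Ξ) : IsNormalMap fun A => Θ (Ξ A) where
  add A B := by rw [hΞ.add, hΘ.add]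
  smul c A := by rw [hΞ.smul, hΘ.smul]
  positive A hA := hΘ.positive _ (hΞ.positive _ hA)
  bounded := by
    obtain ⟨C, hC0, hC⟩ := hΘ.bounded
    obtain ⟨D, hD0, hD⟩ := hΞ.bounded
    refine ⟨C * D, by positivity, fun A => (hC _).trans ?_⟩
    rw [mul_assoc]
    gcongr
    exact hD A
  normal Y C Z hC hY := by
    obtain ⟨D, hD0, hD⟩ := hΞ.bounded
    exact hΘ.normal _ (D * C) _ (fun n => (hD _).trans (by gcongr; exact hC n))
      (hΞ.normal Y C Z hC hY)

theorem exists_bound_of_positive {K T : Type*} [NormedAddCommGroup K] [InnerProductSpace ℂ K]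
    [CompleteSpace K] [NormedAddCommGroup T] [InnerProductSpace ℂ T] [CompleteSpace T]
    {Θ : (K →L[ℂ] K) → (T →L[ℂ] T)} (add : ∀ A B, Θ (A + B) = Θ A + Θ B)
    (smul : ∀ (c : ℂ) A, Θ (c • A) = c • Θ A) (pos : ∀ A, A.IsPositive → (Θ A).IsPositive) :
    ∃ C : ℝ, 0 ≤ C ∧ ∀ A, ‖Θ A‖ ≤ C * ‖A‖ := by
  obtain ⟨C, hC⟩ := PositiveLinearMap.exists_norm_apply_le
    (PositiveLinearMap.mk₀ (R := ℂ) (⟨⟨Θ, add⟩, smul⟩ : (K →L[ℂ] K) →ₗ[ℂ] (T →L[ℂ] T))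
    (fun A hA => (ContinuousLinearMap.nonneg_iff_isPositive _).2
      (pos A ((ContinuousLinearMap.nonneg_iff_isPositive _).1 hA))))
  exact ⟨C, C.2, hC⟩

variable {K : Type*} [NormedAddCommGroup K] [InnerProductSpace ℂ K] [CompleteSpace K]

/-- The orthogonal projection onto the span of finitely many vectors of a Hilbert basis. -/
def finProj {ι : Type*} (e : HilbertBasis ι ℂ K) (s : Finset ι) : K →L[ℂ] K :=
  ∑ i ∈ s, InnerProductSpace.rankOne ℂ (e i) (e i)

omit [CompleteSpace K] in
theorem inner_finProj {ι : Type*} (e : HilbertBasis ι ℂ K) (s : Finset ι) (u v : K) :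
    ⟪u, finProj e s v⟫_ℂ = ∑ i ∈ s, ⟪u, e i⟫_ℂ * ⟪e i, v⟫_ℂ := by
  simp [finProj, mul_comm]

omit [CompleteSpace K] in
theorem isEffect_finProj {ι : Type*} (e : HilbertBasis ι ℂ K) (s : Finset ι) :
    IsEffect (finProj e s) := by
  have h : ∀ u, ⟪u, finProj e s u⟫_ℂ = ((∑ i ∈ s, ‖⟪e i, u⟫_ℂ‖ ^ 2 : ℝ) : ℂ) := fun u => by
    rw [inner_finProj]
    push_cast
    refine Finset.sum_congr rfl fun i _ => ?_
    rw [← inner_conj_symm, ← Complex.normSq_eq_conj_mul_self, Complex.normSq_eq_norm_sq]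
    push_cast
    rfl
  refine ⟨isPositive_of_inner_nonneg fun u => ?_, isPositive_of_inner_nonneg fun u => ?_⟩
  · rw [h]
    exact_mod_cast Finset.sum_nonneg fun i _ => by positivity
  · have hB := e.orthonormal.sum_inner_products_le u (s := s)
    simp only [sub_apply, one_apply_eq_self, inner_sub_right, h,
      inner_self_eq_norm_sq_to_K]
    rw [sub_nonneg]
    exact (Complex.real_le_real.2 hB).trans_eq (by simp)

omit [CompleteSpace K] in
theorem weakTendsto_finProj_mul {ι : Type*} (e : HilbertBasis ι ℂ K) (A : K →L[ℂ] K) :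
    WeakTendsto (fun s => finProj e s * A) atTop A := fun u v => by
  simpa only [mul_apply_eq_comp, inner_finProj, HasSum,
    SummationFilter.unconditional_filter] using e.hasSum_inner_mul_inner u (A v)

variable [SeparableSpace K]

/-- Normal positive functionals on operators are given by positive trace-class operators. -/
theorem exists_nuclear_of_functional {φ : (K →L[ℂ] K) → ℂ} (add : ∀ A B, φ (A + B) = φ A + φ B)
    (smul : ∀ (c : ℂ) A, φ (c • A) = c * φ A) (pos : ∀ A, A.IsPositive → 0 ≤ φ A)
    (normal : ∀ (Y : ℕ → K →L[ℂ] K) (C : ℝ) (Z : K →L[ℂ] K), (∀ n, ‖Y n‖ ≤ C) →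
      WeakTendsto Y atTop Z → Tendsto (fun n => φ (Y n)) atTop (𝓝 (φ Z))) :
    ∃ a : ℕ → K, (Summable fun n => ‖a n‖ ^ 2) ∧ ∀ A, φ A = ∑' n, ⟪a n, A (a n)⟫_ℂ := by
  let φl : (K →L[ℂ] K) →ₗ[ℂ] ℂ := ⟨⟨φ, add⟩, smul⟩
  obtain ⟨C, hC⟩ := PositiveLinearMap.exists_norm_apply_le
    (PositiveLinearMap.mk₀ (R := ℂ) φl
    (fun A hA => pos A ((ContinuousLinearMap.nonneg_iff_isPositive _).1 hA)))
  replace hC : ∀ A, ‖φ A‖ ≤ C * ‖A‖ := hC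
  let Bl : K →ₗ⋆[ℂ] K →ₗ[ℂ] ℂ := LinearMap.mk₂'ₛₗ _ _
    (fun v w => φ (InnerProductSpace.rankOne ℂ w v))
    (fun v v' w => by rw [map_add, add]) (fun c v w => by rw [map_smulₛₗ, smul]; rfl)
    (fun v w w' => by rw [map_add, add_apply, add])
    (fun c v w => by rw [map_smul, smul_apply, smul]; rfl)
  -- The density of `φ` is read off from its values on rank-one operators.
  set ρ : K →L[ℂ] K := InnerProductSpace.continuousLinearMapOfBilin
    (Bl.mkContinuous₂ C fun v w => (hC _).trans_eq (by
      rw [InnerProductSpace.norm_rankOne]; ring)) with hρdef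
  have hρ : ∀ v w, ⟪ρ v, w⟫_ℂ = φ (InnerProductSpace.rankOne ℂ w v) := fun v w => by
    rw [hρdef, InnerProductSpace.continuousLinearMapOfBilin_apply]
    rfl
  have hpos : ρ.IsPositive := isPositive_of_inner_nonneg fun v => by
    rw [← inner_conj_symm, hρ]
    exact star_nonneg_iff.2 (pos _ (InnerProductSpace.isPositive_rankOne_self v))
  have hρ' : ∀ v w, ⟪v, ρ w⟫_ℂ = φ (InnerProductSpace.rankOne ℂ w v) := fun v w => by
    rw [← hpos.inner_left_eq_inner_right, hρ]
  have hsum : ∀ {ι : Type _} (s : Finset ι) (f : ι → K →L[ℂ] K),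
      φ (∑ i ∈ s, f i) = ∑ i ∈ s, φ (f i) := fun s f => map_sum φl f s
  -- The partial diagonal sums of `ρ` are values of `φ` at finite-rank projections, hence bounded by
  -- `C`.
  obtain ⟨a, ha, -, hz⟩ := exists_nuclear_of_isPositive hpos (M := C) (fun s => by
    have : ∑ i ∈ s, (⟪traceBasis K i, ρ (traceBasis K i)⟫_ℂ).re
        = (φ (finProj (traceBasis K) s)).re := by
      rw [finProj, hsum, Complex.re_sum]
      exact Finset.sum_congr rfl fun i _ => by rw [hρ']
    rw [this]
    refine (Complex.re_le_norm _).trans ((hC _).trans ?_)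
    exact mul_le_of_le_one_right C.2 (isEffect_finProj _ s).norm_le_one)
  refine ⟨a, ha, fun A => ?_⟩
  have hs : Summable fun n => ‖a n‖ * ‖a n‖ := by simpa only [sq] using ha
  have htr := trace_mul_eq_tsum hs hz
  have hTC : IsTraceClass ρ := ⟨a, a, hs, hz⟩
  rw [← htr]
  have hfin : ∀ s, φ (finProj (traceBasis K) s * A)
      = trace (ρ * (finProj (traceBasis K) s * A)) := by
    intro s
    have hr : ∀ i, InnerProductSpace.rankOne ℂ (traceBasis K i) (traceBasis K i) * A
        = InnerProductSpace.rankOne ℂ (traceBasis K i)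
          (ContinuousLinearMap.adjoint A (traceBasis K i)) := fun i => by
      ext v
      simp [ContinuousLinearMap.adjoint_inner_left]
    classical
    rw [finProj, Finset.sum_mul, hsum]
    induction s using Finset.induction_on with
    | empty => simp [trace]
    | insert i s hi ih =>
      rw [Finset.sum_insert hi, Finset.sum_insert hi, mul_add,
        trace_add (hTC.mul_right _) (hTC.mul_right _), ih, hr, trace_mul_rankOne hTC, hρ']
  -- The basis is countable, so a sequence of finite sets exhausts it and sequential normality is
  -- enough to pass from finite rank to all `A`.
  obtain ⟨s, hs⟩ := exists_seq_tendsto (atTop : Filter (Finset ↑(exists_hilbertBasis ℂ K).choose))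
  have hb : ∀ n, ‖finProj (traceBasis K) (s n) * A‖ ≤ ‖A‖ := fun n =>
    (norm_mul_le _ _).trans (mul_le_of_le_one_left (norm_nonneg _)
      (isEffect_finProj _ _).norm_le_one)
  have hw : WeakTendsto (fun n => finProj (traceBasis K) (s n) * A) atTop A := fun u v =>
    (weakTendsto_finProj_mul (traceBasis K) A u v).comp hs
  refine tendsto_nhds_unique (normal _ _ A hb hw) ?_
  simp only [hfin]
  exact hTC.tendsto_trace_mul hb hw

/-- The predual of a normal map, on self-adjoint trace-class operators. -/
theorem IsNormalMap.exists_predual {T : Type*} [NormedAddCommGroup T] [InnerProductSpace ℂ T]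
    [CompleteSpace T] [SeparableSpace T] {Θ : (K →L[ℂ] K) → (T →L[ℂ] T)} (hΘ : IsNormalMap Θ)
    (Ω : TraceClassSA T) : ∃ ρ : TraceClassSA K, ∀ A : K →L[ℂ] K,
      trace ((ρ : K →L[ℂ] K) * A) = trace ((Ω : T →L[ℂ] T) * Θ A) := by
  have key : ∀ a : ℕ → T, (Summable fun n => ‖a n‖ ^ 2) → ∃ b : ℕ → K,
      (Summable fun n => ‖b n‖ ^ 2) ∧
        ∀ A, ∑' n, ⟪a n, Θ A (a n)⟫_ℂ = ∑' n, ⟪b n, A (b n)⟫_ℂ := by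
    intro a ha
    have hs : Summable fun n => ‖a n‖ * ‖a n‖ := by simpa only [sq] using ha
    have hS : ∀ B : T →L[ℂ] T, Summable fun n => ⟪a n, B (a n)⟫_ℂ := fun B =>
      Summable.of_norm_bounded (hs.mul_left ‖B‖)
        fun n => (norm_inner_apply_le le_rfl _ _).trans_eq (by ring)
    obtain ⟨C, hC0, hC⟩ := hΘ.bounded
    refine exists_nuclear_of_functional (φ := fun A => ∑' n, ⟪a n, Θ A (a n)⟫_ℂ) ?_ ?_ ?_ ?_
    · intro A B
      simp only [hΘ.add, add_apply, inner_add_right]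
      exact (hS _).tsum_add (hS _)
    · intro c A
      simp only [hΘ.smul, smul_apply, inner_smul_right]
      exact tsum_mul_left
    · intro A hA
      exact tsum_nonneg fun n => (hΘ.positive A hA).inner_nonneg_right _
    · intro Y D Z hD hY
      exact tendsto_tsum_inner (C := C * D) (fun n => (hC _).trans (by gcongr; exact hD n))
        (hΘ.normal Y D Z hD hY) hs
  obtain ⟨M, hM0, hM⟩ := Ω.2.1.exists_bound
  -- A positive map composed with a difference of two positive normal functionals is again such a
  -- difference, so each part is treated separately.
  obtain ⟨a, b, ha, hb, -, -, htr⟩ := TraceClassSA.exists_diagonal_form Ω hM0 hM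
  obtain ⟨a', ha', haa⟩ := key a ha
  obtain ⟨b', hb', hbb⟩ := key b hb
  obtain ⟨ρ, hρ⟩ := exists_traceClassSA ha' hb'
  exact ⟨ρ, fun A => by rw [hρ, htr, haa, hbb]⟩

/-- Series of self-adjoint trace-class operators with summable trace norms converge. -/
theorem exists_hasSum_trace (Ω : ℕ → TraceClassSA K) {M : ℕ → ℝ} (hM0 : ∀ k, 0 ≤ M k)
    (hM : ∀ k (A : K →L[ℂ] K), ‖trace ((Ω k : K →L[ℂ] K) * A)‖ ≤ M k * ‖A‖) (hs : Summable M) :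
    ∃ ρ : TraceClassSA K, ∀ A : K →L[ℂ] K,
      HasSum (fun k => trace ((Ω k : K →L[ℂ] K) * A)) (trace ((ρ : K →L[ℂ] K) * A)) := by
  -- An arbitrary nuclear form of `Ω k` may have a nuclear sum far above `M k`. The diagonal forms
  -- are controlled by `M k`, so all their vectors together, reindexed by `ℕ × ℕ ≃ ℕ`, remain square
  -- summable.
  choose a b ha hb haM hbM htr using fun k => TraceClassSA.exists_diagonal_form (Ω k) (hM0 k) (hM k)
  have key : ∀ a : ℕ → ℕ → K, (∀ k, Summable fun n => ‖a k n‖ ^ 2) →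
      (∀ k, ∑' n, ‖a k n‖ ^ 2 ≤ M k) →
      (Summable fun n => ‖a (Nat.pairEquiv.symm n).1 (Nat.pairEquiv.symm n).2‖ ^ 2) ∧
      ∀ A : K →L[ℂ] K, HasSum (fun k => ∑' n, ⟪a k n, A (a k n)⟫_ℂ)
        (∑' n, ⟪a (Nat.pairEquiv.symm n).1 (Nat.pairEquiv.symm n).2,
          A (a (Nat.pairEquiv.symm n).1 (Nat.pairEquiv.symm n).2)⟫_ℂ) := by
    intro a ha haM
    have h1 : Summable fun p : ℕ × ℕ => ‖a p.1 p.2‖ ^ 2 := by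
      rw [summable_prod_of_nonneg fun _ => by positivity]
      exact ⟨ha, Summable.of_nonneg_of_le (fun _ => tsum_nonneg fun _ => by positivity) haM hs⟩
    refine ⟨(Nat.pairEquiv.symm.summable_iff (f := fun p : ℕ × ℕ => ‖a p.1 p.2‖ ^ 2)).2 h1,
      fun A => ?_⟩
    have h2 : Summable fun p : ℕ × ℕ => ⟪a p.1 p.2, A (a p.1 p.2)⟫_ℂ :=
      Summable.of_norm_bounded (h1.mul_left ‖A‖)
        fun n => (norm_inner_apply_le le_rfl _ _).trans_eq (by ring)
    rw [Nat.pairEquiv.symm.tsum_eq fun p : ℕ × ℕ => ⟪a p.1 p.2, A (a p.1 p.2)⟫_ℂ]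
    exact h2.hasSum.prod_fiberwise fun k => (h2.prod_factor k).hasSum
  obtain ⟨ha1, ha2⟩ := key a ha haM
  obtain ⟨hb1, hb2⟩ := key b hb hbM
  obtain ⟨ρ, hρ⟩ := exists_traceClassSA ha1 hb1
  refine ⟨ρ, fun A => ?_⟩
  rw [hρ]
  simp only [htr]
  exact (ha2 A).sub (hb2 A)

end Normal

/-! ### Operators on tensor decompositions. -/

section Splits
variable {R K T : Type*} [NormedAddCommGroup R] [InnerProductSpace ℂ R]
  [NormedAddCommGroup K] [InnerProductSpace ℂ K] [NormedAddCommGroup T] [InnerProductSpace ℂ T]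

instance [SeparableSpace R] [SeparableSpace K] : SeparableSpace (R ⊗ₕ K) := by
  have h1 : IsSeparable {z : R ⊗ₕ K | ∃ x y, z = (toH (x ⊗ₜ[ℂ] y))} := by
    have : {z : R ⊗ₕ K | ∃ x y, z = (toH (x ⊗ₜ[ℂ] y))}
        = Set.range fun p : R × K => (toH (p.1 ⊗ₜ[ℂ] p.2) : R ⊗ₕ K) := by
      ext z
      simp [eq_comm]
    rw [this]
    exact isSeparable_range (toH.continuous.comp
      (TensorProduct.continuous_tmul.comp (continuous_fst.prodMk continuous_snd)))
  have h2 := (h1.span (R := ℂ)).closure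
  rw [hTensor_dense.closure_eq] at h2
  exact isSeparable_univ_iff.1 h2

theorem inner_self_eq_ofReal (r : R) : ⟪r, r⟫_ℂ = ((‖r‖ ^ 2 : ℝ) : ℂ) := by
  rw [inner_self_eq_norm_sq_to_K, Complex.ofReal_pow]
  rfl

theorem adjoint_sqrt_comp_sqrt {H : Type*} [NormedAddCommGroup H] [InnerProductSpace ℂ H]
    [CompleteSpace H] {A : H →L[ℂ] H} (hA : A.IsPositive) :
    ContinuousLinearMap.adjoint (CFC.sqrt A) ∘L CFC.sqrt A = A := by
  have h0 : 0 ≤ A := (ContinuousLinearMap.nonneg_iff_isPositive _).2 hA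
  rw [(CFC.sqrt_nonneg A).isSelfAdjoint.adjoint_eq]
  exact CFC.sqrt_mul_sqrt_self A h0

/-- The operator `A ⊗ B` is `T* T` with `T = √A ⊗ √B`. -/
theorem isPositive_hmap [CompleteSpace R] [CompleteSpace K] {A : R →L[ℂ] R} {B : K →L[ℂ] K}
    (hA : A.IsPositive) (hB : B.IsPositive) : (hmap A B).IsPositive := by
  have := ContinuousLinearMap.isPositive_adjoint_comp_self (hmap (CFC.sqrt A) (CFC.sqrt B))
  rwa [adjoint_hmap, hmap_comp, adjoint_sqrt_comp_sqrt hA, adjoint_sqrt_comp_sqrt hB] at this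

theorem isEffect_hmap [CompleteSpace R] [CompleteSpace K] {A : R →L[ℂ] R} {B : K →L[ℂ] K}
    (hA : IsEffect A) (hB : IsEffect B) : IsEffect (hmap A B) := by
  refine ⟨isPositive_hmap hA.1 hB.1, ?_⟩
  have : 1 - hmap A B = hmap (1 - A) 1 + hmap A (1 - B) := hmap_ext fun x y => by
    simp [hmap_tmul, TensorProduct.sub_tmul, TensorProduct.tmul_sub]
  rw [this]
  exact (isPositive_hmap hA.2 ContinuousLinearMap.isPositive_one).add (isPositive_hmap hA.1 hB.2)

namespace TensorSplit
variable (D : TensorSplit R K T)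

theorem norm_slot (r : R) (k : K) : ‖D.slot r k‖ = ‖r‖ * ‖k‖ := by
  have h := D.inner_slot r r k k
  simp only [inner_self_eq_ofReal] at h
  norm_cast at h
  have h' : ‖D.slot r k‖ ^ 2 = (‖r‖ * ‖k‖) ^ 2 := by rw [h]; ring
  exact (sq_eq_sq₀ (norm_nonneg _) (by positivity)).1 h'

theorem eq_zero_of_inner_slot {t : T} (h : ∀ r k, ⟪D.slot r k, t⟫_ℂ = 0) : t = 0 := by
  refine ext_inner_left ℂ fun v => ?_
  have : (innerSL ℂ).flip t = (0 : T →L⋆[ℂ] ℂ) := by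
    refine ContinuousLinearMap.ext_on D.dense_slot ?_
    rintro _ ⟨r, k, rfl⟩
    simpa using h r k
  simpa using congrArg (fun f => f v) this

/-- An operator vanishes if its expectation values in all product vectors do. -/
theorem determining_slot [CompleteSpace K] [CompleteSpace T] :
    Determining fun p : R × K => D.slot p.1 p.2 := by
  intro Z hZ
  -- Polarization in the second factor, through the compression of `Z` by `slot r`.
  have h1 : ∀ r k k', ⟪D.slot r k, Z (D.slot r k')⟫_ℂ = 0 := by
    intro r k k'
    have : ContinuousLinearMap.adjoint (D.slot r) ∘L Z ∘L D.slot r = 0 :=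
      eq_zero_of_inner_self fun v => by
        simpa [ContinuousLinearMap.adjoint_inner_right] using hZ (r, v)
    have h := congrArg (fun f => ⟪k, f k'⟫_ℂ) this
    simpa [ContinuousLinearMap.adjoint_inner_right] using h
  -- Polarization in the first factor: `r + r'` kills the sum of the two cross terms and `r + i r'`
  -- their difference.
  have h2 : ∀ r r' k k', ⟪D.slot r k, Z (D.slot r' k')⟫_ℂ = 0 := by
    intro r r' k k'
    have e1 := h1 (r + r') k k'
    have e2 := h1 (r + Complex.I • r') k k'
    simp only [map_add, map_smul, add_apply, smul_apply, inner_add_left, inner_add_right,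
      inner_smul_left, inner_smul_right, h1, Complex.conj_I] at e1 e2
    have e3 : ⟪D.slot r k, Z (D.slot r' k')⟫_ℂ + ⟪D.slot r' k, Z (D.slot r k')⟫_ℂ = 0 := by
      linear_combination e1
    have e4 : ⟪D.slot r k, Z (D.slot r' k')⟫_ℂ - ⟪D.slot r' k, Z (D.slot r k')⟫_ℂ = 0 := by
      have := Complex.I_mul_I
      linear_combination (-Complex.I) * e2 +
        (⟪D.slot r k, Z (D.slot r' k')⟫_ℂ - ⟪D.slot r' k, Z (D.slot r k')⟫_ℂ) * this
    linear_combination (e3 + e4) / 2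
  refine ContinuousLinearMap.ext_on D.dense_slot ?_
  rintro _ ⟨r', k', rfl⟩
  exact D.eq_zero_of_inner_slot fun r k => h2 r r' k k'

/-- Product vectors of three factors determine operators. -/
theorem determining_slot_slot {S R' : Type*} [NormedAddCommGroup S] [InnerProductSpace ℂ S]
    [CompleteSpace S] [NormedAddCommGroup R'] [InnerProductSpace ℂ R'] [CompleteSpace K]
    [CompleteSpace T] (e : TensorSplit R' S K) :
    Determining fun p : R × R' × S => D.slot p.1 (e.slot p.2.1 p.2.2) := by
  intro Z hZ
  refine D.determining_slot Z fun p => ?_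
  have : ContinuousLinearMap.adjoint (D.slot p.1) ∘L Z ∘L D.slot p.1 = 0 :=
    e.determining_slot _ fun q => by
      simpa [ContinuousLinearMap.adjoint_inner_right] using hZ (p.1, q)
  have h := congrArg (fun f => ⟪p.2, f p.2⟫_ℂ) this
  simpa [ContinuousLinearMap.adjoint_inner_right] using h

section Op
variable [CompleteSpace R] [CompleteSpace K] [CompleteSpace T]

theorem inner_op_slot (A : R →L[ℂ] R) (B : K →L[ℂ] K) (r : R) (k : K) :
    ⟪D.slot r k, D.op A B (D.slot r k)⟫_ℂ = ⟪r, A r⟫_ℂ * ⟪k, B k⟫_ℂ := by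
  rw [op_slot, D.inner_slot]

theorem op_compl (A : R →L[ℂ] R) (B : K →L[ℂ] K) :
    1 - D.op A B = D.op (1 - A) 1 + D.op A (1 - B) :=
  D.determining_slot.eq fun p => by
    simp only [sub_apply, add_apply, one_apply_eq_self, op_slot, inner_sub_right,
      inner_add_right, D.inner_slot]
    ring

theorem isPositive_op {A : R →L[ℂ] R} {B : K →L[ℂ] K} (hA : A.IsPositive) (hB : B.IsPositive) :
    (D.op A B).IsPositive := by
  exact (isPositive_hmap hA hB).conj_adjoint D.toUnitary

theorem isEffect_op {A : R →L[ℂ] R} {B : K →L[ℂ] K} (hA : IsEffect A) (hB : IsEffect B) :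
    IsEffect (D.op A B) :=
  ⟨D.isPositive_op hA.1 hB.1, by
    rw [op_compl]
    exact (D.isPositive_op hA.2 ContinuousLinearMap.isPositive_one).add
      (D.isPositive_op hA.1 hB.2)⟩

end Op
end TensorSplit

end Splits

/-! ### Probability measures of a POVM. -/

section Measure
variable {G : Type*} [MeasurableSpace G] {H : Type*} [NormedAddCommGroup H]
  [InnerProductSpace ℂ H] [CompleteSpace H]

namespace POVM
variable (E : POVM G H)

theorem measure_apply (ψ : H) {X : Set G} (hX : MeasurableSet X) :
    E.measure ψ X = ENNReal.ofReal (⟪ψ, E.toFun X ψ⟫_ℂ).re :=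
  Measure.ofMeasurable_apply X hX

theorem isFiniteMeasure_measure (ψ : H) : IsFiniteMeasure (E.measure ψ) :=
  ⟨by rw [E.measure_apply ψ MeasurableSet.univ]; exact ENNReal.ofReal_lt_top⟩

instance (ψ : H) : IsFiniteMeasure (E.measure ψ) := E.isFiniteMeasure_measure ψ

theorem measure_real (ψ : H) {X : Set G} (hX : MeasurableSet X) :
    (((E.measure ψ).real X : ℝ) : ℂ) = ⟪ψ, E.toFun X ψ⟫_ℂ := by
  have hp := (E.positive X hX).inner_nonneg_right ψ
  rw [Measure.real, E.measure_apply ψ hX, ENNReal.toReal_ofReal (Complex.nonneg_iff.1 hp).1]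
  exact Complex.ext (by simp) (by simpa using (Complex.nonneg_iff.1 hp).2)

theorem measure_real_univ (ψ : H) : (E.measure ψ).real Set.univ = ‖ψ‖ ^ 2 := by
  have := E.measure_real ψ MeasurableSet.univ
  rw [E.univ, one_apply_eq_self, inner_self_eq_ofReal] at this
  exact_mod_cast this

theorem compl {X : Set G} (hX : MeasurableSet X) : 1 - E.toFun X = E.toFun Xᶜ := by
  refine sub_eq_zero.1 (eq_zero_of_inner_self fun ψ => ?_)
  have h := congrArg (fun x : ℝ => (x : ℂ)) (measureReal_add_measureReal_compl (μ := E.measure ψ) hX)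
  simp only [Complex.ofReal_add, E.measure_real ψ hX, E.measure_real ψ hX.compl,
    E.measure_real ψ MeasurableSet.univ, E.univ] at h
  simp only [sub_apply, inner_sub_right, ← h]
  ring

theorem isEffect {X : Set G} (hX : MeasurableSet X) : IsEffect (E.toFun X) :=
  ⟨E.positive X hX, by rw [E.compl hX]; exact E.positive _ hX.compl⟩

end POVM

end Measure

/-! ### The group action on operators. -/

section Rep
variable {G : Type*} [Group G] [TopologicalSpace G] {H : Type*} [NormedAddCommGroup H]
  [InnerProductSpace ℂ H] [CompleteSpace H]

namespace UnitaryRep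
variable (U : UnitaryRep G H)

/-- The unitary operator `U(g)`. -/
def act (g : G) : H →L[ℂ] H := (U.toHom g : H →L[ℂ] H)

theorem norm_act (g : G) (ψ : H) : ‖U.act g ψ‖ = ‖ψ‖ :=
  ContinuousLinearMap.norm_map_of_mem_unitary (U.toHom g).2 ψ

theorem act_mul (g h : G) (ψ : H) : U.act (g * h) ψ = U.act g (U.act h ψ) := by
  simp [act]

theorem act_one (ψ : H) : U.act 1 ψ = ψ := by
  simp [act]

theorem act_act_inv (g : G) (ψ : H) : U.act g (U.act g⁻¹ ψ) = ψ := by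
  rw [← act_mul, mul_inv_cancel, act_one]

theorem adjoint_act (g : G) : ContinuousLinearMap.adjoint (U.act g) = U.act g⁻¹ := by
  have : U.toHom g⁻¹ = (U.toHom g)⁻¹ := map_inv _ _
  rw [act, act, this]
  rfl

theorem conj_eq (g : G) (A : H →L[ℂ] H) : U.conj g A = U.act g ∘L A ∘L U.act g⁻¹ := by
  rw [← adjoint_act]
  rfl

theorem inner_conj (g : G) (A : H →L[ℂ] H) (ψ : H) :
    ⟪ψ, U.conj g A ψ⟫_ℂ = ⟪U.act g⁻¹ ψ, A (U.act g⁻¹ ψ)⟫_ℂ := by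
  rw [conj_eq, ← adjoint_act]
  simp [ContinuousLinearMap.adjoint_inner_left]

theorem isEffect_conj (g : G) {A : H →L[ℂ] H} (hA : IsEffect A) : IsEffect (U.conj g A) := by
  refine ⟨isPositive_of_inner_nonneg fun ψ => ?_, isPositive_of_inner_nonneg fun ψ => ?_⟩
  · rw [inner_conj]
    exact hA.1.inner_nonneg_right _
  · have := hA.2.inner_nonneg_right (U.act g⁻¹ ψ)
    simpa only [sub_apply, inner_sub_right, one_apply_eq_self, inner_conj,
      inner_self_eq_norm_sq_to_K, norm_act] using this

theorem conj_one (g : G) : U.conj g 1 = 1 := by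
  refine sub_eq_zero.1 (eq_zero_of_inner_self fun ψ => ?_)
  simp [inner_conj, inner_self_eq_norm_sq_to_K, norm_act]

theorem norm_inner_conj_le (g : G) {A : H →L[ℂ] H} {C : ℝ} (hA : ‖A‖ ≤ C) (ψ : H) :
    ‖⟪ψ, U.conj g A ψ⟫_ℂ‖ ≤ C * ‖ψ‖ * ‖ψ‖ := by
  rw [inner_conj]
  simpa [norm_act] using norm_inner_apply_le hA (U.act g⁻¹ ψ) (U.act g⁻¹ ψ)

variable [IsTopologicalGroup G]

theorem continuous_act_inv (ψ : H) : Continuous fun g => U.act g⁻¹ ψ :=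
  (U.continuous' ψ).comp continuous_inv

theorem continuous_inner_conj (A : H →L[ℂ] H) (ψ : H) :
    Continuous fun g => ⟪ψ, U.conj g A ψ⟫_ℂ := by
  simp only [inner_conj]
  exact (U.continuous_act_inv ψ).inner (A.continuous.comp (U.continuous_act_inv ψ))

theorem integrable_inner_conj [SecondCountableTopology G] [MeasurableSpace G] [BorelSpace G]
    (A : H →L[ℂ] H) (ψ : H) (μ : Measure G) [IsFiniteMeasure μ] :
    Integrable (fun g => ⟪ψ, U.conj g A ψ⟫_ℂ) μ :=
  Integrable.of_bound (U.continuous_inner_conj A ψ).measurable.aestronglyMeasurable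
    (‖A‖ * ‖ψ‖ * ‖ψ‖) (Eventually.of_forall fun g => U.norm_inner_conj_le g le_rfl ψ)

end UnitaryRep
end Rep

/-! ### Relativization as a limit of Riemann sums. -/

section RiemannSums
variable {G : Type*} [Group G] [TopologicalSpace G] [IsTopologicalGroup G]
  [SecondCountableTopology G] [T2Space G] [MeasurableSpace G] [BorelSpace G]

-- Replacing `g` by `s n g` in the integrand turns `∫ dE(g) ⊗ g.A` into finite sums of product
-- operators.
variable (G) in
theorem exists_simpleFunc_tendsto_id :
    ∃ s : ℕ → SimpleFunc G G, ∀ g, Tendsto (fun n => s n g) atTop (𝓝 g) := by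
  have h : StronglyMeasurable (id : G → G) := measurable_id.stronglyMeasurable
  exact ⟨h.approx, h.tendsto_approx⟩

variable {R K T : Type*} [NormedAddCommGroup R] [InnerProductSpace ℂ R] [CompleteSpace R]
  [NormedAddCommGroup K] [InnerProductSpace ℂ K] [CompleteSpace K]
  [NormedAddCommGroup T] [InnerProductSpace ℂ T] [CompleteSpace T]

/-- The integral `∫_Z dE(g) ⊗ s(g).A` for a simple function `s`. -/
def simpleIntegral (D : TensorSplit R K T) (E : POVM G R) (V : UnitaryRep G K)
    (s : SimpleFunc G G) (Z : Set G) (A : K →L[ℂ] K) : T →L[ℂ] T :=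
  ∑ x ∈ s.range, D.op (E.toFun (s ⁻¹' {x} ∩ Z)) (V.conj x A)

variable (D : TensorSplit R K T) (E : POVM G R) (V : UnitaryRep G K) (s : SimpleFunc G G)

omit [IsTopologicalGroup G] [SecondCountableTopology G] [T2Space G] [BorelSpace G] in
theorem inner_simpleIntegral {Z : Set G} (hZ : MeasurableSet Z) (A : K →L[ℂ] K) (r : R) (k : K) :
    ⟪D.slot r k, simpleIntegral D E V s Z A (D.slot r k)⟫_ℂ
      = ∫ g in Z, ⟪k, V.conj (s g) A k⟫_ℂ ∂(E.measure r) := by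
  have h : ∀ g, ⟪k, V.conj (s g) A k⟫_ℂ
      = ∑ x ∈ s.range, (s ⁻¹' {x}).indicator (fun _ => ⟪k, V.conj x A k⟫_ℂ) g := fun g => by
    rw [Finset.sum_eq_single (s g)]
    · simp
    · intro x _ hx
      exact Set.indicator_of_notMem (by simpa using hx.symm) _
    · simp
  simp_rw [h]
  rw [integral_finsetSum _ fun x _ => (integrable_const _).indicator (s.measurableSet_fiber x)]
  rw [simpleIntegral, sum_apply, inner_sum]
  refine Finset.sum_congr rfl fun x _ => ?_
  rw [integral_indicator_const _ (s.measurableSet_fiber x), D.inner_op_slot,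
    measureReal_restrict_apply (s.measurableSet_fiber x),
    ← E.measure_real r ((s.measurableSet_fiber x).inter hZ)]
  simp

-- The complement is again a sum of positive operators, because `E(Z) + E(Zᶜ) = 1`. The resulting
-- norm bound one, independent of `s`, is what makes the Riemann sums weakly compact.
omit [IsTopologicalGroup G] [SecondCountableTopology G] [T2Space G] [BorelSpace G] in
theorem isEffect_simpleIntegral {Z : Set G} (hZ : MeasurableSet Z) {A : K →L[ℂ] K}
    (hA : IsEffect A) : IsEffect (simpleIntegral D E V s Z A) := by
  have hpos : ∀ {Z : Set G}, MeasurableSet Z → ∀ {A : K →L[ℂ] K}, IsEffect A →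
      (simpleIntegral D E V s Z A).IsPositive := fun hZ _ hA =>
    ContinuousLinearMap.isPositive_sum _ fun x _ => D.isPositive_op
      (E.positive _ ((s.measurableSet_fiber x).inter hZ)) (V.isEffect_conj x hA).1
  have hsub : 1 - simpleIntegral D E V s Z A
      = simpleIntegral D E V s Z (1 - A) + simpleIntegral D E V s Zᶜ 1 := by
    rw [sub_eq_iff_eq_add]
    refine D.determining_slot.eq fun p => ?_
    have hi : ∀ Z : Set G, Integrable (fun g => ⟪p.2, V.conj (s g) A p.2⟫_ℂ)
        ((E.measure p.1).restrict Z) := fun Z =>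
      Integrable.of_bound (s.map fun g => ⟪p.2, V.conj g A p.2⟫_ℂ).measurable.aestronglyMeasurable
        (‖A‖ * ‖p.2‖ * ‖p.2‖) (Eventually.of_forall fun g => V.norm_inner_conj_le _ le_rfl _)
    have h1 : ∀ g, ⟪p.2, V.conj g (1 - A) p.2⟫_ℂ = ⟪p.2, p.2⟫_ℂ - ⟪p.2, V.conj g A p.2⟫_ℂ := by
      intro g
      simp [V.inner_conj, V.norm_act]
    simp only [add_apply, inner_add_right, inner_simpleIntegral, hZ, hZ.compl, V.conj_one, h1,
      one_apply_eq_self]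
    rw [integral_sub (integrable_const _) (hi Z)]
    simp only [integral_const, measureReal_restrict_apply, MeasurableSet.univ, Set.univ_inter,
      Complex.real_smul, E.measure_real _ hZ, E.measure_real _ hZ.compl, ← E.compl hZ, sub_apply,
      inner_sub_right, one_apply_eq_self, D.inner_slot]
    ring
  refine ⟨hpos hZ hA, ?_⟩
  rw [hsub]
  exact (hpos hZ hA.compl).add (hpos hZ.compl isEffect_one)

omit [SecondCountableTopology G] [T2Space G] [BorelSpace G] in
theorem tendsto_integral_inner_conj {s : ℕ → SimpleFunc G G}
    (hs : ∀ g, Tendsto (fun n => s n g) atTop (𝓝 g)) (μ : Measure G) [IsFiniteMeasure μ]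
    (A : K →L[ℂ] K) (k : K) :
    Tendsto (fun n => ∫ g, ⟪k, V.conj (s n g) A k⟫_ℂ ∂μ) atTop
      (𝓝 (∫ g, ⟪k, V.conj g A k⟫_ℂ ∂μ)) := by
  refine tendsto_integral_of_dominated_convergence (fun _ => ‖A‖ * ‖k‖ * ‖k‖) (fun n => ?_)
    (integrable_const _) (fun n => Eventually.of_forall fun g => V.norm_inner_conj_le _ le_rfl _)
    (Eventually.of_forall fun g => ((V.continuous_inner_conj A k).tendsto g).comp (hs g))
  exact ((s n).map fun g => ⟪k, V.conj g A k⟫_ℂ).measurable.aestronglyMeasurable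

namespace InternalFrame
variable (F : InternalFrame G R K T)

/-- For an effect, the Riemann sums are bounded by one, so they have a weak ultrafilter limit, whose
product expectations are the integrals by dominated convergence. Four effects give the general case
by linearity. -/
theorem exists_isRelativization (A : K →L[ℂ] K) : ∃ Y, F.IsRelativization A Y := by
  obtain ⟨s, hs⟩ := exists_simpleFunc_tendsto_id G
  have heff : ∀ A : K →L[ℂ] K, IsEffect A → ∃ Y, F.IsRelativization A Y := by
    intro A hA
    obtain ⟨Y, hY⟩ := exists_weakTendsto_ultrafilter (C := 1)
      (fun n => (isEffect_simpleIntegral F.split F.frame.povm F.restRep (s n)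
        MeasurableSet.univ hA).norm_le_one) (hyperfilter ℕ)
    refine ⟨Y, fun r k => tendsto_nhds_unique (hY _ _) ?_⟩
    simp only [inner_simpleIntegral _ _ _ _ MeasurableSet.univ, Measure.restrict_univ]
    exact (tendsto_integral_inner_conj F.restRep hs _ A k).mono_left
      (Nat.hyperfilter_le_atTop)
  obtain ⟨c, E, hE, rfl⟩ := exists_effect_decomposition A
  choose Y hY using fun i => heff (E i) (hE i)
  refine ⟨∑ i, c i • Y i, fun r k => ?_⟩
  simp only [sum_apply, smul_apply, inner_sum, inner_smul_right, hY _ r k]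
  simp only [UnitaryRep.inner_conj, sum_apply, smul_apply, inner_sum, inner_smul_right]
  simp only [← UnitaryRep.inner_conj]
  rw [integral_finsetSum _ fun i _ =>
    (F.restRep.integrable_inner_conj (E i) k _).const_mul (c i)]
  exact Finset.sum_congr rfl fun i _ => (integral_const_mul _ _).symm

theorem isRelativization_yen (A : K →L[ℂ] K) : F.IsRelativization A (F.yen A) := by
  rw [yen, dif_pos (F.exists_isRelativization A)]
  exact (F.exists_isRelativization A).choose_spec

theorem inner_yen (A : K →L[ℂ] K) (r : R) (k : K) :
    ⟪F.split.slot r k, F.yen A (F.split.slot r k)⟫_ℂ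
      = ∫ g, ⟪k, F.restRep.conj g A k⟫_ℂ ∂(F.frame.povm.measure r) :=
  F.isRelativization_yen A r k

theorem yen_add (A B : K →L[ℂ] K) : F.yen (A + B) = F.yen A + F.yen B := by
  refine F.split.determining_slot.eq fun p => ?_
  simp only [add_apply, inner_add_right, inner_yen]
  rw [← integral_add (F.restRep.integrable_inner_conj A _ _)
    (F.restRep.integrable_inner_conj B _ _)]
  simp only [UnitaryRep.inner_conj, add_apply, inner_add_right]

theorem yen_smul (c : ℂ) (A : K →L[ℂ] K) : F.yen (c • A) = c • F.yen A := by
  refine F.split.determining_slot.eq fun p => ?_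
  simp only [smul_apply, inner_smul_right, inner_yen]
  rw [← integral_const_mul]
  simp only [UnitaryRep.inner_conj, smul_apply, inner_smul_right]

theorem yen_one : F.yen 1 = 1 := by
  refine F.split.determining_slot.eq fun p => ?_
  simp only [inner_yen, UnitaryRep.conj_one, one_apply_eq_self, integral_const,
    POVM.measure_real_univ, F.split.inner_slot, Complex.real_smul]
  rw [inner_self_eq_ofReal p.1]

theorem yen_sum {ι : Type*} (s : Finset ι) (A : ι → K →L[ℂ] K) :
    F.yen (∑ i ∈ s, A i) = ∑ i ∈ s, F.yen (A i) :=
  map_sum (⟨⟨F.yen, F.yen_add⟩, F.yen_smul⟩ : (K →L[ℂ] K) →ₗ[ℂ] (T →L[ℂ] T)) A s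

theorem isPositive_yen {A : K →L[ℂ] K} (hA : A.IsPositive) : (F.yen A).IsPositive := by
  obtain ⟨c, E, hc, hE, rfl⟩ := exists_effect_of_isPositive hA
  rw [yen_smul]
  refine ContinuousLinearMap.IsPositive.smul_of_nonneg ?_ (Complex.zero_le_real.2 hc)
  obtain ⟨s, hs⟩ := exists_simpleFunc_tendsto_id G
  have heff := fun n => isEffect_simpleIntegral F.split F.frame.povm F.restRep (s n)
    MeasurableSet.univ hE
  refine WeakTendsto.isPositive (l := atTop) (F.split.determining_slot.weakTendsto (C := 1)
    (fun n => (heff n).norm_le_one) fun p => ?_) fun n => (heff n).1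
  simp only [inner_simpleIntegral _ _ _ _ MeasurableSet.univ, Measure.restrict_univ, inner_yen]
  exact tendsto_integral_inner_conj F.restRep hs _ E _

theorem isEffect_yen {A : K →L[ℂ] K} (hA : IsEffect A) : IsEffect (F.yen A) := by
  refine ⟨F.isPositive_yen hA.1, ?_⟩
  have h := F.yen_add A (1 - A)
  rw [add_sub_cancel, yen_one] at h
  rw [h, add_sub_cancel_left]
  exact F.isPositive_yen hA.2

/-- Normality is dominated convergence on `G`: the integrand is an expectation value of `Y n` in the
vector `g⁻¹k`, so it converges for each `g` separately. -/
theorem isNormalMap_yen : IsNormalMap F.yen where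
  add := F.yen_add
  smul := F.yen_smul
  positive _ := F.isPositive_yen
  bounded := exists_bound_of_positive F.yen_add F.yen_smul fun _ => F.isPositive_yen
  normal Y C Z hC hY := by
    obtain ⟨D, hD0, hD⟩ := exists_bound_of_positive F.yen_add F.yen_smul
      fun _ => F.isPositive_yen
    refine F.split.determining_slot.weakTendsto (C := D * C)
      (fun n => (hD _).trans (by gcongr; exact hC n)) fun p => ?_
    simp only [inner_yen]
    refine tendsto_integral_of_dominated_convergence (fun _ => C * ‖p.2‖ * ‖p.2‖)
      (fun n => (F.restRep.continuous_inner_conj _ _).measurable.aestronglyMeasurable)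
      (integrable_const _)
      (fun n => Eventually.of_forall fun g => F.restRep.norm_inner_conj_le g (hC n) _)
      (Eventually.of_forall fun g => ?_)
    simp only [UnitaryRep.inner_conj]
    exact hY _ _

omit [IsTopologicalGroup G] [SecondCountableTopology G] [T2Space G] [BorelSpace G]

theorem inner_restrict (ξ : R) (B : T →L[ℂ] T) (k k' : K) :
    ⟪k, F.restrict ξ B k'⟫_ℂ = ⟪F.split.slot ξ k, B (F.split.slot ξ k')⟫_ℂ := by
  simp [restrict, ContinuousLinearMap.adjoint_inner_right]

theorem restrict_one {ξ : R} (hξ : ‖ξ‖ = 1) : F.restrict ξ 1 = 1 := by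
  refine sub_eq_zero.1 (eq_zero_of_inner_self fun k => ?_)
  rw [sub_apply, inner_sub_right, inner_restrict, one_apply_eq_self, F.split.inner_slot,
    inner_self_eq_ofReal ξ, hξ]
  simp

theorem isNormalMap_restrict (ξ : R) : IsNormalMap (F.restrict ξ) := by
  have add : ∀ A B, F.restrict ξ (A + B) = F.restrict ξ A + F.restrict ξ B := fun A B => by
    simp [restrict]
  have smul : ∀ (c : ℂ) A, F.restrict ξ (c • A) = c • F.restrict ξ A := fun c A => by
    simp [restrict]
  have pos : ∀ A, A.IsPositive → (F.restrict ξ A).IsPositive := fun A hA =>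
    hA.adjoint_conj (F.split.slot ξ)
  refine ⟨add, smul, pos, exists_bound_of_positive add smul pos, fun Y C Z hC hY u v => ?_⟩
  simp only [inner_restrict]
  exact hY _ _

end InternalFrame
end RiemannSums

/-! ### Lifting along localizing sequences. -/

section Localization
variable {G : Type*} [Group G] [TopologicalSpace G] [IsTopologicalGroup G]
  [SecondCountableTopology G] [T2Space G] [MeasurableSpace G] [BorelSpace G]
variable {R K T : Type*} [NormedAddCommGroup R] [InnerProductSpace ℂ R] [CompleteSpace R]
  [NormedAddCommGroup K] [InnerProductSpace ℂ K] [CompleteSpace K]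
  [NormedAddCommGroup T] [InnerProductSpace ℂ T] [CompleteSpace T]

/-- `M` bounds the trace norm of a trace-class operator. -/
def TraceNormLE {H : Type*} [NormedAddCommGroup H] [InnerProductSpace ℂ H] [CompleteSpace H]
    (Ω : TraceClassSA H) (M : ℝ) : Prop :=
  ∀ A : H →L[ℂ] H, ‖trace ((Ω : H →L[ℂ] H) * A)‖ ≤ M * ‖A‖

omit [Group G] [TopologicalSpace G] [IsTopologicalGroup G] [SecondCountableTopology G]
  [T2Space G] [BorelSpace G] in
theorem POVM.isProbabilityMeasure {H : Type*} [NormedAddCommGroup H] [InnerProductSpace ℂ H]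
    [CompleteSpace H] (E : POVM G H) {ξ : H} (hξ : ‖ξ‖ = 1) :
    IsProbabilityMeasure (E.measure ξ) :=
  ⟨by
    rw [E.measure_apply ξ MeasurableSet.univ, E.univ, one_apply_eq_self, inner_self_eq_ofReal, hξ]
    simp⟩

/-- How far `g⁻¹ψ` is from `ψ`, as a bounded continuous function of `g`. -/
def UnitaryRep.displacement (U : UnitaryRep G K) (ψ : K) : BoundedContinuousFunction G ℝ :=
  BoundedContinuousFunction.ofNormedAddCommGroup (fun g => 2 * ‖ψ‖ * ‖U.act g⁻¹ ψ - ψ‖)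
    (continuous_const.mul ((U.continuous_act_inv ψ).sub continuous_const).norm) (4 * ‖ψ‖ ^ 2)
    (fun g => by
      rw [Real.norm_of_nonneg (by positivity)]
      have := norm_sub_le (U.act g⁻¹ ψ) ψ
      rw [U.norm_act] at this
      nlinarith [norm_nonneg ψ])

-- The estimate separates `g` from `A`: a bounded continuous function of `g` alone times `‖A‖`. This
-- makes the later convergence uniform on the unit ball of operators.
omit [SecondCountableTopology G] [T2Space G] [MeasurableSpace G] [BorelSpace G] in
theorem UnitaryRep.norm_inner_sub_inner_conj_le (U : UnitaryRep G K) (ψ : K) (A : K →L[ℂ] K)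
    (g : G) : ‖⟪ψ, A ψ⟫_ℂ - ⟪ψ, U.conj g A ψ⟫_ℂ‖ ≤ U.displacement ψ g * ‖A‖ := by
  set φ := U.act g⁻¹ ψ with hφ
  have hn : ‖φ‖ = ‖ψ‖ := U.norm_act _ _
  have hd : U.displacement ψ g = 2 * ‖ψ‖ * ‖φ - ψ‖ := rfl
  have e : ⟪ψ, A ψ⟫_ℂ - ⟪ψ, U.conj g A ψ⟫_ℂ = - ⟪φ - ψ, A ψ⟫_ℂ - ⟪φ, A (φ - ψ)⟫_ℂ := by
    rw [U.inner_conj, map_sub, inner_sub_left, inner_sub_right]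
    ring
  rw [e, hd]
  refine (norm_sub_le _ _).trans ?_
  rw [norm_neg]
  have h1 := norm_inner_apply_le (le_refl ‖A‖) (φ - ψ) ψ
  have h2 := norm_inner_apply_le (le_refl ‖A‖) φ (φ - ψ)
  rw [hn] at h2
  nlinarith

theorem IsDensity.trace_mul_nonneg [SeparableSpace T] {Ω : T →L[ℂ] T}
    (hΩ : IsDensity Ω) {B : T →L[ℂ] T} (hB : B.IsPositive) : 0 ≤ trace (Ω * B) := by
  have hS := Complex.hasSum_re
    (hΩ.traceClass.summable_diag (traceBasis T).orthonormal).hasSum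
  obtain ⟨a, ha, -, hz⟩ := exists_nuclear_of_isPositive hΩ.positive
    (fun s => sum_le_hasSum s (fun i _ => hΩ.positive.re_inner_nonneg_right _) hS)
  rw [trace_mul_eq_tsum (by simpa only [sq] using ha) hz]
  exact tsum_nonneg fun n => hB.inner_nonneg_right _

namespace InternalFrame
variable (F : InternalFrame G R K T)

/-- Restricting `¥(A)` by the pure state of `ξ` averages `g.A` over the frame distribution of `ξ`.
-/
theorem norm_inner_sub_restrict_yen_le {ξ : R} (hξ : ‖ξ‖ = 1) (A : K →L[ℂ] K) (ψ : K) :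
    ‖⟪ψ, (A - F.restrict ξ (F.yen A)) ψ⟫_ℂ‖
      ≤ (∫ g, F.restRep.displacement ψ g ∂(F.frame.povm.measure ξ)) * ‖A‖ := by
  have := F.frame.povm.isProbabilityMeasure hξ
  have e : ⟪ψ, (A - F.restrict ξ (F.yen A)) ψ⟫_ℂ
      = ∫ g, (⟪ψ, A ψ⟫_ℂ - ⟪ψ, F.restRep.conj g A ψ⟫_ℂ) ∂(F.frame.povm.measure ξ) := by
    rw [integral_sub (integrable_const _) (F.restRep.integrable_inner_conj A ψ _)]
    simp [inner_restrict, inner_yen]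
  rw [e, ← integral_mul_const]
  exact norm_integral_le_of_norm_le
    (((F.restRep.displacement ψ).integrable _).mul_const _)
    (Eventually.of_forall fun g => F.restRep.norm_inner_sub_inner_conj_le ψ A g)

-- Each displacement vanishes at the identity, so localization sends its integral to zero. The bound
-- `4 ‖a i‖²` permits exchanging this limit with the series.
omit [SecondCountableTopology G] [T2Space G] [BorelSpace G] [CompleteSpace T] in
theorem tendsto_tsum_displacement {ξ : ℕ → R} (hξ : F.frame.IsLocalizingSequence ξ) {a : ℕ → K}
    (ha : Summable fun n => ‖a n‖ ^ 2) :
    (∀ n, Summable fun i =>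
      ∫ g, F.restRep.displacement (a i) g ∂(F.frame.povm.measure (ξ n))) ∧
    Tendsto (fun n => ∑' i, ∫ g, F.restRep.displacement (a i) g ∂(F.frame.povm.measure (ξ n)))
      atTop (𝓝 0) := by
  have hb : ∀ n i, ‖∫ g, F.restRep.displacement (a i) g ∂(F.frame.povm.measure (ξ n))‖
      ≤ 4 * ‖a i‖ ^ 2 := fun n i => by
    have := F.frame.povm.isProbabilityMeasure (hξ.1 n)
    refine (norm_integral_le_of_norm_le_const (C := 4 * ‖a i‖ ^ 2)
      (Eventually.of_forall fun g => ?_)).trans_eq (by simp)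
    exact (BoundedContinuousFunction.norm_coe_le_norm _ g).trans
      (BoundedContinuousFunction.norm_ofNormedAddCommGroup_le _ (by positivity) _)
  refine ⟨fun n => Summable.of_norm_bounded (ha.mul_left 4) (hb n), ?_⟩
  have h := tendsto_tsum_of_dominated_convergence (𝓕 := atTop) (ha.mul_left 4)
    (fun i => hξ.2 (F.restRep.displacement (a i))) (Eventually.of_forall hb)
  have h0 : ∀ i, F.restRep.displacement (a i) 1 = 0 := fun i => by
    simp [UnitaryRep.displacement, UnitaryRep.act_one]
  simpa [h0] using h

theorem norm_tsum_inner_sub_le {ξ : R} (hξ : ‖ξ‖ = 1) (A : K →L[ℂ] K) {a : ℕ → K}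
    (hs : Summable fun i => ∫ g, F.restRep.displacement (a i) g ∂(F.frame.povm.measure ξ)) :
    ‖∑' i, ⟪a i, (A - F.restrict ξ (F.yen A)) (a i)⟫_ℂ‖
      ≤ (∑' i, ∫ g, F.restRep.displacement (a i) g ∂(F.frame.povm.measure ξ)) * ‖A‖ := by
  rw [← tsum_mul_right]
  exact tsum_of_norm_bounded (hs.mul_right ‖A‖).hasSum
    fun i => F.norm_inner_sub_restrict_yen_le hξ A (a i)

/-- `Γ_ω ∘ ¥` tends to the identity along localizing sequences, in trace norm on the predual. -/
theorem eventually_norm_trace_sub_le [SeparableSpace K] {ξ : ℕ → R}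
    (hξ : F.frame.IsLocalizingSequence ξ) (ρ : TraceClassSA K) {ε : ℝ} (hε : 0 < ε) :
    ∀ᶠ n in atTop, ∀ A : K →L[ℂ] K,
      ‖trace ((ρ : K →L[ℂ] K) * (A - F.restrict (ξ n) (F.yen A)))‖ ≤ ε * ‖A‖ := by
  obtain ⟨M, hM0, hM⟩ := ρ.2.1.exists_bound
  obtain ⟨a, b, ha, hb, -, -, htr⟩ := TraceClassSA.exists_diagonal_form ρ hM0 hM
  obtain ⟨ha1, ha2⟩ := F.tendsto_tsum_displacement hξ ha
  obtain ⟨hb1, hb2⟩ := F.tendsto_tsum_displacement hξ hb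
  have h := ha2.add hb2
  rw [add_zero] at h
  filter_upwards [h.eventually_lt_const hε] with n hn A
  rw [htr]
  refine (norm_sub_le _ _).trans ?_
  have h1 := F.norm_tsum_inner_sub_le (hξ.1 n) A (ha1 n)
  have h2 := F.norm_tsum_inner_sub_le (hξ.1 n) A (hb1 n)
  nlinarith [norm_nonneg A]

omit [IsTopologicalGroup G] [SecondCountableTopology G] [T2Space G] [BorelSpace G] in
theorem norm_restrict_le {ξ : R} (hξ : ‖ξ‖ = 1) (B : T →L[ℂ] T) : ‖F.restrict ξ B‖ ≤ ‖B‖ := by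
  have hs : ‖F.split.slot ξ‖ ≤ 1 := ContinuousLinearMap.opNorm_le_bound _ zero_le_one fun k => by
    rw [F.split.norm_slot, hξ]
  calc ‖F.restrict ξ B‖ ≤ ‖ContinuousLinearMap.adjoint (F.split.slot ξ)‖
        * (‖B‖ * ‖F.split.slot ξ‖) :=
        (ContinuousLinearMap.opNorm_comp_le _ _).trans (by
          gcongr; exact ContinuousLinearMap.opNorm_comp_le _ _)
    _ ≤ 1 * (‖B‖ * 1) := by
        rw [LinearIsometryEquiv.norm_map]
        gcongr
    _ = ‖B‖ := by ring

variable [SeparableSpace K] [SeparableSpace T]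

/-- One step of successive approximation: `Ω = (Γ_ω)_* ρ` for `ω` localized well enough, with
remainder `ρ' = ρ - ¥_* Ω` of half the size. -/
theorem exists_approximate_lift {ξ : ℕ → R} (hξ : F.frame.IsLocalizingSequence ξ) {M : ℝ}
    (hM : 0 < M) (ρ : TraceClassSA K) (hρ : TraceNormLE ρ M) :
    ∃ (ρ' : TraceClassSA K) (Ω : TraceClassSA T), TraceNormLE ρ' (M / 2) ∧ TraceNormLE Ω M ∧
      ∀ A : K →L[ℂ] K, trace ((Ω : T →L[ℂ] T) * F.yen A)
        = trace ((ρ : K →L[ℂ] K) * A) - trace ((ρ' : K →L[ℂ] K) * A) := by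
  obtain ⟨n, hn⟩ := (F.eventually_norm_trace_sub_le hξ ρ (half_pos hM)).exists
  obtain ⟨Ω, hΩ⟩ := (F.isNormalMap_restrict (ξ n)).exists_predual ρ
  obtain ⟨σ, hσ⟩ := F.isNormalMap_yen.exists_predual Ω
  have hsub : ∀ A, trace (((ρ - σ : TraceClassSA K) : K →L[ℂ] K) * A)
      = trace ((ρ : K →L[ℂ] K) * A) - trace ((σ : K →L[ℂ] K) * A) :=
    trace_sub_mul ρ.2.1 σ.2.1
  refine ⟨ρ - σ, Ω, fun A => ?_, fun B => ?_, fun A => ?_⟩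
  · rw [hsub, hσ, hΩ]
    have h := hn A
    rwa [mul_sub, sub_eq_add_neg, trace_add (ρ.2.1.mul_right _)
      (by simpa using ρ.2.1.mul_right (-F.restrict (ξ n) (F.yen A))), trace_neg,
      ← sub_eq_add_neg] at h
  · rw [hΩ]
    exact (hρ _).trans (by gcongr; exact F.norm_restrict_le (hξ.1 n) B)
  · rw [hsub, hσ]
    ring

/-- The predual of the relativization map of a localizable frame is an open surjection. -/
theorem exists_yen_predual_preimage {ξ : ℕ → R} (hξ : F.frame.IsLocalizingSequence ξ) {M : ℝ}
    (hM : 0 < M) (ρ : TraceClassSA K) (hρ : TraceNormLE ρ M) :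
    ∃ Ω : TraceClassSA T, TraceNormLE Ω (2 * M) ∧
      ∀ A : K →L[ℂ] K, trace ((Ω : T →L[ℂ] T) * F.yen A) = trace ((ρ : K →L[ℂ] K) * A) := by
  choose! next Ω hnext hΩ hstep using fun (M : ℝ) (hM : 0 < M) (ρ : TraceClassSA K)
    (hρ : TraceNormLE ρ M) => F.exists_approximate_lift hξ hM ρ hρ
  let M' : ℕ → ℝ := fun k => M * (1 / 2) ^ k
  -- The successive remainders; the `k`-th has trace norm at most `M / 2 ^ k`, so the lifts sum to
  -- norm at most `2 M`.
  let σ : ℕ → TraceClassSA K := fun k => Nat.rec ρ (fun k σ => next (M' k) σ) k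
  have hσ0 : σ 0 = ρ := rfl
  have hM' : ∀ k, 0 < M' k := fun k => by positivity
  have hσ : ∀ k, TraceNormLE (σ k) (M' k) := by
    intro k
    induction k with
    | zero => simpa [M', hσ0] using hρ
    | succ k ih =>
      have := hnext (M' k) (hM' k) (σ k) ih
      have e : M' k / 2 = M' (k + 1) := by simp only [M', pow_succ]; ring
      rwa [e] at this
  have hsum : HasSum M' (2 * M) := by
    have := hasSum_geometric_two.mul_left M
    rwa [mul_comm M 2] at this
  obtain ⟨Ω', hΩ'⟩ := exists_hasSum_trace (fun k => Ω (M' k) (σ k)) (fun k => (hM' k).le)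
    (fun k => hΩ (M' k) (hM' k) (σ k) (hσ k)) hsum.summable
  refine ⟨Ω', fun B => ?_, fun A => ?_⟩
  · rw [← (hΩ' B).tsum_eq]
    exact tsum_of_norm_bounded (hsum.mul_right ‖B‖)
      fun k => hΩ (M' k) (hM' k) (σ k) (hσ k) B
  · have h1 := (hΩ' (F.yen A)).tendsto_sum_nat
    -- Telescoping of `¥_* Ω_k = σ_k - σ_{k+1}`.
    have h2 : ∀ n : ℕ, ∑ k ∈ Finset.range n, trace ((Ω (M' k) (σ k) : T →L[ℂ] T) * F.yen A)
        = trace ((ρ : K →L[ℂ] K) * A) - trace ((σ n).1 * A) := by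
      intro n
      rw [Finset.sum_congr rfl fun k _ => hstep (M' k) (hM' k) (σ k) (hσ k) A]
      exact Finset.sum_range_sub' (fun k => trace ((σ k).1 * A)) n
    have h3 : Tendsto (fun n => trace ((σ n).1 * A)) atTop (𝓝 0) := by
      refine squeeze_zero_norm (fun n => hσ n A) ?_
      simpa using hsum.summable.tendsto_atTop_zero.mul_const ‖A‖
    simp only [h2] at h1
    refine tendsto_nhds_unique h1 ?_
    simpa using tendsto_const_nhds.sub h3

-- Normality of `¥ ∘ Γ_ω` guarantees its predual, so `lift` is not the default value zero.
omit [SeparableSpace K] in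
theorem trace_lift_mul (ξ : R) (Ω : TraceClassSA T) (B : T →L[ℂ] T) :
    trace ((F.lift ξ Ω : T →L[ℂ] T) * B)
      = trace ((Ω : T →L[ℂ] T) * F.yen (F.restrict ξ B)) := by
  have h := (F.isNormalMap_yen.comp (F.isNormalMap_restrict ξ)).exists_predual Ω
  rw [lift, predual, dif_pos h]
  exact h.choose_spec B

/-- Lifting along a localizing sequence does not change, in the limit, the expectation values of
operators in the ultraweak closure of the range of the relativization map. -/
theorem tendsto_trace_lift {ξ : ℕ → R} (hξ : F.frame.IsLocalizingSequence ξ) (Ω : TraceClassSA T)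
    {B : T →L[ℂ] T} (hB : ∀ Δ : TraceClassSA T,
      (∀ A, trace ((Δ : T →L[ℂ] T) * F.yen A) = 0) → trace ((Δ : T →L[ℂ] T) * B) = 0) :
    Tendsto (fun n => trace ((F.lift (ξ n) Ω : T →L[ℂ] T) * B)) atTop
      (𝓝 (trace ((Ω : T →L[ℂ] T) * B))) := by
  obtain ⟨ρ, hρ⟩ := F.isNormalMap_yen.exists_predual Ω
  rw [Metric.tendsto_atTop']
  intro ε hε
  -- Chosen so that `2 δ ‖B‖ ≤ ε / 2`, the factor two being the loss in
  -- `exists_yen_predual_preimage`; adding one avoids division by zero.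
  set δ : ℝ := ε / (4 * (‖B‖ + 1)) with hδ
  have hδ0 : 0 < δ := by positivity
  obtain ⟨N, hN⟩ := eventually_atTop.1 (F.eventually_norm_trace_sub_le hξ ρ hδ0)
  refine ⟨N, fun n hn => ?_⟩
  set Λ := F.lift (ξ n) Ω
  obtain ⟨σ, hσ⟩ := F.isNormalMap_yen.exists_predual (Ω - Λ)
  have hsub : ∀ B, trace (((Ω - Λ : TraceClassSA T) : T →L[ℂ] T) * B)
      = trace ((Ω : T →L[ℂ] T) * B) - trace ((Λ : T →L[ℂ] T) * B) :=
    trace_sub_mul Ω.2.1 Λ.2.1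
  have hσb : TraceNormLE σ δ := fun A => by
    have h := hN n hn.le A
    rwa [mul_sub, sub_eq_add_neg, trace_add (ρ.2.1.mul_right _)
      (by simpa using ρ.2.1.mul_right (-F.restrict (ξ n) (F.yen A))), trace_neg,
      ← sub_eq_add_neg, hρ, hρ, ← F.trace_lift_mul, ← hsub, ← hσ] at h
  -- The difference `Ω - Λ` need not be small in trace norm, but `¥_*(Ω - Λ)` is. Replacing `Ω - Λ`
  -- by a small `Δ` with the same image changes it by an annihilator of the range, invisible to `B`.
  obtain ⟨Δ, hΔ, hΔσ⟩ := F.exists_yen_predual_preimage hξ hδ0 σ hσb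
  have h0 := hB ((Ω - Λ) - Δ) fun A => by
    rw [Submodule.coe_sub, trace_sub_mul (Ω - Λ).2.1 Δ.2.1, hΔσ, hσ, sub_self]
  rw [Submodule.coe_sub, trace_sub_mul (Ω - Λ).2.1 Δ.2.1, hsub, sub_eq_zero] at h0
  rw [dist_comm, dist_eq_norm, h0]
  refine (hΔ B).trans_lt ?_
  have : 2 * δ * ‖B‖ ≤ ε / 2 * (‖B‖ / (‖B‖ + 1)) := le_of_eq (by
    rw [hδ]; field_simp; ring)
  have h1 : ‖B‖ / (‖B‖ + 1) ≤ 1 := (div_le_one (by positivity)).2 (by linarith)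
  nlinarith

omit [SeparableSpace K] in
theorem lift_mem_density {ξ : R} (hξ : ‖ξ‖ = 1) {Ω : TraceClassSA T} (hΩ : Ω ∈ Density T) :
    F.lift ξ Ω ∈ Density T := by
  have hp : IsDensity (Ω : T →L[ℂ] T) := hΩ
  refine ⟨(F.lift ξ Ω).2.1, isPositive_of_inner_nonneg fun v => ?_, ?_⟩
  · rw [← trace_mul_rankOne (F.lift ξ Ω).2.1, F.trace_lift_mul]
    exact hp.trace_mul_nonneg (F.isPositive_yen ((F.isNormalMap_restrict ξ).positive _
      (InnerProductSpace.isPositive_rankOne_self v)))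
  · have := F.trace_lift_mul ξ Ω 1
    rwa [F.restrict_one hξ, F.yen_one, mul_one, mul_one, hp.trace_eq_one] at this

end InternalFrame

end Localization

/-! ### Exchange of two frames, and existence of localizing sequences. -/

section Covariance
variable {G : Type*} [Group G] [TopologicalSpace G] [IsTopologicalGroup G]
  [SecondCountableTopology G] [T2Space G] [MeasurableSpace G] [BorelSpace G]
variable {R K T : Type*} [NormedAddCommGroup R] [InnerProductSpace ℂ R] [CompleteSpace R]
  [NormedAddCommGroup K] [InnerProductSpace ℂ K] [CompleteSpace K]
  [NormedAddCommGroup T] [InnerProductSpace ℂ T] [CompleteSpace T]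

-- Covariance read on distributions: translating the vector translates the measure.
omit [SecondCountableTopology G] [T2Space G] in
theorem QFrame.measure_act_inv (𝓡 : QFrame G R) (g : G) (r : R) :
    𝓡.povm.measure (𝓡.rep.act g⁻¹ r) = (𝓡.povm.measure r).map (fun x => g⁻¹ * x) := by
  ext X hX
  have hm : Measurable fun x : G => g⁻¹ * x := measurable_const_mul _
  rw [Measure.map_apply hm hX, POVM.measure_apply _ _ hX, POVM.measure_apply _ _ (hm hX),
    ← UnitaryRep.inner_conj, ← 𝓡.covariant g X hX, Set.image_mul_left]

namespace InternalFrame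

/-- Relativized operators are invariant. -/
theorem conj_yen (F : InternalFrame G R K T) (W : UnitaryRep G T)
    (hW : ∀ g r k, W.act g (F.split.slot r k)
      = F.split.slot (F.frame.rep.act g r) (F.restRep.act g k))
    (g : G) (A : K →L[ℂ] K) : W.conj g (F.yen A) = F.yen A := by
  refine F.split.determining_slot.eq fun p => ?_
  rw [W.inner_conj, hW, F.inner_yen, F.inner_yen, QFrame.measure_act_inv,
    integral_map (measurable_const_mul _).aemeasurable
      (F.restRep.continuous_inner_conj A _).measurable.aestronglyMeasurable]
  refine integral_congr_ae (Eventually.of_forall fun h => ?_)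
  simp only [UnitaryRep.inner_conj, mul_inv_rev, inv_inv, UnitaryRep.act_mul,
    UnitaryRep.act_act_inv]

variable {R' K' S : Type*} [NormedAddCommGroup R'] [InnerProductSpace ℂ R'] [CompleteSpace R']
  [NormedAddCommGroup K'] [InnerProductSpace ℂ K'] [CompleteSpace K']
  [NormedAddCommGroup S] [InnerProductSpace ℂ S] [CompleteSpace S]

/-- An operator framed by a frame `F` and relativized by a second frame `F'` is an ultraweak limit
of operators framed by `F'` and relativized by `F`. -/
theorem yen_op_mem_uwSpan (F : InternalFrame G R K T) (F' : InternalFrame G R' K' T)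
    (e : TensorSplit R' S K) (e' : TensorSplit R S K') (V : UnitaryRep G S)
    (hD : ∀ r r' s, F.split.slot r (e.slot r' s) = F'.split.slot r' (e'.slot r s))
    (hK : ∀ g r' s, F.restRep.act g (e.slot r' s) = e.slot (F'.frame.rep.act g r') (V.act g s))
    (hK' : ∀ g r s, F'.restRep.act g (e'.slot r s) = e'.slot (F.frame.rep.act g r) (V.act g s))
    {C : S →L[ℂ] S} (hC : IsEffect C) {X : Set G} (hX : MeasurableSet X)
    {𝒜 : Set (K →L[ℂ] K)} (h𝒜 : ∀ (g : G) (Y : Set G), MeasurableSet Y →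
      e.op (F'.frame.povm.toFun Y) (V.conj g C) ∈ 𝒜) :
    F'.yen (e'.op (F.frame.povm.toFun X) C) ∈ uwSpan (F.yen '' 𝒜) := by
  obtain ⟨σ, hσ⟩ := exists_simpleFunc_tendsto_id G
  have hZ : MeasurableSet (Inv.inv ⁻¹' X : Set G) := measurable_inv hX
  -- Riemann sums for `∫_{X⁻¹} dE'(g) ⊗ g.C`; their relativizations by `F` are the approximants.
  set A : ℕ → K →L[ℂ] K := fun n =>
    simpleIntegral e F'.frame.povm V (σ n) (Inv.inv ⁻¹' X) C with hA
  have hAe : ∀ n, IsEffect (A n) := fun n =>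
    isEffect_simpleIntegral e F'.frame.povm V (σ n) hZ hC
  have hYn : ∀ n, ‖F.yen (A n)‖ ≤ 1 := fun n => (F.isEffect_yen (hAe n)).norm_le_one
  refine WeakTendsto.mem_uwSpan (l := atTop) hYn
    ((F.split.determining_slot_slot e).weakTendsto hYn fun p => ?_) fun n => ?_
  swap
  · rw [hA]
    simp only [simpleIntegral]
    rw [yen_sum]
    exact Submodule.sum_mem _ fun x _ => Submodule.subset_span (Set.mem_image_of_mem _
      (h𝒜 x _ (((σ n).measurableSet_fiber x).inter hZ)))
  obtain ⟨r, r', s⟩ := p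
  dsimp only
  set c : G → ℂ := fun g => ⟪s, V.conj g C s⟫_ℂ with hc
  have hcm : Measurable c := (V.continuous_inner_conj C s).measurable
  have hlim : Tendsto (fun n => ⟪F.split.slot r (e.slot r' s),
      F.yen (A n) (F.split.slot r (e.slot r' s))⟫_ℂ) atTop
      (𝓝 (∫ h, ∫ g in Inv.inv ⁻¹' X, ⟪V.act h⁻¹ s, V.conj g C (V.act h⁻¹ s)⟫_ℂ
        ∂(F'.frame.povm.measure (F'.frame.rep.act h⁻¹ r')) ∂(F.frame.povm.measure r))) := by
    simp only [inner_yen]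
    refine tendsto_integral_of_dominated_convergence
      (fun _ => 1 * ‖e.slot r' s‖ * ‖e.slot r' s‖)
      (fun n => (F.restRep.continuous_inner_conj _ _).measurable.aestronglyMeasurable)
      (integrable_const _) (fun n => Eventually.of_forall fun g =>
        F.restRep.norm_inner_conj_le g (hAe n).norm_le_one _) (Eventually.of_forall fun h => ?_)
    simp only [UnitaryRep.inner_conj F.restRep, hK, hA, inner_simpleIntegral e _ _ _ hZ]
    exact tendsto_integral_inner_conj V hσ _ C _
  convert hlim using 2
  rw [hD, inner_yen]
  -- The common integrand on `G × G`, with `h` the value of the frame `F` and `g` that of `F'`. Both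
  -- sides are iterated integrals of it, in opposite orders.
  set Φ : G → G → ℂ := fun h g => Set.indicator {p : G × G | p.2⁻¹ * p.1 ∈ X}
    (fun p => c p.2) (h, g) with hΦ
  have hSm : MeasurableSet {p : G × G | p.2⁻¹ * p.1 ∈ X} :=
    (measurable_snd.inv.mul measurable_fst) hX
  have hΦin : ∀ h g, g⁻¹ * h ∈ X → Φ h g = c g := fun h g hg => Set.indicator_of_mem
    (s := {p : G × G | p.2⁻¹ * p.1 ∈ X}) (a := (h, g)) hg _
  have hΦout : ∀ h g, g⁻¹ * h ∉ X → Φ h g = 0 := fun h g hg => Set.indicator_of_notMem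
    (s := {p : G × G | p.2⁻¹ * p.1 ∈ X}) (a := (h, g)) hg _
  have hΦint : Integrable (Function.uncurry Φ)
      ((F.frame.povm.measure r).prod (F'.frame.povm.measure r')) := by
    refine Integrable.of_bound (C := ‖C‖ * ‖s‖ * ‖s‖)
      ((hcm.comp measurable_snd).indicator hSm).aestronglyMeasurable
      (Eventually.of_forall fun p => ?_)
    exact (norm_indicator_le_norm_self (fun p : G × G => c p.2) p).trans
      (V.norm_inner_conj_le p.2 le_rfl s)
  -- By covariance of `F'`, the variable becomes `h⁻¹ g`, which turns the domain `X⁻¹` into the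
  -- condition `g⁻¹ h ∈ X` and cancels the action of `h` on `s`.
  have hright : ∀ h, ∫ g in Inv.inv ⁻¹' X, ⟪V.act h⁻¹ s, V.conj g C (V.act h⁻¹ s)⟫_ℂ
        ∂(F'.frame.povm.measure (F'.frame.rep.act h⁻¹ r'))
      = ∫ g, Φ h g ∂(F'.frame.povm.measure r') := by
    intro h
    have hm : Measurable fun x : G => h⁻¹ * x := measurable_const_mul _
    rw [QFrame.measure_act_inv, setIntegral_map hZ
      (V.continuous_inner_conj C _).measurable.aestronglyMeasurable hm.aemeasurable,
      ← integral_indicator (hm hZ)]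
    refine integral_congr_ae (Eventually.of_forall fun g => ?_)
    have hiff : g ∈ (fun x => h⁻¹ * x) ⁻¹' (Inv.inv ⁻¹' X) ↔ g⁻¹ * h ∈ X := by
      change (h⁻¹ * g)⁻¹ ∈ X ↔ _
      rw [mul_inv_rev, inv_inv]
    by_cases hg : g⁻¹ * h ∈ X
    · rw [Set.indicator_of_mem (hiff.2 hg), hΦin h g hg]
      simp only [hc, UnitaryRep.inner_conj, mul_inv_rev, inv_inv, UnitaryRep.act_mul,
        UnitaryRep.act_act_inv]
    · rw [Set.indicator_of_notMem (fun h' => hg (hiff.1 h')), hΦout h g hg]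
  -- By covariance of `F`, conjugation by `g` replaces `E(X)` by `E(gX)`, and `h ∈ gX` is the same
  -- condition.
  have hleft : ∀ g, ⟪e'.slot r s, F'.restRep.conj g (e'.op (F.frame.povm.toFun X) C)
      (e'.slot r s)⟫_ℂ = ∫ h, Φ h g ∂(F.frame.povm.measure r) := by
    intro g
    have hm : Measurable fun x : G => g⁻¹ * x := measurable_const_mul _
    rw [UnitaryRep.inner_conj, hK', e'.inner_op_slot, ← POVM.measure_real _ _ hX,
      QFrame.measure_act_inv, map_measureReal_apply hm hX]
    have : (fun h => Φ h g) = ((fun x : G => g⁻¹ * x) ⁻¹' X).indicator fun _ => c g := by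
      ext h
      by_cases hg : g⁻¹ * h ∈ X
      · rw [hΦin h g hg, Set.indicator_of_mem (s := (fun x : G => g⁻¹ * x) ⁻¹' X) hg]
      · rw [hΦout h g hg, Set.indicator_of_notMem (s := (fun x : G => g⁻¹ * x) ⁻¹' X) hg]
    rw [this, integral_indicator_const _ (hm hX), Complex.real_smul, hc]
    dsimp only
    rw [UnitaryRep.inner_conj]
  simp only [hright, hleft]
  exact (integral_integral_swap hΦint).symm

end InternalFrame

-- If `E(X)` vanished, so would `E(gX)` for every `g` by covariance; countably many of these
-- translates cover `G`, contradicting `E(G) = 1 ≠ 0`.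
omit [T2Space G] in
theorem QFrame.toFun_nhds_one_ne_zero [Nontrivial R] (𝓡 : QFrame G R) {X : Set G}
    (hX : MeasurableSet X) (h1 : X ∈ 𝓝 1) : 𝓡.povm.toFun X ≠ 0 := by
  intro h0
  obtain ⟨ψ, hψ⟩ := exists_ne (0 : R)
  have hcover : ∀ g : G, (fun x => g⁻¹ * x) ⁻¹' X ∈ 𝓝 g := fun g =>
    (continuous_const_mul g⁻¹).continuousAt.preimage_mem_nhds (by simpa using h1)
  obtain ⟨t, ht, htu⟩ := TopologicalSpace.countable_cover_nhds hcover
  have hnull : ∀ g, 𝓡.povm.measure ψ ((fun x => g⁻¹ * x) ⁻¹' X) = 0 := fun g => by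
    rw [← Measure.map_apply (measurable_const_mul _) hX, ← 𝓡.measure_act_inv,
      POVM.measure_apply _ _ hX, h0]
    simp
  have huniv : 𝓡.povm.measure ψ Set.univ = 0 := by
    rw [← htu]
    exact (measure_biUnion_null_iff ht).2 fun g _ => hnull g
  have := 𝓡.povm.measure_real_univ ψ
  rw [Measure.real, huniv] at this
  simp [eq_comm, hψ] at this

-- Localize in a decreasing countable neighbourhood base at the identity, with failure probability
-- below `1 / (n + 1)`.
omit [T2Space G] in
theorem QFrame.Localizable.exists_isLocalizingSequence [Nontrivial R] {𝓡 : QFrame G R}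
    (h𝓡 : 𝓡.Localizable) : ∃ ξ, 𝓡.IsLocalizingSequence ξ := by
  obtain ⟨V, hV, hVb⟩ := (nhds_basis_opens (1 : G)).exists_antitone_subbasis
  have hε : ∀ n : ℕ, (0 : ℝ) < 1 / (n + 1) := fun n => by positivity
  have hmem : ∀ n, V n ∈ 𝓝 (1 : G) := fun n => (hV n).2.mem_nhds (hV n).1
  choose ξ hξ hξV using fun n => h𝓡 (V n) (hV n).2.measurableSet
    (𝓡.toFun_nhds_one_ne_zero (hV n).2.measurableSet (hmem n)) _ (hε n)
  refine ⟨ξ, hξ, fun f => ?_⟩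
  have hprob : ∀ n, IsProbabilityMeasure (𝓡.povm.measure (ξ n)) := fun n =>
    𝓡.povm.isProbabilityMeasure (hξ n)
  rw [Metric.tendsto_atTop]
  intro ε hε0
  have hf : ∀ᶠ g in 𝓝 (1 : G), ‖f g - f 1‖ < ε / 2 :=
    Metric.tendsto_nhds.1 (f.continuous.tendsto 1) _ (half_pos hε0)
  obtain ⟨N, hN⟩ := hVb.mem_iff.1 hf
  have hsmall : Tendsto (fun n : ℕ => 2 * ‖f‖ * (1 / ((n : ℝ) + 1))) atTop (𝓝 0) := by
    simpa using tendsto_one_div_add_atTop_nhds_zero_nat.const_mul (2 * ‖f‖)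
  obtain ⟨N', hN'⟩ := eventually_atTop.1 (hsmall.eventually_lt_const (half_pos hε0))
  refine ⟨max N N', fun n hn => ?_⟩
  have := hprob n
  set μ := 𝓡.povm.measure (ξ n)
  have hVm := (hV n).2.measurableSet
  have hc : μ.real (V n)ᶜ ≤ 1 / ((n : ℝ) + 1) := by
    have h1 := congrArg Complex.re (𝓡.povm.measure_real (ξ n) hVm)
    rw [Complex.ofReal_re] at h1
    have h2 := measureReal_add_measureReal_compl (μ := μ) hVm
    rw [probReal_univ] at h2
    have h3 := hξV n
    rw [← h1] at h3
    linarith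
  -- Continuity of `f` controls the neighbourhood, and the small mass outside it controls the rest.
  have hb : ∀ g, ‖f g - f 1‖ ≤ ε / 2 + (V n)ᶜ.indicator (fun _ => 2 * ‖f‖) g := fun g => by
    by_cases hg : g ∈ V n
    · have h1 : g ∈ V N := hVb.antitone ((le_max_left _ _).trans hn) hg
      have h2 : ‖f g - f 1‖ < ε / 2 := hN h1
      rw [Set.indicator_of_notMem (by simpa using hg)]
      linarith
    · rw [Set.indicator_of_mem (by simpa using hg)]
      have := (norm_sub_le (f g) (f 1)).trans
        (add_le_add (f.norm_coe_le_norm g) (f.norm_coe_le_norm 1))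
      linarith
  have hi : Integrable (fun g => ε / 2 + (V n)ᶜ.indicator (fun _ => 2 * ‖f‖) g) μ :=
    (integrable_const _).add ((integrable_const _).indicator hVm.compl)
  have h1 : ∫ g, f g ∂μ - f 1 = ∫ g, (f g - f 1) ∂μ := by
    rw [integral_sub (f.integrable μ) (integrable_const _)]
    simp
  rw [dist_eq_norm, h1]
  refine (norm_integral_le_of_norm_le hi (Eventually.of_forall hb)).trans_lt ?_
  rw [integral_add (integrable_const _) ((integrable_const _).indicator hVm.compl),
    integral_indicator_const _ hVm.compl, integral_const, probReal_univ, one_smul, smul_eq_mul]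
  have h3 := hN' n ((le_max_right _ _).trans hn)
  nlinarith [norm_nonneg f]

end Covariance

/-! ### Operational quotients as state spaces. -/

section StateSpaces
variable {T : Type*} [NormedAddCommGroup T] [InnerProductSpace ℂ T] [CompleteSpace T]

theorem opQuotient_ext {O : Set (T →L[ℂ] T)} {x y : OpQuotient O}
    (h : ∀ B : uwSpan O, (B : T →L[ℂ] T) ∈ O → expect O B x = expect O B y) : x = y := by
  obtain ⟨a, rfl⟩ := (opKernel O).mkQ_surjective x
  obtain ⟨b, rfl⟩ := (opKernel O).mkQ_surjective y
  refine (Submodule.Quotient.eq _).2 fun F hF => ?_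
  rw [Submodule.coe_sub, trace_sub_mul a.2.1 b.2.1, sub_eq_zero]
  exact h ⟨F, subset_uwSpan O hF⟩ hF

theorem opKernel_le_of_subset_uwSpan {O O' : Set (T →L[ℂ] T)} (h : O' ⊆ uwSpan O) :
    opKernel O ≤ opKernel O' := fun _ hΩ _ hF => trace_eq_zero_of_mem_uwSpan hΩ (h hF)

/-- The canonical projection `[Ω]_O ↦ [Ω]_O'`. -/
def opProj {O O' : Set (T →L[ℂ] T)} (h : opKernel O ≤ opKernel O') (x : OpStates O) :
    OpStates O' :=
  ⟨Submodule.factor h x, by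
    obtain ⟨Ω, hΩ, hx⟩ := x.2
    exact ⟨Ω, hΩ, by rw [← hx]; rfl⟩⟩

theorem isProjection_opProj {O O' : Set (T →L[ℂ] T)} (h : opKernel O ≤ opKernel O') :
    IsProjection (opProj h) := fun _ => rfl

theorem exists_opState_eq {O : Set (T →L[ℂ] T)} (x : OpStates O) : ∃ Ω, opState O Ω = x := by
  obtain ⟨_, Ω, hΩ, rfl⟩ := x
  exact ⟨⟨Ω, hΩ⟩, rfl⟩

theorem convex_density : Convex ℝ (Density T) := by
  intro Ω hΩ Ω' hΩ' a b ha hb hab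
  have h : IsDensity (Ω : T →L[ℂ] T) := hΩ
  have h' : IsDensity (Ω' : T →L[ℂ] T) := hΩ'
  have e : ((a • Ω + b • Ω' : TraceClassSA T) : T →L[ℂ] T)
      = (a : ℂ) • (Ω : T →L[ℂ] T) + (b : ℂ) • (Ω' : T →L[ℂ] T) := by
    ext v
    simp
  refine ⟨(a • Ω + b • Ω').2.1, ?_, ?_⟩
  · rw [e]
    exact (h.positive.smul_of_nonneg (Complex.zero_le_real.2 ha)).add
      (h'.positive.smul_of_nonneg (Complex.zero_le_real.2 hb))
  · have h1 := trace_add (h.traceClass.smul a) (h'.traceClass.smul b)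
    rw [← Complex.coe_smul, ← Complex.coe_smul b] at h1
    rw [e, h1, trace_smul, trace_smul, h.trace_eq_one, h'.trace_eq_one]
    exact_mod_cast by simpa using hab

variable [SeparableSpace T]

theorem isStateSpace_opStates {O : Set (T →L[ℂ] T)} (hO : ∀ F ∈ O, IsEffect F) :
    IsStateSpace (OpStates O) where
  convex := convex_density.linear_image (opKernel O).mkQ
  total x y h := by
    refine Subtype.ext (opQuotient_ext fun B hB => ?_)
    have hpos : ∀ z : OpStates O, 0 ≤ expect O B z := fun z => by
      obtain ⟨Ω, rfl⟩ := exists_opState_eq z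
      exact IsDensity.trace_mul_nonneg (Ω := (Ω : T →L[ℂ] T)) Ω.2 (hO B hB).1
    have hle : ∀ z : OpStates O, expect O B z ≤ 1 := fun z => by
      obtain ⟨Ω, rfl⟩ := exists_opState_eq z
      have hΩ : IsDensity (Ω : T →L[ℂ] T) := Ω.2
      have h1 := hΩ.trace_mul_nonneg (hO B hB).2
      have h2 := trace_add (hΩ.traceClass.mul_right (1 - (B : T →L[ℂ] T)))
        (hΩ.traceClass.mul_right (B : T →L[ℂ] T))
      rw [← mul_add, sub_add_cancel, mul_one, hΩ.trace_eq_one] at h2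
      change trace ((Ω : T →L[ℂ] T) * (B : T →L[ℂ] T)) ≤ 1
      rw [h2]
      exact le_add_of_nonneg_left h1
    -- The effects in `O` are themselves separating functionals: on states their expectation values
    -- are real and lie in `[0, 1]`, so real parts suffice.
    have := h (fun z => (expect O B z).re) (fun n c v w _ _ hw => by
      simp [hw]) fun z =>
        ⟨(Complex.nonneg_iff.1 (hpos z)).1, (Complex.le_def.1 (hle z)).1⟩
    refine Complex.ext this ?_
    rw [← (Complex.nonneg_iff.1 (hpos x)).2, ← (Complex.nonneg_iff.1 (hpos y)).2]

theorem isStateSpaceMap_opProj {O O' : Set (T →L[ℂ] T)} (hO : ∀ F ∈ O, IsEffect F)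
    (hO' : ∀ F ∈ O', IsEffect F) (h : opKernel O ≤ opKernel O') :
    IsStateSpaceMap (opProj h) where
  source := isStateSpace_opStates hO
  target := isStateSpace_opStates hO'
  affine n c x y _ _ hy := by
    change Submodule.factor h (y : OpQuotient O) = ∑ i, c i • Submodule.factor h (x i : OpQuotient O)
    rw [hy, map_sum]
    simp

end StateSpaces

/-! ### Frame changes as canonical projections. -/

section FrameChange
variable {G : Type*} [Group G] [TopologicalSpace G] [IsTopologicalGroup G]
  [SecondCountableTopology G] [T2Space G] [MeasurableSpace G] [BorelSpace G]
variable {R K R' K' T : Type*} [NormedAddCommGroup R] [InnerProductSpace ℂ R] [CompleteSpace R]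
  [NormedAddCommGroup K] [InnerProductSpace ℂ K] [CompleteSpace K]
  [NormedAddCommGroup R'] [InnerProductSpace ℂ R'] [CompleteSpace R']
  [NormedAddCommGroup K'] [InnerProductSpace ℂ K'] [CompleteSpace K']
  [NormedAddCommGroup T] [InnerProductSpace ℂ T] [CompleteSpace T]

namespace InternalFrame

omit [IsTopologicalGroup G] [SecondCountableTopology G] [T2Space G] [BorelSpace G] in
theorem relEffects_mono (F : InternalFrame G R K T) {𝒜 𝒜' : Set (K →L[ℂ] K)} (h : 𝒜 ⊆ 𝒜') :
    F.relEffects 𝒜 ⊆ F.relEffects 𝒜' := fun _ hB =>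
  ⟨@closure_mono _ (ultraweak T) _ _ (Submodule.span_mono (Set.image_mono h)) _ hB.1, hB.2⟩

theorem opKernel_relEffects_le (F : InternalFrame G R K T) {𝒜 : Set (K →L[ℂ] K)}
    (h𝒜 : ∀ A ∈ 𝒜, IsEffect A) : opKernel (F.relEffects 𝒜) ≤ opKernel (F.yen '' 𝒜) := by
  rintro Ω hΩ _ ⟨A, hA, rfl⟩
  exact hΩ _ ⟨subset_uwSpan _ ⟨A, hA, rfl⟩, F.isEffect_yen (h𝒜 A hA)⟩

-- Localizing sequences need a nonzero frame space. A zero frame space forces `T = 0`, which carries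
-- no state of trace one, so the degenerate case is vacuous.
omit [IsTopologicalGroup G] [SecondCountableTopology G] [T2Space G] [MeasurableSpace G]
  [BorelSpace G] in
theorem nontrivial_of_density [MeasurableSpace G] (F : InternalFrame G R K T)
    (Ω : Density T) : Nontrivial R := by
  by_contra h
  rw [not_nontrivial_iff_subsingleton] at h
  have hT : ∀ t : T, t = 0 := fun t => F.split.eq_zero_of_inner_slot fun r k => by
    rw [Subsingleton.elim r 0, map_zero]
    simp
  have h1 : trace (Ω : T →L[ℂ] T) = 1 := IsDensity.trace_eq_one Ω.2
  simp [trace, hT] at h1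

variable [SeparableSpace K] [SeparableSpace T]

/-- Out of a localizable frame, the canonical projection between the states relative to two frames
is a frame-change map whenever the target operators are ultraweak limits of source operators. -/
theorem isFrameChange_opProj (F : InternalFrame G R K T) (hF : F.frame.Localizable)
    {O O' : Set (T →L[ℂ] T)} (hO : ∀ B ∈ O, IsEffect B) (hO' : ∀ B ∈ O', IsEffect B)
    (h : opKernel O ≤ opKernel O') {𝒜 : Set (K →L[ℂ] K)}
    (h𝒜 : opKernel (F.yen '' 𝒜) ≤ opKernel O') : F.IsFrameChange (opProj h) := by
  -- The hypothesis of `tendsto_trace_lift` is met: whatever annihilates the range of `¥`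
  -- annihilates `¥(𝒜)`, hence `O'` and its ultraweak span. The limit is the class of `Ω` itself, so
  -- neither representative nor sequence matters.
  have hlim : F.IsLocalizedLimit (opProj h) := fun ξ hξ Ω B =>
    F.tendsto_trace_lift hξ Ω fun Δ hΔ => trace_eq_zero_of_mem_uwSpan
      (h𝒜 (by rintro _ ⟨A, -, rfl⟩; exact hΔ A)) B.2
  refine ⟨fun ξ hξ Ω => F.lift_mem_density hξ Ω.2, hlim, fun Ψ hΨ => ?_,
    isStateSpaceMap_opProj hO hO' h⟩
  funext x
  obtain ⟨Ω, rfl⟩ := exists_opState_eq x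
  have := F.nontrivial_of_density Ω
  obtain ⟨ξ, hξ⟩ := hF.exists_isLocalizingSequence
  exact Subtype.ext (opQuotient_ext fun B _ =>
    tendsto_nhds_unique (hΨ ξ hξ Ω B) (hlim ξ hξ Ω B))

theorem exists_isFrameChange (F : InternalFrame G R K T) (F' : InternalFrame G R' K' T)
    (hF : F.frame.Localizable) {𝒜 : Set (K →L[ℂ] K)} {𝒜' : Set (K' →L[ℂ] K')}
    (h𝒜 : ∀ A ∈ 𝒜, IsEffect A) (h : F'.yen '' 𝒜' ⊆ uwSpan (F.yen '' 𝒜)) :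
    ∃ Φ : OpStates (F.relEffects 𝒜) → OpStates (F'.relEffects 𝒜'),
      F.IsFrameChange Φ ∧ IsProjection Φ := by
  -- Annihilators are compared instead of iterated closures: a trace-class operator vanishing on a
  -- set vanishes on its ultraweak span.
  have h1 : opKernel (F.yen '' 𝒜) ≤ opKernel (F'.relEffects 𝒜') :=
    (opKernel_le_of_subset_uwSpan h).trans (opKernel_le_of_subset_uwSpan fun _ hB => hB.1)
  exact ⟨opProj ((F.opKernel_relEffects_le h𝒜).trans h1),
    F.isFrameChange_opProj hF (fun _ hB => hB.2) (fun _ hB => hB.2) _ h1, isProjection_opProj _⟩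

end InternalFrame
end FrameChange

/-! ### The frames in two- and three-frame tensor products. -/

section Concrete
variable {A B R K T S : Type*} [NormedAddCommGroup A] [InnerProductSpace ℂ A] [CompleteSpace A]
  [NormedAddCommGroup B] [InnerProductSpace ℂ B] [CompleteSpace B]
  [NormedAddCommGroup R] [InnerProductSpace ℂ R] [CompleteSpace R]
  [NormedAddCommGroup K] [InnerProductSpace ℂ K] [CompleteSpace K]
  [NormedAddCommGroup T] [InnerProductSpace ℂ T] [CompleteSpace T]
  [NormedAddCommGroup S] [InnerProductSpace ℂ S] [CompleteSpace S]

namespace TensorSplit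

omit [CompleteSpace R] [CompleteSpace K] in
theorem first_slot (r : R) (k : K) : (first R K).slot r k = toH (r ⊗ₜ[ℂ] k) := rfl

omit [CompleteSpace A] [CompleteSpace R] [CompleteSpace K] [CompleteSpace T] in
theorem skip_slot (D : TensorSplit R K T) (r : R) :
    (D.skip A).slot r = hmap (ContinuousLinearMap.id ℂ A) (D.slot r) := rfl

theorem first_op (X : R →L[ℂ] R) (Y : K →L[ℂ] K) : (first R K).op X Y = hmap X Y :=
  hmap_ext fun r k => by rw [← first_slot, op_slot, first_slot, first_slot, hmap_tmul]

omit [CompleteSpace A] in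
theorem skip_op (D : TensorSplit R K T) (X : R →L[ℂ] R) (Y : A →L[ℂ] A) (Z : K →L[ℂ] K) :
    (D.skip A).op X (hmap Y Z) = hmap Y (D.op X Z) := by
  refine hmap_ext fun a t => ?_
  have : (D.skip A).op X (hmap Y Z) ∘L (first A T).slot a
      = hmap Y (D.op X Z) ∘L (first A T).slot a := by
    refine ContinuousLinearMap.ext_on D.dense_slot ?_
    rintro _ ⟨r, k, rfl⟩
    have h : (first A T).slot a (D.slot r k) = (D.skip A).slot r (toH (a ⊗ₜ[ℂ] k)) := by
      rw [skip_slot, hmap_tmul]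
      rfl
    simp only [ContinuousLinearMap.comp_apply]
    rw [h, op_slot, ← h, first_slot, hmap_tmul, hmap_tmul, skip_slot, hmap_tmul, op_slot]
    rfl
  exact congrArg (fun f => f t) this

end TensorSplit

variable {G : Type*} [Group G] [TopologicalSpace G]

theorem UnitaryRep.tensor_act (U : UnitaryRep G R) (V : UnitaryRep G K) (g : G) :
    (U.tensor V).act g = hmap (U.act g) (V.act g) := rfl

theorem UnitaryRep.tensor_act_first (U : UnitaryRep G R) (V : UnitaryRep G K) (g : G) (r : R)
    (k : K) : (U.tensor V).act g ((TensorSplit.first R K).slot r k)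
      = (TensorSplit.first R K).slot (U.act g r) (V.act g k) :=
  hmap_tmul _ _ _ _

theorem UnitaryRep.tensor_act_skip (D : TensorSplit R K T) (U : UnitaryRep G R)
    (V : UnitaryRep G K) (W : UnitaryRep G T) (UA : UnitaryRep G A) {g : G}
    (h : ∀ r k, W.act g (D.slot r k) = D.slot (U.act g r) (V.act g k)) (r : R) (k : A ⊗ₕ K) :
    (UA.tensor W).act g ((D.skip A).slot r k)
      = (D.skip A).slot (U.act g r) ((UA.tensor V).act g k) := by
  have : (UA.tensor W).act g ∘L (D.skip A).slot r
      = (D.skip A).slot (U.act g r) ∘L (UA.tensor V).act g :=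
    hmap_ext fun a k => by
      simp [tensor_act, TensorSplit.skip_slot, hmap_tmul, h]
  exact congrArg (fun f => f k) this

theorem UnitaryRep.tensor_conj (U : UnitaryRep G R) (V : UnitaryRep G K) (g : G)
    (X : R →L[ℂ] R) (Y : K →L[ℂ] K) :
    (U.tensor V).conj g (hmap X Y) = hmap (U.conj g X) (V.conj g Y) := by
  simp only [conj_eq, tensor_act, hmap_comp]

variable [MeasurableSpace G]

omit [Group G] [TopologicalSpace G] in
theorem isEffect_of_mem_framing {D : TensorSplit R S K} {E : POVM G R} {C : K →L[ℂ] K}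
    (h : C ∈ framing D E) : IsEffect C := by
  obtain ⟨X, F, hX, hF, rfl⟩ := h
  exact D.isEffect_op (E.isEffect hX) hF

omit [Group G] [TopologicalSpace G] in
theorem isEffect_of_mem_doubleFraming {E : POVM G A} {E' : POVM G B}
    {C : A ⊗ₕ (B ⊗ₕ S) →L[ℂ] A ⊗ₕ (B ⊗ₕ S)} (h : C ∈ doubleFraming E E' S) : IsEffect C := by
  obtain ⟨X, Y, F, hX, hY, hF, rfl⟩ := h
  exact isEffect_hmap (E.isEffect hX) (isEffect_hmap (E'.isEffect hY) hF)

omit [Group G] [TopologicalSpace G] in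
theorem doubleFraming_subset_framing_first (E : POVM G A) (E' : POVM G B) :
    doubleFraming E E' S ⊆ framing (TensorSplit.first A (B ⊗ₕ S)) E := by
  rintro _ ⟨X, Y, F, hX, hY, hF, rfl⟩
  exact ⟨X, _, hX, isEffect_hmap (E'.isEffect hY) hF, (TensorSplit.first_op _ _).symm⟩

omit [CompleteSpace A] in
theorem hmap_hmap_eq_skip_op (X : A →L[ℂ] A) (Y : B →L[ℂ] B) (F : S →L[ℂ] S) :
    hmap X (hmap Y F) = ((TensorSplit.first B S).skip A).op Y (hmap X F) := by
  rw [TensorSplit.skip_op, TensorSplit.first_op]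

omit [Group G] [TopologicalSpace G] in
theorem doubleFraming_subset_framing_skip (E : POVM G A) (E' : POVM G B) :
    doubleFraming E E' S ⊆ framing ((TensorSplit.first B S).skip A) E' := by
  rintro _ ⟨X, Y, F, hX, hY, hF, rfl⟩
  exact ⟨Y, _, hY, isEffect_hmap (E.isEffect hX) hF, hmap_hmap_eq_skip_op _ _ _⟩

variable [IsTopologicalGroup G] [SecondCountableTopology G] [T2Space G] [BorelSpace G]

-- Covariance keeps the framing by a third frame: `E(Y) ⊗ F` is moved to `E(gY) ⊗ g.F`. Without
-- this, exchanging two frames would leave the doubly framed operators.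
omit [SecondCountableTopology G] [T2Space G] in
theorem QFrame.conj_hmap_povm (𝓡 : QFrame G R) (V : UnitaryRep G S) {Y : Set G}
    (hY : MeasurableSet Y) {F : S →L[ℂ] S} (hF : IsEffect F) (g : G) :
    ∃ (Y' : Set G) (F' : S →L[ℂ] S), MeasurableSet Y' ∧ IsEffect F' ∧
      (𝓡.rep.tensor V).conj g (hmap (𝓡.povm.toFun Y) F) = hmap (𝓡.povm.toFun Y') F' := by
  refine ⟨(fun x => g * x) '' Y, V.conj g F, ?_, V.isEffect_conj g hF, ?_⟩
  · rw [Set.image_mul_left]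
    exact measurable_const_mul g⁻¹ hY
  · rw [UnitaryRep.tensor_conj, 𝓡.covariant g Y hY]

variable (𝓐 : QFrame G A) (𝓑 : QFrame G B) (𝓡 : QFrame G R) (V : UnitaryRep G S)

omit [SecondCountableTopology G] [T2Space G] [BorelSpace G] [IsTopologicalGroup G] in
theorem frameOne_slot_slot (a : A) (b : B) (s : S) :
    (frameOne 𝓐 (𝓑.rep.tensor V)).split.slot a ((TensorSplit.first B S).slot b s)
      = (frameTwo 𝓐.rep 𝓑 V).split.slot b ((TensorSplit.first A S).slot a s) := by
  change toH (a ⊗ₜ[ℂ] _) = hmap _ _ (toH (a ⊗ₜ[ℂ] s))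
  rw [hmap_tmul]
  rfl

/-- The free set `𝒜` serves the singly and the doubly framed case at once; in the latter, `C`
already contains the effect of the third frame. -/
theorem frameTwo_yen_op_mem {C : S →L[ℂ] S} (hC : IsEffect C) {X : Set G} (hX : MeasurableSet X)
    {𝒜 : Set (B ⊗ₕ S →L[ℂ] B ⊗ₕ S)} (h𝒜 : ∀ (g : G) (Y : Set G), MeasurableSet Y →
      hmap (𝓑.povm.toFun Y) (V.conj g C) ∈ 𝒜) :
    (frameTwo 𝓐.rep 𝓑 V).yen (hmap (𝓐.povm.toFun X) C)
      ∈ uwSpan ((frameOne 𝓐 (𝓑.rep.tensor V)).yen '' 𝒜) := by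
  rw [← TensorSplit.first_op]
  exact InternalFrame.yen_op_mem_uwSpan (frameOne 𝓐 (𝓑.rep.tensor V)) (frameTwo 𝓐.rep 𝓑 V)
    (TensorSplit.first B S) (TensorSplit.first A S) V (frameOne_slot_slot 𝓐 𝓑 V)
    (fun g b s => 𝓑.rep.tensor_act_first V g b s) (fun g a s => 𝓐.rep.tensor_act_first V g a s)
    hC hX fun g Y hY => by rw [TensorSplit.first_op]; exact h𝒜 g Y hY

theorem frameTwo_yen_framing_subset :
    (frameTwo 𝓐.rep 𝓑 V).yen '' framing (TensorSplit.first A S) 𝓐.povm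
      ⊆ uwSpan ((frameOne 𝓐 (𝓑.rep.tensor V)).yen ''
        framing (TensorSplit.first B S) 𝓑.povm) := by
  rintro _ ⟨_, ⟨X, F, hX, hF, rfl⟩, rfl⟩
  rw [TensorSplit.first_op]
  exact frameTwo_yen_op_mem 𝓐 𝓑 V hF hX fun g Y hY =>
    ⟨Y, _, hY, V.isEffect_conj g hF, (TensorSplit.first_op _ _).symm⟩

theorem frameOne_yen_framing_subset :
    (frameOne 𝓐 (𝓑.rep.tensor V)).yen '' framing (TensorSplit.first B S) 𝓑.povm
      ⊆ uwSpan ((frameTwo 𝓐.rep 𝓑 V).yen '' framing (TensorSplit.first A S) 𝓐.povm) := by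
  rintro _ ⟨_, ⟨X, F, hX, hF, rfl⟩, rfl⟩
  exact InternalFrame.yen_op_mem_uwSpan (frameTwo 𝓐.rep 𝓑 V) (frameOne 𝓐 (𝓑.rep.tensor V))
    (TensorSplit.first A S) (TensorSplit.first B S) V
    (fun b a s => (frameOne_slot_slot 𝓐 𝓑 V a b s).symm)
    (fun g a s => 𝓐.rep.tensor_act_first V g a s) (fun g b s => 𝓑.rep.tensor_act_first V g b s)
    hF hX fun g Y hY => ⟨Y, _, hY, V.isEffect_conj g hF, rfl⟩

theorem frameTwo_yen_doubleFraming_subset :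
    (frameTwo 𝓐.rep 𝓑 (𝓡.rep.tensor V)).yen '' doubleFraming 𝓐.povm 𝓡.povm S
      ⊆ uwSpan ((frameOne 𝓐 (𝓑.rep.tensor (𝓡.rep.tensor V))).yen ''
        doubleFraming 𝓑.povm 𝓡.povm S) := by
  rintro _ ⟨_, ⟨X, Y, F, hX, hY, hF, rfl⟩, rfl⟩
  refine frameTwo_yen_op_mem 𝓐 𝓑 (𝓡.rep.tensor V)
    (isEffect_hmap (𝓡.povm.isEffect hY) hF) hX fun g Z hZ => ?_
  obtain ⟨Y', F', hY', hF', e⟩ := 𝓡.conj_hmap_povm V hY hF g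
  rw [e]
  exact ⟨Z, Y', F', hZ, hY', hF', rfl⟩

omit [SecondCountableTopology G] [T2Space G] [BorelSpace G] [IsTopologicalGroup G]
  [MeasurableSpace G] in
theorem UnitaryRep.tensor_act_skip_first (UA : UnitaryRep G A) (UR : UnitaryRep G R)
    (V : UnitaryRep G S) (g : G) (r : R) (s : A ⊗ₕ S) :
    (UA.tensor (UR.tensor V)).act g (((TensorSplit.first R S).skip A).slot r s)
      = ((TensorSplit.first R S).skip A).slot (UR.act g r) ((UA.tensor V).act g s) :=
  tensor_act_skip _ UR V (UR.tensor V) UA (UR.tensor_act_first V g) r s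

theorem frameThree_yen_framing_subset :
    (frameThree 𝓐.rep 𝓑.rep 𝓡 V).yen '' framing (TensorSplit.first A (B ⊗ₕ S)) 𝓐.povm
      ⊆ uwSpan ((frameOne 𝓐 (𝓑.rep.tensor (𝓡.rep.tensor V))).yen ''
        framing ((TensorSplit.first R S).skip B) 𝓡.povm) := by
  rintro _ ⟨_, ⟨X, F, hX, hF, rfl⟩, rfl⟩
  refine InternalFrame.yen_op_mem_uwSpan (frameOne 𝓐 (𝓑.rep.tensor (𝓡.rep.tensor V)))
    (frameThree 𝓐.rep 𝓑.rep 𝓡 V)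
    ((TensorSplit.first R S).skip B) (TensorSplit.first A (B ⊗ₕ S)) (𝓑.rep.tensor V)
    (fun a r s => ?_) (fun g r s => 𝓑.rep.tensor_act_skip_first 𝓡.rep V g r s)
    (fun g a s => 𝓐.rep.tensor_act_first (𝓑.rep.tensor V) g a s)
    hF hX fun g Y hY => ⟨Y, _, hY, (𝓑.rep.tensor V).isEffect_conj g hF, rfl⟩
  change toH (a ⊗ₜ[ℂ] _) = hmap _ _ (toH (a ⊗ₜ[ℂ] s))
  rw [hmap_tmul]
  rfl

theorem frameThree_yen_doubleFraming_subset :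
    (frameThree 𝓐.rep 𝓑.rep 𝓡 V).yen '' doubleFraming 𝓐.povm 𝓑.povm S
      ⊆ uwSpan ((frameTwo 𝓐.rep 𝓑 (𝓡.rep.tensor V)).yen ''
        doubleFraming 𝓐.povm 𝓡.povm S) := by
  rintro _ ⟨_, ⟨X, Y, F, hX, hY, hF, rfl⟩, rfl⟩
  -- Frames two and three are exchanged while frame one is a spectator, so the second factor must be
  -- the distinguished one and `E₁(X)` joins the remaining effect.
  rw [hmap_hmap_eq_skip_op]
  refine InternalFrame.yen_op_mem_uwSpan (frameTwo 𝓐.rep 𝓑 (𝓡.rep.tensor V))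
    (frameThree 𝓐.rep 𝓑.rep 𝓡 V)
    ((TensorSplit.first R S).skip A) ((TensorSplit.first B S).skip A) (𝓐.rep.tensor V)
    (fun b r s => ?_) (fun g r s => 𝓐.rep.tensor_act_skip_first 𝓡.rep V g r s)
    (fun g b s => 𝓐.rep.tensor_act_skip_first 𝓑.rep V g b s)
    (isEffect_hmap (𝓐.povm.isEffect hX) hF) hY fun g Z hZ => ?_
  · have : hmap (ContinuousLinearMap.id ℂ A) ((TensorSplit.first B (R ⊗ₕ S)).slot b) ∘L
        hmap (ContinuousLinearMap.id ℂ A) ((TensorSplit.first R S).slot r)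
        = hmap (ContinuousLinearMap.id ℂ A) (((TensorSplit.first R S).skip B).slot r) ∘L
          hmap (ContinuousLinearMap.id ℂ A) ((TensorSplit.first B S).slot b) :=
      hmap_ext fun a s => by
        simp [hmap_tmul, TensorSplit.skip_slot, TensorSplit.first_slot]
    exact congrArg (fun f => f s) this
  · obtain ⟨X', F', hX', hF', e⟩ := 𝓐.conj_hmap_povm V hX hF g
    rw [e, ← hmap_hmap_eq_skip_op]
    exact ⟨X', Z, F', hX', hZ, hF', rfl⟩

/-- This makes `¥_*` well defined on global states: states equivalent on invariant effects agree on
relativized ones. -/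
theorem frameOne_yen_subset_invariantEffects (W : UnitaryRep G K) :
    (frameOne 𝓐 W).yen '' {C | IsEffect C} ⊆ (𝓐.rep.tensor W).invariantEffects := by
  rintro _ ⟨C, hC, rfl⟩
  exact ⟨(frameOne 𝓐 W).isEffect_yen hC, fun g => (frameOne 𝓐 W).conj_yen _
    (fun g a k => 𝓐.rep.tensor_act_first W g a k) g C⟩

theorem frameTwo_yen_subset_invariantEffects (UA : UnitaryRep G A) :
    (frameTwo UA 𝓡 V).yen '' {C | IsEffect C}
      ⊆ (UA.tensor (𝓡.rep.tensor V)).invariantEffects := by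
  rintro _ ⟨C, hC, rfl⟩
  exact ⟨(frameTwo UA 𝓡 V).isEffect_yen hC, fun g => (frameTwo UA 𝓡 V).conj_yen _
    (fun g r k => UA.tensor_act_skip_first 𝓡.rep V g r k) g C⟩

omit [IsTopologicalGroup G] [SecondCountableTopology G] [T2Space G] [BorelSpace G] in
theorem opKernel_yen_le_relEffects_framing (F : InternalFrame G R K T)
    {R' S : Type*} [NormedAddCommGroup R'] [InnerProductSpace ℂ R'] [CompleteSpace R']
    [NormedAddCommGroup S] [InnerProductSpace ℂ S] [CompleteSpace S]
    (D : TensorSplit R' S K) (E : POVM G R') :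
    opKernel (F.yen '' {C | IsEffect C}) ≤ opKernel (F.relEffects (framing D E)) :=
  opKernel_le_of_subset_uwSpan fun _ hB =>
    (F.relEffects_mono (fun _ hC => isEffect_of_mem_framing hC) hB).1

end Concrete

theorem opKernel_anti {T : Type*} [NormedAddCommGroup T] [InnerProductSpace ℂ T] [CompleteSpace T]
    {O O' : Set (T →L[ℂ] T)} (h : O' ⊆ O) : opKernel O ≤ opKernel O' :=
  fun _ hΩ F hF => hΩ F (h hF)

end

end QRF

/-! ### Assembly of the three statements. -/

theorem mainTheorem1
    {G : Type*} [Group G] [TopologicalSpace G] [IsTopologicalGroup G] [LocallyCompactSpace G]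
    [SecondCountableTopology G] [T2Space G] [MeasurableSpace G] [BorelSpace G]
    {H₁ H₂ Hₛ : Type*}
    [NormedAddCommGroup H₁] [InnerProductSpace ℂ H₁] [CompleteSpace H₁] [SeparableSpace H₁]
    [NormedAddCommGroup H₂] [InnerProductSpace ℂ H₂] [CompleteSpace H₂] [SeparableSpace H₂]
    [NormedAddCommGroup Hₛ] [InnerProductSpace ℂ Hₛ] [CompleteSpace Hₛ] [SeparableSpace Hₛ]
    (R₁ : QFrame G H₁) (R₂ : QFrame G H₂) (Uₛ : UnitaryRep G Hₛ) (hR₁ : R₁.Localizable) :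
    (let F₁ := frameOne R₁ (R₂.rep.tensor Uₛ)
     let F₂ := frameTwo R₁.rep R₂ Uₛ
     let O₁₂ := F₁.relEffects (framing (TensorSplit.first H₂ Hₛ) R₂.povm)
     let O₂₁ := F₂.relEffects (framing (TensorSplit.first H₁ Hₛ) R₁.povm)
     let O₁ := F₁.yen '' {A | IsEffect A}
     let O₂ := F₂.yen '' {A | IsEffect A}
     let OG := (R₁.rep.tensor (R₂.rep.tensor Uₛ)).invariantEffects
     ∃ Φ₁₂ : OpStates O₁₂ → OpStates O₂₁,
      F₁.IsFrameChange Φ₁₂ ∧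
      (∃ (y₁ : OpStates OG → OpStates O₁) (π₂ : OpStates O₁ → OpStates O₁₂)
         (y₂ : OpStates OG → OpStates O₂) (π₁ : OpStates O₂ → OpStates O₂₁),
        IsProjection y₁ ∧ IsProjection π₂ ∧ IsProjection y₂ ∧ IsProjection π₁ ∧
        ∀ x, Φ₁₂ (π₂ (y₁ x)) = π₁ (y₂ x)) ∧
      (R₂.Localizable → ∃ Φ₂₁ : OpStates O₂₁ → OpStates O₁₂,
        F₂.IsFrameChange Φ₂₁ ∧ (∀ x, Φ₂₁ (Φ₁₂ x) = x) ∧ (∀ x, Φ₁₂ (Φ₂₁ x) = x))) ∧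
    (R₂.Localizable →
      ∀ {H₃ : Type*} [NormedAddCommGroup H₃] [InnerProductSpace ℂ H₃] [CompleteSpace H₃]
        [SeparableSpace H₃] (R₃ : QFrame G H₃),
      let F₁ := frameOne R₁ (R₂.rep.tensor (R₃.rep.tensor Uₛ))
      let F₂ := frameTwo R₁.rep R₂ (R₃.rep.tensor Uₛ)
      let F₃ := frameThree R₁.rep R₂.rep R₃ Uₛ
      let O₁₂ := F₁.relEffects (framing (TensorSplit.first H₂ (H₃ ⊗ₕ Hₛ)) R₂.povm)
      let O₂₁ := F₂.relEffects (framing (TensorSplit.first H₁ (H₃ ⊗ₕ Hₛ)) R₁.povm)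
      let O₁₃ := F₁.relEffects (framing ((TensorSplit.first H₃ Hₛ).skip H₂) R₃.povm)
      let O₃₁ := F₃.relEffects (framing (TensorSplit.first H₁ (H₂ ⊗ₕ Hₛ)) R₁.povm)
      let O₁₂₃ := F₁.relEffects (doubleFraming R₂.povm R₃.povm Hₛ)
      let O₂₁₃ := F₂.relEffects (doubleFraming R₁.povm R₃.povm Hₛ)
      let O₃₁₂ := F₃.relEffects (doubleFraming R₁.povm R₂.povm Hₛ)
      ∃ (Φ₁₂ : OpStates O₁₂ → OpStates O₂₁) (Φ₁₂' : OpStates O₁₂₃ → OpStates O₂₁₃)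
        (Φ₁₃ : OpStates O₁₃ → OpStates O₃₁) (Φ₂₃ : OpStates O₂₁₃ → OpStates O₃₁₂)
        (π₂ : OpStates O₃₁ → OpStates O₃₁₂) (π₂' : OpStates O₁₃ → OpStates O₁₂₃)
        (π₃ : OpStates O₂₁ → OpStates O₂₁₃),
        F₁.IsFrameChange Φ₁₂ ∧ F₁.IsFrameChange Φ₁₂' ∧ F₁.IsFrameChange Φ₁₃ ∧
        F₂.IsFrameChange Φ₂₃ ∧
        IsProjection π₂ ∧ IsProjection π₂' ∧ IsProjection π₃ ∧
        (∀ Ω, π₂ (Φ₁₃ (opState O₁₃ Ω)) = Φ₂₃ (π₃ (Φ₁₂ (opState O₁₂ Ω)))) ∧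
        (∀ x, π₂ (Φ₁₃ x) = Φ₂₃ (Φ₁₂' (π₂' x)))) := by
  refine ⟨?_, ?_⟩
  · intro F₁ F₂ O₁₂ O₂₁ O₁ O₂ OG
    obtain ⟨Φ₁₂, hΦ₁₂, hp₁₂⟩ := F₁.exists_isFrameChange F₂ hR₁
      (fun _ => isEffect_of_mem_framing) (frameTwo_yen_framing_subset R₁ R₂ Uₛ)
    refine ⟨Φ₁₂, hΦ₁₂, ⟨opProj (opKernel_anti (frameOne_yen_subset_invariantEffects R₁ _)),
      opProj (opKernel_yen_le_relEffects_framing F₁ _ _),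
      opProj (opKernel_anti (frameTwo_yen_subset_invariantEffects R₂ Uₛ R₁.rep)),
      opProj (opKernel_yen_le_relEffects_framing F₂ _ _), isProjection_opProj _,
      isProjection_opProj _, isProjection_opProj _, isProjection_opProj _, fun x => ?_⟩,
      fun hR₂ => ?_⟩
    -- Every map involved sends the class of `Ω` to the class of `Ω`, so both sides are the same
    -- class.
    · obtain ⟨Ω, rfl⟩ := exists_opState_eq x
      simp only [isProjection_opProj _ Ω]
      exact hp₁₂ Ω
    · obtain ⟨Φ₂₁, hΦ₂₁, hp₂₁⟩ := F₂.exists_isFrameChange F₁ hR₂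
        (fun _ => isEffect_of_mem_framing) (frameOne_yen_framing_subset R₁ R₂ Uₛ)
      refine ⟨Φ₂₁, hΦ₂₁, fun x => ?_, fun x => ?_⟩
      · obtain ⟨Ω, rfl⟩ := exists_opState_eq x
        rw [hp₁₂ Ω]
        exact hp₂₁ Ω
      · obtain ⟨Ω, rfl⟩ := exists_opState_eq x
        rw [hp₂₁ Ω]
        exact hp₁₂ Ω
  · intro hR₂ H₃ _ _ _ _ R₃ F₁ F₂ F₃ O₁₂ O₂₁ O₁₃ O₃₁ O₁₂₃ O₂₁₃ O₃₁₂
    obtain ⟨Φ₁₂, hΦ₁₂, hp₁₂⟩ := F₁.exists_isFrameChange F₂ hR₁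
      (fun _ => isEffect_of_mem_framing) (frameTwo_yen_framing_subset R₁ R₂ (R₃.rep.tensor Uₛ))
    obtain ⟨Φ₁₂', hΦ₁₂', hp₁₂'⟩ := F₁.exists_isFrameChange F₂ hR₁
      (fun _ => isEffect_of_mem_doubleFraming) (frameTwo_yen_doubleFraming_subset R₁ R₂ R₃ Uₛ)
    obtain ⟨Φ₁₃, hΦ₁₃, hp₁₃⟩ := F₁.exists_isFrameChange F₃ hR₁
      (fun _ => isEffect_of_mem_framing) (frameThree_yen_framing_subset R₁ R₂ R₃ Uₛ)
    obtain ⟨Φ₂₃, hΦ₂₃, hp₂₃⟩ := F₂.exists_isFrameChange F₃ hR₂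
      (fun _ => isEffect_of_mem_doubleFraming) (frameThree_yen_doubleFraming_subset R₁ R₂ R₃ Uₛ)
    refine ⟨Φ₁₂, Φ₁₂', Φ₁₃, Φ₂₃,
      opProj (opKernel_anti (F₃.relEffects_mono (doubleFraming_subset_framing_first _ _))),
      opProj (opKernel_anti (F₁.relEffects_mono (doubleFraming_subset_framing_skip _ _))),
      opProj (opKernel_anti (F₂.relEffects_mono (doubleFraming_subset_framing_first _ _))),
      hΦ₁₂, hΦ₁₂', hΦ₁₃, hΦ₂₃, isProjection_opProj _, isProjection_opProj _,
      isProjection_opProj _, fun Ω => ?_, fun x => ?_⟩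
    -- Both composites end at the class of `Ω` in the doubly framed states of frame three.
    · rw [hp₁₃ Ω, hp₁₂ Ω, isProjection_opProj _ Ω, isProjection_opProj _ Ω]
      exact (hp₂₃ Ω).symm
    · obtain ⟨Ω, rfl⟩ := exists_opState_eq x
      rw [hp₁₃ Ω, isProjection_opProj _ Ω, isProjection_opProj _ Ω, hp₁₂' Ω]
      exact (hp₂₃ Ω).symm
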